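/- **Setting.** Let $q$ be a power of a prime $p$ and let $G_q=PGL(2,q)$ act on $PG(3,q)$ by the collineations extending $(x^3,x^2,x,1)\mapsto((ax+b)^3,(ax+b)^2(cx+d),(ax+b)(cx+d)^2,(cx+d)^3)$, so that it preserves the twisted cubic $\mathcal C_3(q)$ with points $P(x)=(x^3:x^2:x:1)$ for $x\in\mathbb F_q$ and $P(\infty)=(1:0:0:0)$. The osculating planes are $\pi(x):X_0-3xX_1+3x^2X_2-x^3X_3=0$ and $\pi(\infty):X_3=0$; the tangents are $\langle(x^3,x^2,x,1),(3x^2,2x,1,0)\rangle$ and $\langle(1,0,0,0),(0,1,0,0)\rangle$ (at $P(\infty)$). A real chord (real axis) is the join of two different points of $\mathcal C_3(q)$ (the intersection of two different osculating planes $\pi(x)$, $x\in\mathbb F_q\cup\{\infty\}$). An imaginary chord (imaginary axis) is a line of $PG(3,q)$ whose extension to $\overline{\mathbb F}_q$ is the join of $P(\xi)$ and $P(\xi^q)$ (the intersection of $\pi(\xi)$ and $\pi(\xi^q)$) for some $\xi\in\mathbb F_{q^2}\setminus\mathbb F_q$. A unisecant (passant) is a line with exactly one (no) point of $\mathcal C_3(q)$;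 a unisecant is true if it is not a tangent, a passant is true if it is not an imaginary chord. "In an osculating plane" refers to the planes $\pi(x)$ with $x\in\mathbb F_q\cup\{\infty\}$. For $p=3$ the axis of the osculating developable is the intersection of all the planes $\pi(x)$. A line $\{\sum f_jX_j=\sum g_jX_j=0\}$ corresponds to the rational function $\varphi=f/g$ of degree $3$ on $\mathbb P^1$, where $f=\sum_{j=0}^3 f_jx^{3-j}$, $g=\sum_{j=0}^3 g_jx^{3-j}$ (viewed as binary cubic forms; $\varphi$ depends on the choice of the equations, i.e. it is determined up to composition on the left with $PGL(2,q)$). $B_\varphi$ is the divisor of the greatest common divisor of the two cubic forms, and $\tilde\varphi:\mathbb P^1\to\mathbb P^1$ is the morphism obtained by cancelling it. For $\tilde\varphi$ separable, $R=\sum_P(e_P-1)P$ and $D=\sum_P d_PP$ are its ramification and different divisors, the sums running over the places $P$ of $\mathbb P^1$ over $\mathbb F_q$: $e_P$ is the order at $P$ of the pull back $y$ of a local parameter at $\tilde\varphi(P)$, and $d_P$ is the order at $P$ of $dy/dx$ for a local parameter $x$ at $P$. A morphism is simple if all its ramification places have $e_P=2$ and distinct ramification places have distinct images. Let $P_a=(a:1)$,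 $P_\infty=(1:0)$. For a non-square $m$ let $Q_m$ be the place of degree 2 of $x^2-m$. Let $x^2+x+n$ be irreducible over $\mathbb F_q$ and let $Q$ be its place. Fix $d$ (if $p\neq2$), $v$ (if $p\ne2,3$) and $u$ (if $p=3$) such that $d$, $3v$ and $u$ are non-squares. **Classes.** * $\mathcal O_1$ real chords; $\mathcal O_2$ tangents; $\mathcal O_3$ imaginary chords. * $\mathcal O_1'$ real axes and $\mathcal O_3'$ imaginary axes ($p\ne3$). * $\mathcal O_4$ true unisecants in an osculating plane ($p\neq2$). For $p=2$ instead: $\mathcal O_4^-(2)$, the lines $G_q$-equivalent to $\langle(0,1,0,0),(0,0,0,1)\rangle$, and $\mathcal O_4^+(2)$, those $G_q$-equivalent to $\langle(0,1,w,0),(0,0,0,1)\rangle$ for some $w\ne0$. * For $p=2$: $\mathcal O_5(2)$, the unisecants not in an osculating plane. For $p\ne2$: $\mathcal O_5^-$ (resp. $\mathcal O_5^+$), the lines $G_q$-equivalent to $\langle(-c,0,1,0),(0,0,0,1)\rangle$ for some non-square (resp. non-zero square) $c$. * For $p=2$: $\mathcal O_5'(2)$, the true passants in an osculating plane that are not real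 axes. For $p\neq2,3$: $\mathcal O_5'^-$ (resp. $\mathcal O_5'^+$), the lines $G_q$-equivalent to $\langle(0,0,1,0),(0,c,0,1)\rangle$ for some $c$ with $3c$ a non-square (resp. non-zero square). * $\mathcal O_6$: the true passants that are not in an osculating plane and are not imaginary axes. * For $p=3$: $\mathcal O_7(3)$, consisting of the axis of the osculating developable; $\mathcal O_{8.1}^-(3)$ (resp. $\mathcal O_{8.1}^+(3)$), the lines $G_q$-equivalent to $\langle(0,1,0,0),(c,0,1,0)\rangle$ for some non-square (resp. non-zero square) $c$; $\mathcal O_{8.2}(3)$, the lines $G_q$-equivalent to $\langle(w,1,0,0),(0,0,1,0)\rangle$ for some $w\neq0$. **Theorem.** (i) The classes occurring for the given characteristic partition the set of lines of $PG(3,q)$. Moreover, for $p=2$ the true unisecants in an osculating plane are $\mathcal O_4^-(2)\cup\mathcal O_4^+(2)$; for $p\ne2$ the unisecants not in an osculating plane are $\mathcal O_5^-\cup\mathcal O_5^+$; for $p\ne2,3$ the true passants in an osculating plane that are not real axes are $\mathcal O_5'^-\cup\mathcal O_5'^+$; for $p=3$ the passants that meet the axis of the osculating developable and are different from it are $\mathcal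 O_{8.1}^-(3)\cup\mathcal O_{8.1}^+(3)\cup\mathcal O_{8.2}(3)$. (ii) Every occurring class except $\mathcal O_6$ is a single $G_q$-orbit, of the size given in the table; the given line $\mathcal L$ is a representative, the given $\varphi$ corresponds to $\mathcal L$ and has the given base divisor, and $\tilde\varphi$ is separable with the given $R$ and $D$, or is purely inseparable where the table says so. $$ \begin{array}{l|l|l|l|l|l|l} \text{Class}&\text{Size}&\mathcal L&\varphi&B_\varphi&R&D\\ \hline \mathcal O_1&\frac12(q^2+q)&\langle(1,0,0,0),(0,0,0,1)\rangle&x^2/x&P_0+P_\infty&0&0\\ \mathcal O_1'&\frac12(q^2+q)&\langle(0,1,0,0),(0,0,1,0)\rangle&x^3/1&0&2P_0+2P_\infty&2P_0+2P_\infty\\ \mathcal O_2&q+1&\langle(0,0,1,0),(0,0,0,1)\rangle&x^3/x^2&2P_0&0&0\\ \mathcal O_3&\frac12(q^2-q)&\langle(n,-n,0,1),(1-n,-1,1,0)\rangle&(x^3+(n-1)x-n)/(x^2+x+n)&Q&0&0\\ \mathcal O_3'&\frac12(q^2-q)&\langle(3n,n-1,0,3),(3n,-1,1,0)\rangle&(x^3-3nx-n)/(x^2+x+\frac13(1-n))&0&2Q&2Q\\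 \mathcal O_4&q^2+q&\langle(0,1,0,0),(0,0,0,1)\rangle&x^3/x&P_0&P_0+P_\infty&P_0+P_\infty\\ \mathcal O_4^-(2)&q+1&\langle(0,1,0,0),(0,0,0,1)\rangle&x^3/x&P_0&\text{purely insep.}&\\ \mathcal O_4^+(2)&q^2-1&\langle(0,1,1,0),(0,0,0,1)\rangle&x^3/(x^2+x)&P_0&P_0&2P_0\\ \mathcal O_5^-&\frac12(q^3-q)&\langle(-d,0,1,0),(0,0,0,1)\rangle&(x^3+dx)/x^2&P_0&Q_d&Q_d\\ \mathcal O_5^+&\frac12(q^3-q)&\langle(-1,0,1,0),(0,0,0,1)\rangle&(x^3+x)/x^2&P_0&P_1+P_{-1}&P_1+P_{-1}\\ \mathcal O_5(2)&q^3-q&\langle(1,0,1,0),(0,0,0,1)\rangle&(x^3+x)/x^2&P_0&P_1&2P_1\\ \mathcal O_5'^-&\frac12(q^3-q)&\langle(0,0,1,0),(0,v,0,1)\rangle&x^3/(x^2-v)&0&Q_{3v}+2P_0&Q_{3v}+2P_0\\ \mathcal O_5'^+&\frac12(q^3-q)&\langle(0,0,1,0),(0,\frac13,0,1)\rangle&x^3/(x^2-\frac13)&0&P_1+P_{-1}+2P_0&P_1+P_{-1}+2P_0\\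 \mathcal O_5'(2)&q^3-q&\langle(0,0,1,0),(0,1,0,1)\rangle&x^3/(x^2+1)&0&P_1+2P_0&2P_1+2P_0\\ \mathcal O_7(3)&1&\langle(0,1,0,0),(0,0,1,0)\rangle&x^3/1&0&\text{purely insep.}&\\ \mathcal O_{8.1}^-(3)&\frac12(q^2-1)&\langle(0,1,0,0),(u,0,1,0)\rangle&(x^3-ux)/1&0&2P_\infty&4P_\infty\\ \mathcal O_{8.1}^+(3)&\frac12(q^2-1)&\langle(0,1,0,0),(1,0,1,0)\rangle&(x^3-x)/1&0&2P_\infty&4P_\infty\\ \mathcal O_{8.2}(3)&q^3-q&\langle(1,1,0,0),(0,0,1,0)\rangle&(x^3-x^2)/1&0&P_0+2P_\infty&P_0+3P_\infty \end{array} $$ (iii) $|\mathcal O_6|=q^4-q^3-q^2+q$, and every rational function corresponding to a line of $\mathcal O_6$ has base divisor $0$ and is a separable simple morphism. -/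

import Mathlib

open Polynomial
open scoped MatrixGroups IntermediateField

noncomputable section

namespace TwistedCubic

/-! ### The twisted cubic and its osculating planes

Subspaces of projective three space over `K` are linear subspaces of `Fin 4 → K`; a line is a
subspace of vector space dimension `2`.  A parameter in `Option K` is a point of the projective
line, `none` being the point at infinity. -/

section Geometry

variable {K : Type*} [Field K]

/-- The point `P(x) = (x³ : x² : x : 1)`, `P(∞) = (1 : 0 : 0 : 0)` of the twisted cubic. -/
def cubicPoint : Option K → Fin 4 → K
  | some x => ![x ^ 3, x ^ 2, x, 1]
  | none => ![1, 0, 0, 0]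

/-- The plane `[c₀ : c₁ : c₂ : c₃]`, that is `c₀ X₀ + c₁ X₁ + c₂ X₂ + c₃ X₃ = 0`. -/
def plane (c : Fin 4 → K) : Submodule K (Fin 4 → K) where
  carrier := {v | c ⬝ᵥ v = 0}
  add_mem' := by
    intro a b ha hb
    simp only [Set.mem_ofPred_eq] at ha hb ⊢
    rw [dotProduct_add, ha, hb, add_zero]
  zero_mem' := by simp
  smul_mem' := by
    intro r a ha
    simp only [Set.mem_ofPred_eq] at ha ⊢
    rw [dotProduct_smul, ha, smul_zero]

/-- The osculating plane of the twisted cubic at a point. -/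
def osculatingPlane : Option K → Submodule K (Fin 4 → K)
  | some x => plane ![1, -3 * x, 3 * x ^ 2, -x ^ 3]
  | none => plane ![0, 0, 0, 1]

/-- The line spanned by two vectors (a line when they are linearly independent). -/
def join (v w : Fin 4 → K) : Submodule K (Fin 4 → K) :=
  Submodule.span K {v, w}

/-- The tangent line of the twisted cubic at a point. -/
def tangentLine : Option K → Submodule K (Fin 4 → K)
  | some x => join ![x ^ 3, x ^ 2, x, 1] ![3 * x ^ 2, 2 * x, 1, 0]
  | none => join ![1, 0, 0, 0] ![0, 1, 0, 0]

/-- The lines of projective three space. -/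
def IsLine (L : Submodule K (Fin 4 → K)) : Prop :=
  Module.finrank K L = 2

/-- The extension of a subspace to the algebraic closure of the base field. -/
def extend (L : Submodule K (Fin 4 → K)) :
    Submodule (AlgebraicClosure K) (Fin 4 → AlgebraicClosure K) :=
  Submodule.span (AlgebraicClosure K)
    ((fun (v : Fin 4 → K) (i : Fin 4) => algebraMap K (AlgebraicClosure K) (v i)) '' L)

end Geometry

/-! ### The action of `PGL(2, F)` -/

section Action

variable {F : Type*} [Field F]

/-- The matrix of the collineation
`(x³, x², x, 1) ↦ ((ax+b)³, (ax+b)²(cx+d), (ax+b)(cx+d)², (cx+d)³)`. -/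
def cubicMatrix (g : Matrix (Fin 2) (Fin 2) F) : Matrix (Fin 4) (Fin 4) F :=
  let a := g 0 0
  let b := g 0 1
  let c := g 1 0
  let d := g 1 1
  !![a ^ 3, 3 * a ^ 2 * b, 3 * a * b ^ 2, b ^ 3;
     a ^ 2 * c, a ^ 2 * d + 2 * a * b * c, b ^ 2 * c + 2 * a * b * d, b ^ 2 * d;
     a * c ^ 2, b * c ^ 2 + 2 * a * c * d, a * d ^ 2 + 2 * b * c * d, b * d ^ 2;
     c ^ 3, 3 * c ^ 2 * d, 3 * c * d ^ 2, d ^ 3]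

theorem cubicMatrix_one : cubicMatrix (1 : Matrix (Fin 2) (Fin 2) F) = 1 := by
  ext i j
  fin_cases i <;> fin_cases j <;> simp [cubicMatrix]

theorem cubicMatrix_mul (g h : Matrix (Fin 2) (Fin 2) F) :
    cubicMatrix (g * h) = cubicMatrix g * cubicMatrix h := by
  ext i j
  fin_cases i <;> fin_cases j <;>
    simp [cubicMatrix, Matrix.mul_apply, Fin.sum_univ_succ] <;> ring

theorem cubicMatrix_scalar (r : F) :
    cubicMatrix (Matrix.scalar (Fin 2) r) = Matrix.scalar (Fin 4) (r ^ 3) := by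
  ext i j
  fin_cases i <;> fin_cases j <;> simp [cubicMatrix] <;> ring

/-- The action of `GL(2, F)` on subspaces through the collineations `cubicMatrix g`. -/
instance cubicActionGL : MulAction (GL (Fin 2) F) (Submodule F (Fin 4 → F)) where
  smul g L := L.map (Matrix.mulVecLin (cubicMatrix g.val))
  one_smul L := by
    change L.map (Matrix.mulVecLin (cubicMatrix (1 : Matrix (Fin 2) (Fin 2) F))) = L
    rw [cubicMatrix_one, Matrix.mulVecLin_one, Submodule.map_id]
  mul_smul g h L := by
    change L.map (Matrix.mulVecLin (cubicMatrix (g.val * h.val)))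
      = (L.map (Matrix.mulVecLin (cubicMatrix h.val))).map (Matrix.mulVecLin (cubicMatrix g.val))
    rw [cubicMatrix_mul, Matrix.mulVecLin_mul, Submodule.map_comp]

/-- The action of `PGL(2, F)` on the subspaces of projective three space. -/
instance cubicActionPGL : MulAction PGL(2, F) (Submodule F (Fin 4 → F)) :=
  Matrix.ProjGenLinGroup.mulActionOfGL fun u L => by
    change L.map (Matrix.mulVecLin (cubicMatrix (Matrix.scalar (Fin 2) (u : F)))) = L
    rw [cubicMatrix_scalar]
    have h : Matrix.mulVecLin (Matrix.scalar (Fin 4) ((u : F) ^ 3))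
        = ((u : F) ^ 3) • (LinearMap.id : (Fin 4 → F) →ₗ[F] (Fin 4 → F)) := by
      ext v i
      simp [Matrix.mulVec_diagonal, Pi.single_apply]
    rw [h, Submodule.map_smul _ _ _ (pow_ne_zero 3 u.ne_zero), Submodule.map_id]

/-- `L` is equivalent under `PGL(2, F)` to the line spanned by `v` and `w`. -/
def EquivJoin (L : Submodule F (Fin 4 → F)) (v w : Fin 4 → F) : Prop :=
  L ∈ MulAction.orbit PGL(2, F) (join v w)

end Action

/-! ### The kinds of lines -/

section Lines

variable {F : Type*} [Field F]

/-- Real chords: joins of two different rational points of the twisted cubic. -/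
def IsRealChord (L : Submodule F (Fin 4 → F)) : Prop :=
  ∃ x y : Option F, x ≠ y ∧ L = join (cubicPoint x) (cubicPoint y)

/-- Tangents at rational points. -/
def IsTangent (L : Submodule F (Fin 4 → F)) : Prop :=
  ∃ x : Option F, L = tangentLine x

/-- `ξ` and `ξ ^ q` are two conjugate elements of `𝔽_{q²} \ 𝔽_q`, where `q = |F|`. -/
def IsQuadraticNonrational (ξ : AlgebraicClosure F) : Prop :=
  ξ ^ (Nat.card F ^ 2) = ξ ∧ ξ ^ Nat.card F ≠ ξ

/-- Imaginary chords: rational lines whose extension joins two conjugate points of the twisted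
cubic defined over `𝔽_{q²}`. -/
def IsImaginaryChord (L : Submodule F (Fin 4 → F)) : Prop :=
  IsLine L ∧ ∃ ξ : AlgebraicClosure F, IsQuadraticNonrational ξ ∧
    extend L = join (cubicPoint (some ξ)) (cubicPoint (some (ξ ^ Nat.card F)))

/-- Real axes: intersections of two different rational osculating planes. -/
def IsRealAxis (L : Submodule F (Fin 4 → F)) : Prop :=
  ∃ x y : Option F, x ≠ y ∧ L = osculatingPlane x ⊓ osculatingPlane y

/-- Imaginary axes: rational lines whose extension is the intersection of the osculating planes at
two conjugate points of the twisted cubic defined over `𝔽_{q²}`. -/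
def IsImaginaryAxis (L : Submodule F (Fin 4 → F)) : Prop :=
  IsLine L ∧ ∃ ξ : AlgebraicClosure F, IsQuadraticNonrational ξ ∧
    extend L = osculatingPlane (some ξ) ⊓ osculatingPlane (some (ξ ^ Nat.card F))

/-- The line lies in an osculating plane at a rational point. -/
def InOsculatingPlane (L : Submodule F (Fin 4 → F)) : Prop :=
  ∃ x : Option F, L ≤ osculatingPlane x

/-- Unisecants: lines with exactly one rational point of the twisted cubic. -/
def IsUnisecant (L : Submodule F (Fin 4 → F)) : Prop :=
  IsLine L ∧ ∃! x : Option F, cubicPoint x ∈ L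

/-- True unisecants: unisecants that are not tangents. -/
def IsTrueUnisecant (L : Submodule F (Fin 4 → F)) : Prop :=
  IsUnisecant L ∧ ¬ IsTangent L

/-- Passants: lines without rational points of the twisted cubic. -/
def IsPassant (L : Submodule F (Fin 4 → F)) : Prop :=
  IsLine L ∧ ∀ x : Option F, cubicPoint x ∉ L

/-- True passants: passants that are not imaginary chords. -/
def IsTruePassant (L : Submodule F (Fin 4 → F)) : Prop :=
  IsPassant L ∧ ¬ IsImaginaryChord L

variable (F) in
/-- The intersection of all rational osculating planes (a line in characteristic `3`). -/
def axisOfDevelopable : Submodule F (Fin 4 → F) :=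
  ⨅ x : Option F, osculatingPlane x

variable (F) in
/-- True unisecants in an osculating plane. -/
def unisecantsInOsc : Set (Submodule F (Fin 4 → F)) :=
  {L | IsTrueUnisecant L ∧ InOsculatingPlane L}

variable (F) in
/-- Unisecants not in an osculating plane. -/
def unisecantsNotInOsc : Set (Submodule F (Fin 4 → F)) :=
  {L | IsUnisecant L ∧ ¬ InOsculatingPlane L}

variable (F) in
/-- True passants in an osculating plane, other than the real axes. -/
def passantsInOsc : Set (Submodule F (Fin 4 → F)) :=
  {L | IsTruePassant L ∧ InOsculatingPlane L ∧ ¬ IsRealAxis L}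

variable (F) in
/-- True passants not in an osculating plane, other than the imaginary axes. -/
def passantsNotInOsc : Set (Submodule F (Fin 4 → F)) :=
  {L | IsTruePassant L ∧ ¬ InOsculatingPlane L ∧ ¬ IsImaginaryAxis L}

variable (F) in
/-- Passants different from the axis of the osculating developable and meeting it (used in
characteristic `3`). -/
def passantsMeetingAxis : Set (Submodule F (Fin 4 → F)) :=
  {L | IsPassant L ∧ L ≠ axisOfDevelopable F ∧ L ⊓ axisOfDevelopable F ≠ ⊥}

end Lines

/-! ### The classes of lines -/

/-- The classes of lines.  A suffix `'` of the usual notation is written `d` (dual), a suffix `(p)`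
is written `charp`, and the signs `-`, `+` are written `minus`, `plus`. -/
inductive LineClass
  | O1 | O1d | O2 | O3 | O3d
  | O4 | O4minus_char2 | O4plus_char2
  | O5minus | O5plus | O5_char2
  | O5dminus | O5dplus | O5d_char2
  | O6
  | O7_char3 | O81minus_char3 | O81plus_char3 | O82_char3

namespace LineClass

/-- The characteristics `p` in which a class occurs. -/
def Occurs (p : ℕ) : LineClass → Prop
  | O1 | O2 | O3 | O6 => True
  | O1d | O3d => p ≠ 3
  | O4 | O5minus | O5plus => p ≠ 2
  | O5dminus | O5dplus => p ≠ 2 ∧ p ≠ 3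
  | O4minus_char2 | O4plus_char2 | O5_char2 | O5d_char2 => p = 2
  | O7_char3 | O81minus_char3 | O81plus_char3 | O82_char3 => p = 3

/-- The set of lines of each class.  The classes that subdivide a kind of lines are given by the
form to which a line can be brought by the group, the form depending on a free parameter. -/
def lines (F : Type*) [Field F] : LineClass → Set (Submodule F (Fin 4 → F))
  | O1 => {L | IsRealChord L}
  | O1d => {L | IsRealAxis L}
  | O2 => {L | IsTangent L}
  | O3 => {L | IsImaginaryChord L}
  | O3d => {L | IsImaginaryAxis L}
  | O4 => unisecantsInOsc F
  | O4minus_char2 => {L | EquivJoin L ![0, 1, 0, 0] ![0, 0, 0, 1]}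
  | O4plus_char2 => {L | ∃ w : F, w ≠ 0 ∧ EquivJoin L ![0, 1, w, 0] ![0, 0, 0, 1]}
  | O5minus => {L | ∃ d : F, ¬ IsSquare d ∧ EquivJoin L ![-d, 0, 1, 0] ![0, 0, 0, 1]}
  | O5plus => {L | ∃ d : F, d ≠ 0 ∧ IsSquare d ∧ EquivJoin L ![-d, 0, 1, 0] ![0, 0, 0, 1]}
  | O5_char2 => unisecantsNotInOsc F
  | O5dminus => {L | ∃ v : F, ¬ IsSquare (3 * v) ∧ EquivJoin L ![0, 0, 1, 0] ![0, v, 0, 1]}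
  | O5dplus =>
      {L | ∃ v : F, v ≠ 0 ∧ IsSquare (3 * v) ∧ EquivJoin L ![0, 0, 1, 0] ![0, v, 0, 1]}
  | O5d_char2 => passantsInOsc F
  | O6 => passantsNotInOsc F
  | O7_char3 => {axisOfDevelopable F}
  | O81minus_char3 => {L | ∃ u : F, ¬ IsSquare u ∧ EquivJoin L ![0, 1, 0, 0] ![u, 0, 1, 0]}
  | O81plus_char3 =>
      {L | ∃ u : F, u ≠ 0 ∧ IsSquare u ∧ EquivJoin L ![0, 1, 0, 0] ![u, 0, 1, 0]}
  | O82_char3 => {L | ∃ w : F, w ≠ 0 ∧ EquivJoin L ![w, 1, 0, 0] ![0, 0, 1, 0]}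

end LineClass

/-! ### Places and divisors of the projective line -/

section Places

variable (F : Type*) [Field F]

/-- The places of the projective line over `F`: the monic irreducible polynomials and `∞`. -/
inductive Place
  | finite (p : F[X]) (monic : p.Monic) (irreducible : Irreducible p)
  | infinity

/-- Divisors on the projective line. -/
abbrev Divisor : Type _ := Place F →₀ ℤ

variable {F}

/-- The rational place `P_a = (a : 1)`. -/
def placeAt (a : F) : Place F :=
  .finite (X - C a) (monic_X_sub_C a) (irreducible_X_sub_C a)

/-- The place of degree `2` given by an irreducible polynomial `x² + x + n`. -/
def placeQ (n : F) (hn : Irreducible (X ^ 2 + X + C n : F[X])) : Place F :=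
  .finite (X ^ 2 + X + C n) (by monicity!) hn

/-- The place of degree `2` given by the polynomial `x² - d` for a non-square `d`. -/
def placeSqrt (d : F) (hd : ¬ IsSquare d) : Place F :=
  .finite (X ^ 2 - C d) (monic_X_pow_sub_C d two_ne_zero)
    (X_pow_sub_C_irreducible_of_prime Nat.prime_two fun b hb => hd ⟨b, by rw [← hb, sq]⟩)

/-- The divisor `m P`. -/
def mult (m : ℤ) (P : Place F) : Divisor F := Finsupp.single P m

/-- The order of vanishing of a nonzero rational function at a place. -/
def Place.ord : Place F → RatFunc F → ℤ
  | .finite p _ _, r => (multiplicity p r.num : ℤ) - (multiplicity p r.denom : ℤ)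
  | .infinity, r => -r.intDegree

/-- The value of `r = r.num / r.denom` in the residue field `F[X] / (p)` of a finite place `p` that
is not a pole of `r`. -/
def residue (p : F[X]) (hp : Irreducible p) (r : RatFunc F) : AdjoinRoot p :=
  haveI : Fact (Irreducible p) := ⟨hp⟩
  AdjoinRoot.mk p r.num / AdjoinRoot.mk p r.denom

theorem residue_isIntegral (p : F[X]) (hp : Irreducible p) (r : RatFunc F) :
    IsIntegral F (residue p hp r) := by
  have : Module.Finite F (AdjoinRoot p) := (AdjoinRoot.powerBasis hp.ne_zero).finite
  exact Algebra.IsIntegral.isIntegral _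

open scoped Classical in
/-- The image of a place under the morphism `φ` of the projective line.  At a finite place that is
not a pole it is the place of the minimal polynomial of the value of `φ` in the residue field; at
`∞` the value is a quotient of leading coefficients (`φ.denom` is monic). -/
def Place.image (φ : RatFunc F) : Place F → Place F
  | .finite p _ hp =>
      if p ∣ φ.denom then .infinity
      else
        haveI : Fact (Irreducible p) := ⟨hp⟩
        .finite (minpoly F (residue p hp φ)) (minpoly.monic (residue_isIntegral p hp φ))
          (minpoly.irreducible (residue_isIntegral p hp φ))
  | .infinity =>
      if φ.denom.natDegree < φ.num.natDegree then .infinity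
      else placeAt (φ.num.coeff φ.denom.natDegree)

/-- The pull back along `φ` of the standard local parameter at the place `Q`: the polynomial `q` at
a finite place, `1 / X` at infinity. -/
def Place.pullParam (φ : RatFunc F) : Place F → RatFunc F
  | .finite q _ _ => Polynomial.aeval φ q
  | .infinity => φ⁻¹

/-- The derivative of a rational function, by the quotient rule. -/
def deriv (r : RatFunc F) : RatFunc F :=
  algebraMap F[X] (RatFunc F)
      (derivative r.num * r.denom - r.num * derivative r.denom) /
    algebraMap F[X] (RatFunc F) (r.denom ^ 2)

/-- The ramification index of the morphism `φ` at `P`: the order at `P` of the pull back `y` of a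
local parameter at `φ(P)`. -/
def ramIndex (φ : RatFunc F) (P : Place F) : ℤ :=
  P.ord ((P.image φ).pullParam φ)

/-- The different exponent of the separable morphism `φ` at `P`: the order at `P` of `dy / dx`, with
`x` a local parameter at `P` and `y` the pull back of a local parameter at `φ(P)`. -/
def differentExponent (φ : RatFunc F) (P : Place F) : ℤ :=
  P.ord (deriv ((P.image φ).pullParam φ) / deriv (P.pullParam RatFunc.X))

/-- The coefficients of the ramification divisor `∑ (e_P - 1) P`. -/
def ramificationDivisor (φ : RatFunc F) : Place F → ℤ := fun P => ramIndex φ P - 1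

/-- The coefficients of the different divisor `∑ d_P P`. -/
def differentDivisor (φ : RatFunc F) : Place F → ℤ := fun P => differentExponent φ P

/-- `φ` is a separable morphism: `F(x)` is separable over `F(φ)`. -/
def IsSeparableMorphism (φ : RatFunc F) : Prop := Algebra.IsSeparable F⟮φ⟯ (RatFunc F)

/-- `φ` is a purely inseparable morphism: `F(x)` is purely inseparable over `F(φ)`. -/
def IsPurelyInseparableMorphism (φ : RatFunc F) : Prop := IsPurelyInseparable F⟮φ⟯ (RatFunc F)

/-- `φ` is simple: all ramification indices are at most `2` and distinct ramification places have
distinct images. -/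
def IsSimpleMorphism (φ : RatFunc F) : Prop :=
  (∀ P, 1 < ramIndex φ P → ramIndex φ P = 2) ∧
  ∀ P P', P ≠ P' → 1 < ramIndex φ P → 1 < ramIndex φ P' → P.image φ ≠ P'.image φ

end Places

/-! ### Lines and rational functions of degree three -/

section RationalFunctions

variable {F : Type*} [Field F]

/-- The rational function `(f : g)`, given by the binary cubic forms with dehomogenizations `f` and
`g`, corresponds to the line `L`: the coefficients of the two forms give equations of `L`. -/
def Corresponds (L : Submodule F (Fin 4 → F)) (f g : F[X]) : Prop :=
  f.natDegree ≤ 3 ∧ g.natDegree ≤ 3 ∧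
    L = plane (fun j => f.coeff (3 - (j : ℕ))) ⊓ plane (fun j => g.coeff (3 - (j : ℕ)))

open scoped Classical in
/-- The coefficients of the base divisor of `(f : g)`, the divisor of the greatest common divisor of
the two binary cubic forms with dehomogenizations `f` and `g` (not both zero).  At infinity the
multiplicity of the form of `f` is `3 - deg f`. -/
def baseDivisor (f g : F[X]) : Place F → ℤ
  | .finite p _ _ => (multiplicity p (EuclideanDomain.gcd f g) : ℤ)
  | .infinity => 3 - (max f.natDegree g.natDegree : ℤ)

/-- The associated morphism of `(f : g)`, as an element of `F(x)`: common factors cancel. -/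
def assocMorphism (f g : F[X]) : RatFunc F :=
  algebraMap F[X] (RatFunc F) f / algebraMap F[X] (RatFunc F) g

/-- `φ` is separable with ramification divisor `R` and different divisor `D`. -/
def HasDivisors (R D : Divisor F) (φ : RatFunc F) : Prop :=
  IsSeparableMorphism φ ∧ ramificationDivisor φ = ⇑R ∧ differentDivisor φ = ⇑D

/-- A row of the table: the set `𝒪` of lines is a single orbit, of the given size, represented by
the line spanned by `v` and `w`; this line corresponds to the rational function `f / g`, which has
base divisor `B` and whose associated morphism has the property `ram`. -/
structure IsTableRow (𝒪 : Set (Submodule F (Fin 4 → F))) (size : ℚ) (v w : Fin 4 → F)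
    (f g : F[X]) (B : Divisor F) (ram : RatFunc F → Prop) : Prop where
  orbit : 𝒪 = MulAction.orbit PGL(2, F) (join v w)
  card : (𝒪.ncard : ℚ) = size
  corresponds : Corresponds (join v w) f g
  base : baseDivisor f g = ⇑B
  ramification : ram (assocMorphism f g)

end RationalFunctions

end TwistedCubic

end

namespace TwistedCubic

/-! ### Lines of projective three space -/

section Lin

variable {K : Type*} [Field K]

/-! The classification is a reduction to normal forms. A line is sorted by the points of the cubic
on it and by the osculating planes containing it, over `F` and over the quadratic extension. In
homogeneous parameters the osculating form at `(s : t)` takes the value `(x t - y s)³` at the point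
`(x : y)` of the cubic (`pt_mem_plane_osc`), and a matrix acts on points and on osculating planes
through the same linear action on parameters (`collin_pt`, `smul_plane_osc`), in every
characteristic. So the kinds of lines are invariant, a distinguished point or plane can be moved to
parameter `0` or `∞`, and a shear followed by a diagonal matrix clears all coordinates but one
scalar, which matters up to squares or not at all. The shear divides by `2` for unisecants in an
osculating plane and by `3` for passants in one; this is why characteristics `2` and `3` have
classes of their own.

For the imaginary kinds the line is extended to the algebraic closure. An element moved by Frobenius
is linearly independent of `1` over `F` (`frob_ne_of_eq`), and any two non-rational elements of the
quadratic extension differ by a rational affine map (`exists_affine`). This gives a single orbit,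
and equalities descend by `extend_injective`.

Sizes come from orbit-stabilizer in `GL(2, q)`. With the source line given by points and the target
line by planes, "`g` maps one to the other" is four equations in the entries of `g`
(`smul_join_eq_iff`). The same equations give the stabilizers and show that classes differing by a
square class are disjoint. The generic class is counted last, as the rest of all lines
(`ncard_isLine`).

The divisors are governed by the Wronskian `W = g f' - g' f` of a reduced fraction with monic
denominator. The different exponent at a finite place `p` is the multiplicity of `p` in `W`; the
ramification index `e` is one more than it if `e` is nonzero in `F`, and at most equal to it
otherwise (`IsReduced.exists_ramIndex_eq`). The rows follow from the factorization of `W` and the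
degrees, together with the factorization of a fibre where the different exponent exceeds one.

For a generic line there is a dictionary between geometry and the pencil of cubics spanned by `f`
and `g`. A common factor of degree `1`, `2` or `3` means a rational point on the line, an imaginary
chord, or proportional equations (`Corresponds.isCoprime`). A cube of a linear form in the pencil
means an osculating plane through the line (`coeffVec_dot_cube`). A ramification index of at least
`3` produces such a cube over the closure at every root of the place (`IsReduced.exists_cube`),
while `p² ∣ W` bounds the degree of the place by `2`; the line would then lie in an osculating plane
or be an imaginary axis. Two ramified places in one fibre would need degree `4` in a fibre of degree
`3` (`IsReduced.image_ne`). -/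

theorem mem_plane {c v : Fin 4 → K} : v ∈ plane c ↔ c ⬝ᵥ v = 0 := Iff.rfl

theorem join_le_iff {v w : Fin 4 → K} {L : Submodule K (Fin 4 → K)} :
    join v w ≤ L ↔ v ∈ L ∧ w ∈ L := by
  rw [join, Submodule.span_le, Set.pair_subset_iff]
  rfl

theorem left_mem_join (v w : Fin 4 → K) : v ∈ join v w := (join_le_iff.1 le_rfl).1

theorem right_mem_join (v w : Fin 4 → K) : w ∈ join v w := (join_le_iff.1 le_rfl).2

theorem mem_join {v w x : Fin 4 → K} : x ∈ join v w ↔ ∃ a b : K, a • v + b • w = x :=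
  Submodule.mem_span_pair

theorem join_comm (v w : Fin 4 → K) : join v w = join w v := by
  rw [join, join, Set.pair_comm]

theorem isLine_join {v w : Fin 4 → K} (h : LinearIndependent K ![v, w]) : IsLine (join v w) := by
  have := finrank_span_eq_card h
  rwa [Matrix.range_cons, Matrix.range_cons, Matrix.range_empty, Set.union_empty,
    Fintype.card_fin] at this

theorem plane_inf_plane (c d : Fin 4 → K) :
    plane c ⊓ plane d = LinearMap.ker (Matrix.mulVecLin (Matrix.of ![c, d])) := by
  ext v
  simp [mem_plane, funext_iff, Fin.forall_fin_two]

/-- Rank-nullity for the `2 × 4` matrix with rows `c` and `d`. -/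
theorem isLine_plane_inf {c d : Fin 4 → K} (h : LinearIndependent K ![c, d]) :
    IsLine (plane c ⊓ plane d) := by
  have h1 := (Matrix.mulVecLin (Matrix.of ![c, d])).finrank_range_add_finrank_ker
  have h2 : (Matrix.of ![c, d]).rank = 2 := by
    have := LinearIndependent.rank_matrix (M := Matrix.of ![c, d]) h
    simpa using this
  rw [Matrix.rank] at h2
  rw [IsLine, plane_inf_plane]
  simp only [Module.finrank_fintype_fun_eq_card, Fintype.card_fin] at h1
  rw [h2] at h1
  omega

theorem IsLine.eq_of_le {L L' : Submodule K (Fin 4 → K)} (h : IsLine L) (h' : IsLine L')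
    (hle : L ≤ L') : L = L' :=
  Submodule.eq_of_le_of_finrank_eq hle (h.trans h'.symm)

theorem IsLine.eq_join {L : Submodule K (Fin 4 → K)} (h : IsLine L) {v w : Fin 4 → K}
    (hvw : LinearIndependent K ![v, w]) (hv : v ∈ L) (hw : w ∈ L) : L = join v w :=
  ((isLine_join hvw).eq_of_le h (join_le_iff.2 ⟨hv, hw⟩)).symm

theorem IsLine.exists_join {L : Submodule K (Fin 4 → K)} (h : IsLine L) :
    ∃ v w, LinearIndependent K ![v, w] ∧ L = join v w := by
  have b := Module.finBasisOfFinrankEq K L h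
  have hb := b.linearIndependent.map' L.subtype L.ker_subtype
  have e : L.subtype ∘ b = ![(b 0 : Fin 4 → K), (b 1 : Fin 4 → K)] := by
    ext i; fin_cases i <;> rfl
  rw [e] at hb
  exact ⟨_, _, hb, h.eq_join hb (b 0).2 (b 1).2⟩

/-- Without a second independent point the whole line would lie in the span of `v`, of dimension
one. -/
theorem IsLine.eq_join_of_ne {L : Submodule K (Fin 4 → K)} (h : IsLine L) {v : Fin 4 → K}
    (hv : v ∈ L) (hv0 : v ≠ 0) : ∃ w, LinearIndependent K ![v, w] ∧ L = join v w := by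
  by_contra! hne
  have : L ≤ Submodule.span K {v} := by
    intro w hw
    by_contra hw'
    have hli : LinearIndependent K ![v, w] := by
      rw [LinearIndependent.pair_iff' hv0]
      intro a ha
      exact hw' (Submodule.mem_span_singleton.2 ⟨a, ha⟩)
    exact hne w hli (h.eq_join hli hv hw)
  have h1 := Submodule.finrank_mono this
  rw [finrank_span_singleton hv0] at h1
  rw [IsLine] at h
  omega

/-- One nonzero Plücker coordinate suffices. This is the certificate of independence for all the
explicit lines, since `simp` evaluates the minor. -/
theorem linearIndependent_of_minor {v w : Fin 4 → K} (i j : Fin 4)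
    (h : v i * w j - v j * w i ≠ 0) : LinearIndependent K ![v, w] := by
  rw [LinearIndependent.pair_iff]
  intro s t hst
  have hi : s * v i + t * w i = 0 := by simpa using congrFun hst i
  have hj : s * v j + t * w j = 0 := by simpa using congrFun hst j
  constructor
  · refine (mul_eq_zero.1 (?_ : s * (v i * w j - v j * w i) = 0)).resolve_right h
    linear_combination w j * hi - w i * hj
  · refine (mul_eq_zero.1 (?_ : t * (v i * w j - v j * w i) = 0)).resolve_right h
    linear_combination v i * hj - v j * hi

/-- A line given by two points and by two planes through them. -/
theorem join_eq_plane_inf {v w c d : Fin 4 → K} (hvw : LinearIndependent K ![v, w])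
    (hcd : LinearIndependent K ![c, d]) (h : c ⬝ᵥ v = 0 ∧ d ⬝ᵥ v = 0 ∧ c ⬝ᵥ w = 0 ∧ d ⬝ᵥ w = 0) :
    join v w = plane c ⊓ plane d :=
  (isLine_join hvw).eq_of_le (isLine_plane_inf hcd)
    (join_le_iff.2 ⟨⟨h.1, h.2.1⟩, ⟨h.2.2.1, h.2.2.2⟩⟩)

/-- Two planes of vectors inside a space of dimension at most three intersect, by the dimension
formula. -/
theorem IsLine.inf_ne_bot {L L' P : Submodule K (Fin 4 → K)} (h : IsLine L) (h' : IsLine L')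
    (hL : L ≤ P) (hL' : L' ≤ P) (hP : P ≠ ⊤) : L ⊓ L' ≠ ⊥ := by
  intro hbot
  have h1 := Submodule.finrank_sup_add_finrank_inf_eq L L'
  rw [hbot, finrank_bot, h, h'] at h1
  have h2 := Submodule.finrank_mono (sup_le hL hL')
  have h3 := Submodule.finrank_lt hP
  simp at h3
  omega

end Lin

/-! ### Homogeneous parameters -/

section Homogeneous

variable {K : Type*} [Field K]

/-- The point of the twisted cubic with homogeneous parameters `(s : t)`. -/
def pt (s t : K) : Fin 4 → K := ![s ^ 3, s ^ 2 * t, s * t ^ 2, t ^ 3]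

/-- The osculating plane with homogeneous parameters `(s : t)`. -/
def osc (s t : K) : Fin 4 → K := ![t ^ 3, -3 * s * t ^ 2, 3 * s ^ 2 * t, -s ^ 3]

theorem cubicPoint_some (x : K) : cubicPoint (some x) = pt x 1 := by
  simp [cubicPoint, pt]

theorem cubicPoint_none : cubicPoint (none : Option K) = pt 1 0 := by
  simp [cubicPoint, pt]

theorem osculatingPlane_some (x : K) : osculatingPlane (some x) = plane (osc x 1) := by
  simp [osculatingPlane, osc]

theorem osculatingPlane_none : osculatingPlane (none : Option K) = plane (osc 1 0) := by
  ext v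
  simp [osculatingPlane, osc, mem_plane, dotProduct, Fin.sum_univ_succ]

/-- A parameter in `Option K` for a pair of homogeneous parameters. -/
theorem exists_param {s t : K} (h : s ≠ 0 ∨ t ≠ 0) :
    ∃ (x : Option K) (r a b : K), r ≠ 0 ∧ cubicPoint x = pt a b ∧
      osculatingPlane x = plane (osc a b) ∧ s = r * a ∧ t = r * b := by
  by_cases ht : t = 0
  · have hs := h.resolve_right (not_not.2 ht)
    exact ⟨none, s, 1, 0, hs, cubicPoint_none, osculatingPlane_none, by simp, by simp [ht]⟩
  · exact ⟨some (s / t), t, s / t, 1, ht, cubicPoint_some _, osculatingPlane_some _,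
      by field_simp, by simp⟩

theorem pt_mul (r s t : K) : pt (r * s) (r * t) = r ^ 3 • pt s t := by
  ext i; fin_cases i <;> simp [pt] <;> ring

theorem osc_mul (r s t : K) : osc (r * s) (r * t) = r ^ 3 • osc s t := by
  ext i; fin_cases i <;> simp [osc] <;> ring

theorem plane_smul {r : K} (hr : r ≠ 0) (c : Fin 4 → K) : plane (r • c) = plane c := by
  ext v; simp [mem_plane, hr]

theorem pt_mul_mem {r s t : K} (hr : r ≠ 0) {L : Submodule K (Fin 4 → K)} :
    pt (r * s) (r * t) ∈ L ↔ pt s t ∈ L := by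
  rw [pt_mul]; exact L.smul_mem_iff (pow_ne_zero 3 hr)

theorem plane_osc_mul {r s t : K} (hr : r ≠ 0) : plane (osc (r * s) (r * t)) = plane (osc s t) := by
  rw [osc_mul, plane_smul (pow_ne_zero 3 hr)]

theorem osc_dot (s t : K) (v : Fin 4 → K) :
    osc s t ⬝ᵥ v = t ^ 3 * v 0 - 3 * s * t ^ 2 * v 1 + 3 * s ^ 2 * t * v 2 - s ^ 3 * v 3 := by
  simp [osc, dotProduct, Fin.sum_univ_succ]; ring

theorem mem_plane_osc {s t : K} {v : Fin 4 → K} : v ∈ plane (osc s t) ↔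
    t ^ 3 * v 0 - 3 * s * t ^ 2 * v 1 + 3 * s ^ 2 * t * v 2 - s ^ 3 * v 3 = 0 := by
  rw [mem_plane, osc_dot]

theorem pt_mem_plane_osc {s t x y : K} : pt x y ∈ plane (osc s t) ↔ x * t = y * s := by
  rw [mem_plane_osc]
  have : t ^ 3 * pt x y 0 - 3 * s * t ^ 2 * pt x y 1 + 3 * s ^ 2 * t * pt x y 2 - s ^ 3 * pt x y 3
      = (x * t - y * s) ^ 3 := by simp [pt]; ring
  rw [this, pow_eq_zero_iff three_ne_zero, sub_eq_zero]

/-- The minors `(0, 1)` and `(2, 3)` are the bracket times `(s x)²` and `(t y)²`. If both vanish,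
then `s x = t y = 0`, and the minor `(0, 3)` settles the remaining cases. -/
theorem linearIndependent_pt {s t x y : K} (h : s * y - t * x ≠ 0) :
    LinearIndependent K ![pt s t, pt x y] := by
  by_contra hli
  have h1 : s ^ 3 * y ^ 3 - t ^ 3 * x ^ 3 = 0 := by
    by_contra h0; exact hli (linearIndependent_of_minor 0 3 (by simpa [pt] using h0))
  have h2 : s ^ 3 * (x ^ 2 * y) - s ^ 2 * t * x ^ 3 = 0 := by
    by_contra h0; exact hli (linearIndependent_of_minor 0 1 (by simpa [pt] using h0))
  have h3 : s * t ^ 2 * y ^ 3 - t ^ 3 * (x * y ^ 2) = 0 := by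
    by_contra h0; exact hli (linearIndependent_of_minor 2 3 (by simpa [pt] using h0))
  have h2' : (s * x) ^ 2 * (s * y - t * x) = 0 := by linear_combination h2
  have h3' : (t * y) ^ 2 * (s * y - t * x) = 0 := by linear_combination h3
  have hsx : s * x = 0 := by simpa [h] using h2'
  have hty : t * y = 0 := by simpa [h] using h3'
  rcases mul_eq_zero.1 hsx with hs | hx <;> rcases mul_eq_zero.1 hty with ht | hy <;>
    simp_all

/-- Each form vanishes at its own point of the cubic and not at the other one. Evaluating a linear
relation at the two points kills both coefficients. -/
theorem linearIndependent_osc {s t x y : K} (h : s * y - t * x ≠ 0) :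
    LinearIndependent K ![osc s t, osc x y] := by
  rw [LinearIndependent.pair_iff]
  intro a b hab
  have h0 : ∀ v, a * (osc s t ⬝ᵥ v) + b * (osc x y ⬝ᵥ v) = 0 := by
    intro v
    rw [← smul_eq_mul, ← smul_eq_mul, ← smul_dotProduct, ← smul_dotProduct, ← add_dotProduct, hab,
      zero_dotProduct]
  have hs : osc s t ⬝ᵥ pt s t = 0 := pt_mem_plane_osc.2 (mul_comm _ _)
  have hx : osc x y ⬝ᵥ pt x y = 0 := pt_mem_plane_osc.2 (mul_comm _ _)
  have h1 := h0 (pt s t)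
  have h2 := h0 (pt x y)
  rw [hs, mul_zero, zero_add] at h1
  rw [hx, mul_zero, add_zero] at h2
  refine ⟨(mul_eq_zero.1 h2).resolve_right fun h' => h ?_,
    (mul_eq_zero.1 h1).resolve_right fun h' => h ?_⟩
  · have := pt_mem_plane_osc.1 h'; linear_combination -this
  · have := pt_mem_plane_osc.1 h'; linear_combination this

theorem plane_osc_ne_top {s t : K} (h : s ≠ 0 ∨ t ≠ 0) : plane (osc s t) ≠ ⊤ := by
  intro h0
  have h1 : pt t (-s) ∈ plane (osc s t) := h0 ▸ Submodule.mem_top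
  have h2 : pt 1 0 ∈ plane (osc s t) := h0 ▸ Submodule.mem_top
  have h3 : pt 0 1 ∈ plane (osc s t) := h0 ▸ Submodule.mem_top
  rw [pt_mem_plane_osc] at h2 h3
  simp at h2 h3
  tauto

end Homogeneous

/-! ### The action in homogeneous parameters -/

section Act

variable {F : Type*} [Field F]

/-- The matrix with given entries. -/
def mkGL (a b c d : F) (h : a * d - b * c ≠ 0) : GL (Fin 2) F :=
  Matrix.GeneralLinearGroup.mkOfDetNeZero !![a, b; c, d] (by rwa [Matrix.det_fin_two_of])

theorem mkGL_val (a b c d : F) (h : a * d - b * c ≠ 0) : (mkGL a b c d h).val = !![a, b; c, d] :=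
  rfl

theorem exists_mkGL (g : GL (Fin 2) F) : ∃ a b c d h, g = mkGL a b c d h := by
  have h := g.isUnit.map Matrix.detMonoidHom
  refine ⟨g.val 0 0, g.val 0 1, g.val 1 0, g.val 1 1, ?_, ?_⟩
  · have := h.ne_zero
    simpa [Matrix.det_fin_two] using this
  · ext i j
    fin_cases i <;> fin_cases j <;> rfl

theorem mem_orbit_iff {L L' : Submodule F (Fin 4 → F)} :
    L ∈ MulAction.orbit PGL(2, F) L' ↔ ∃ g : GL (Fin 2) F, g • L' = L := by
  constructor
  · rintro ⟨g, rfl⟩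
    induction g using Matrix.ProjGenLinGroup.induction_on with
    | mk g => exact ⟨g, rfl⟩
  · rintro ⟨g, rfl⟩
    exact ⟨Matrix.ProjGenLinGroup.mk g, rfl⟩

/-- Scalar matrices act trivially, so stabilizers can be counted in `GL(2, F)`, scalars included. -/
theorem orbit_eq (L : Submodule F (Fin 4 → F)) :
    MulAction.orbit PGL(2, F) L = MulAction.orbit (GL (Fin 2) F) L := by
  ext L'
  rw [mem_orbit_iff]
  rfl

theorem gl_smul_def (g : GL (Fin 2) F) (L : Submodule F (Fin 4 → F)) :
    g • L = L.map (Matrix.mulVecLin (cubicMatrix g.val)) := rfl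

/-- The collineation of a matrix, on vectors. -/
def collin (g : GL (Fin 2) F) (v : Fin 4 → F) : Fin 4 → F := (cubicMatrix g.val).mulVec v

theorem collin_inv_collin (g : GL (Fin 2) F) (v : Fin 4 → F) : collin g⁻¹ (collin g v) = v := by
  rw [collin, collin, Matrix.mulVec_mulVec, ← cubicMatrix_mul, ← Units.val_mul, inv_mul_cancel,
    Units.val_one, cubicMatrix_one, Matrix.one_mulVec]

theorem collin_mem_smul (g : GL (Fin 2) F) {L : Submodule F (Fin 4 → F)} {v : Fin 4 → F} :
    collin g v ∈ g • L ↔ v ∈ L := by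
  refine ⟨?_, fun h => ⟨v, h, rfl⟩⟩
  rintro ⟨w, hw, h⟩
  have := congrArg (collin g⁻¹) (show collin g w = collin g v from h)
  rw [collin_inv_collin, collin_inv_collin] at this
  exact this ▸ hw

theorem mem_smul_iff (g : GL (Fin 2) F) {L : Submodule F (Fin 4 → F)} {v : Fin 4 → F} :
    v ∈ g • L ↔ collin g⁻¹ v ∈ L := by
  rw [← collin_mem_smul g⁻¹, inv_smul_smul]

theorem smul_join (g : GL (Fin 2) F) (v w : Fin 4 → F) :
    g • join v w = join (collin g v) (collin g w) := by
  rw [gl_smul_def, join, Submodule.map_span, Set.image_pair]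
  rfl

theorem smul_le_smul_iff (g : GL (Fin 2) F) {L L' : Submodule F (Fin 4 → F)} :
    g • L ≤ g • L' ↔ L ≤ L' := by
  constructor
  · intro h v hv
    rw [← collin_mem_smul g] at hv ⊢
    exact h hv
  · exact fun h => Submodule.map_mono h

theorem smul_inf (g : GL (Fin 2) F) (L L' : Submodule F (Fin 4 → F)) :
    g • (L ⊓ L') = g • L ⊓ g • L' := by
  ext v
  simp [mem_smul_iff]

theorem isLine_smul (g : GL (Fin 2) F) {L : Submodule F (Fin 4 → F)} (h : IsLine L) :
    IsLine (g • L) := by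
  have hinj : Function.Injective (Matrix.mulVecLin (cubicMatrix g.val)) := by
    intro v w hvw
    have := congrArg (collin g⁻¹) (show collin g v = collin g w from hvw)
    rwa [collin_inv_collin, collin_inv_collin] at this
  exact (Submodule.equivMapOfInjective _ hinj L).finrank_eq.symm.trans h

theorem collin_mkGL (a b c d : F) (h : a * d - b * c ≠ 0) (v : Fin 4 → F) :
    collin (mkGL a b c d h) v =
      ![a ^ 3 * v 0 + 3 * a ^ 2 * b * v 1 + 3 * a * b ^ 2 * v 2 + b ^ 3 * v 3,
        a ^ 2 * c * v 0 + (a ^ 2 * d + 2 * a * b * c) * v 1 + (b ^ 2 * c + 2 * a * b * d) * v 2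
          + b ^ 2 * d * v 3,
        a * c ^ 2 * v 0 + (b * c ^ 2 + 2 * a * c * d) * v 1 + (a * d ^ 2 + 2 * b * c * d) * v 2
          + b * d ^ 2 * v 3,
        c ^ 3 * v 0 + 3 * c ^ 2 * d * v 1 + 3 * c * d ^ 2 * v 2 + d ^ 3 * v 3] := by
  ext i
  fin_cases i <;>
    simp [collin, mkGL_val, cubicMatrix, Matrix.mulVec, dotProduct, Fin.sum_univ_succ] <;> ring

theorem collin_pt (a b c d : F) (h : a * d - b * c ≠ 0) (s t : F) :
    collin (mkGL a b c d h) (pt s t) = pt (a * s + b * t) (c * s + d * t) := by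
  rw [collin_mkGL]
  ext i
  fin_cases i <;> simp [pt] <;> ring

/-- The osculating forms are contragredient to the points up to the cube of the determinant. This
replaces the null polarity of the cubic, which degenerates in characteristic `3`. -/
theorem osc_dot_collin (a b c d : F) (h : a * d - b * c ≠ 0) (s t : F) (v : Fin 4 → F) :
    osc (a * s + b * t) (c * s + d * t) ⬝ᵥ collin (mkGL a b c d h) v =
      (a * d - b * c) ^ 3 * (osc s t ⬝ᵥ v) := by
  rw [collin_mkGL, osc_dot, osc_dot]
  simp
  ring

theorem smul_plane_osc (a b c d : F) (h : a * d - b * c ≠ 0) (s t : F) :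
    mkGL a b c d h • plane (osc s t) = plane (osc (a * s + b * t) (c * s + d * t)) := by
  ext v
  rw [mem_smul_iff]
  set w := collin (mkGL a b c d h)⁻¹ v with hw
  have : v = collin (mkGL a b c d h) w := by
    have := collin_inv_collin (mkGL a b c d h)⁻¹ v
    rw [inv_inv] at this
    rw [hw, this]
  rw [mem_plane, mem_plane, this, osc_dot_collin]
  simp [h]

/-- `g` sends a line given by points to a line given by planes. -/
theorem smul_join_eq_iff {g : GL (Fin 2) F} {v w c d : Fin 4 → F}
    (hvw : LinearIndependent F ![v, w]) (hcd : LinearIndependent F ![c, d]) :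
    g • join v w = plane c ⊓ plane d ↔
      c ⬝ᵥ collin g v = 0 ∧ d ⬝ᵥ collin g v = 0 ∧ c ⬝ᵥ collin g w = 0 ∧ d ⬝ᵥ collin g w = 0 := by
  have h1 := isLine_smul g (isLine_join hvw)
  have h2 := isLine_plane_inf hcd
  have : g • join v w = plane c ⊓ plane d ↔ g • join v w ≤ plane c ⊓ plane d :=
    ⟨fun h => h.le, h1.eq_of_le h2⟩
  rw [this, smul_join, join_le_iff, Submodule.mem_inf, Submodule.mem_inf, mem_plane, mem_plane,
    mem_plane, mem_plane, and_assoc]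

end Act

/-! ### The kinds of lines in homogeneous parameters -/

section Kinds

variable {F : Type*} [Field F]

/-- Homogeneous parameters of an element of `Option F`. -/
theorem exists_homogeneous (x : Option F) :
    ∃ a b : F, (a ≠ 0 ∨ b ≠ 0) ∧ cubicPoint x = pt a b ∧ osculatingPlane x = plane (osc a b) := by
  cases x with
  | none => exact ⟨1, 0, by simp, cubicPoint_none, osculatingPlane_none⟩
  | some x => exact ⟨x, 1, by simp, cubicPoint_some x, osculatingPlane_some x⟩

theorem exists_homogeneous_pair {x y : Option F} (h : x ≠ y) :
    ∃ a b c d : F, a * d - b * c ≠ 0 ∧ cubicPoint x = pt a b ∧ osculatingPlane x = plane (osc a b) ∧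
      cubicPoint y = pt c d ∧ osculatingPlane y = plane (osc c d) := by
  cases x with
  | none =>
    cases y with
    | none => exact absurd rfl h
    | some y =>
      exact ⟨1, 0, y, 1, by simp, cubicPoint_none, osculatingPlane_none, cubicPoint_some y,
        osculatingPlane_some y⟩
  | some x =>
    cases y with
    | none =>
      exact ⟨x, 1, 1, 0, by simp, cubicPoint_some x, osculatingPlane_some x, cubicPoint_none,
        osculatingPlane_none⟩
    | some y =>
      have : x - y ≠ 0 := sub_ne_zero.2 fun e => h (e ▸ rfl)
      exact ⟨x, 1, y, 1, by simpa using this, cubicPoint_some x, osculatingPlane_some x,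
        cubicPoint_some y, osculatingPlane_some y⟩

theorem ne_zero_of_det {s t x y : F} (h : s * y - t * x ≠ 0) : s ≠ 0 ∨ t ≠ 0 := by
  by_contra! h0
  simp [h0.1, h0.2] at h

theorem ne_zero_of_det' {s t x y : F} (h : s * y - t * x ≠ 0) : x ≠ 0 ∨ y ≠ 0 := by
  by_contra! h0
  simp [h0.1, h0.2] at h

variable {L : Submodule F (Fin 4 → F)}

/-- Homogeneous parameters remove the separate case of the point at infinity, so a matrix can act
without regard to whether an image is finite. -/
theorem isPassant_iff :
    IsPassant L ↔ IsLine L ∧ ∀ s t : F, (s ≠ 0 ∨ t ≠ 0) → pt s t ∉ L := by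
  refine and_congr_right fun _ => ⟨fun h s t hst hL => ?_, fun h x hx => ?_⟩
  · obtain ⟨x, r, a, b, hr, hx, -, rfl, rfl⟩ := exists_param hst
    exact h x (hx ▸ (pt_mul_mem hr).1 hL)
  · obtain ⟨a, b, hab, h1, -⟩ := exists_homogeneous x
    exact h a b hab (h1 ▸ hx)

theorem inOsculatingPlane_iff :
    InOsculatingPlane L ↔ ∃ s t : F, (s ≠ 0 ∨ t ≠ 0) ∧ L ≤ plane (osc s t) := by
  constructor
  · rintro ⟨x, hx⟩
    obtain ⟨a, b, hab, -, h1⟩ := exists_homogeneous x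
    exact ⟨a, b, hab, h1 ▸ hx⟩
  · rintro ⟨s, t, hst, hL⟩
    obtain ⟨x, r, a, b, hr, -, hx, rfl, rfl⟩ := exists_param hst
    rw [plane_osc_mul hr] at hL
    exact ⟨x, hx ▸ hL⟩

theorem isUnisecant_iff :
    IsUnisecant L ↔ IsLine L ∧ ∃ s t : F, (s ≠ 0 ∨ t ≠ 0) ∧ pt s t ∈ L ∧
      ∀ x y, pt x y ∈ L → x * t = y * s := by
  refine and_congr_right fun _ => ⟨?_, ?_⟩
  · rintro ⟨x, hx, hu⟩
    obtain ⟨a, b, hab, h1, h2⟩ := exists_homogeneous x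
    refine ⟨a, b, hab, h1 ▸ hx, fun s t hst => ?_⟩
    by_cases h0 : s ≠ 0 ∨ t ≠ 0
    · obtain ⟨y, r, c, d, hr, hy, -, rfl, rfl⟩ := exists_param h0
      have := hu y (by change cubicPoint y ∈ L; rw [hy]; exact (pt_mul_mem hr).1 hst)
      subst this
      have : pt c d ∈ plane (osc a b) := by
        rw [← hy, h1, pt_mem_plane_osc, mul_comm]
      rw [pt_mem_plane_osc] at this
      linear_combination r * this
    -- The pair `(0, 0)` gives the zero vector, which lies in every subspace; the proportionality
    -- asked for is then trivial.
    · push Not at h0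
      simp [h0.1, h0.2]
  · rintro ⟨s, t, hst, hL, hu⟩
    obtain ⟨x, r, a, b, hr, hx, -, rfl, rfl⟩ := exists_param hst
    refine ⟨x, by change cubicPoint x ∈ L; rw [hx]; exact (pt_mul_mem hr).1 hL, fun y hy => ?_⟩
    by_contra hne
    obtain ⟨c, d, e, f, hdet, h1, -, h2, h3⟩ := exists_homogeneous_pair hne
    have h4 := hu c d (h1 ▸ hy)
    have h5 : pt a b ∈ plane (osc e f) := by
      rw [← hx, h2, pt_mem_plane_osc, mul_comm]
    have h5 := pt_mem_plane_osc.1 h5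
    have h6 : c * b = d * a := mul_left_cancel₀ hr (by linear_combination h4)
    have ha : a * (c * f - d * e) = 0 := by linear_combination c * h5 + e * h6
    have hb : b * (c * f - d * e) = 0 := by linear_combination d * h5 + f * h6
    have ha := (mul_eq_zero.1 ha).resolve_right hdet
    have hb := (mul_eq_zero.1 hb).resolve_right hdet
    simp [ha, hb] at hst

theorem isRealChord_iff' :
    IsRealChord L ↔ ∃ s t x y : F, s * y - t * x ≠ 0 ∧ L = join (pt s t) (pt x y) := by
  constructor
  · rintro ⟨x, y, hxy, rfl⟩
    obtain ⟨a, b, c, d, hdet, h1, -, h2, -⟩ := exists_homogeneous_pair hxy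
    exact ⟨a, b, c, d, hdet, by rw [h1, h2]⟩
  · rintro ⟨s, t, x, y, hdet, rfl⟩
    obtain ⟨u, r, a, b, hr, hu, -, rfl, rfl⟩ := exists_param (ne_zero_of_det hdet)
    obtain ⟨v, r', c, d, hr', hv, -, rfl, rfl⟩ := exists_param (ne_zero_of_det' hdet)
    refine ⟨u, v, ?_, ?_⟩
    · rintro rfl
      have : pt a b ∈ plane (osc c d) := by rw [← hu, hv, pt_mem_plane_osc, mul_comm]
      rw [pt_mem_plane_osc] at this
      exact hdet (by linear_combination r * r' * this)
    · have hli := linearIndependent_pt hdet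
      refine ((isLine_join hli).eq_join ?_ ?_ ?_)
      · rw [hu, hv]
        apply linearIndependent_pt
        intro h0
        exact hdet (by linear_combination r * r' * h0)
      · rw [hu, ← pt_mul_mem hr]; exact left_mem_join _ _
      · rw [hv, ← pt_mul_mem hr']; exact right_mem_join _ _

theorem isRealChord_iff :
    IsRealChord L ↔ IsLine L ∧ ∃ s t x y : F, s * y - t * x ≠ 0 ∧ pt s t ∈ L ∧ pt x y ∈ L := by
  rw [isRealChord_iff']
  constructor
  · rintro ⟨s, t, x, y, h, rfl⟩
    exact ⟨isLine_join (linearIndependent_pt h), s, t, x, y, h, left_mem_join _ _,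
      right_mem_join _ _⟩
  · rintro ⟨hL, s, t, x, y, h, h1, h2⟩
    exact ⟨s, t, x, y, h, hL.eq_join (linearIndependent_pt h) h1 h2⟩

theorem isRealAxis_iff' :
    IsRealAxis L ↔ ∃ s t x y : F, s * y - t * x ≠ 0 ∧ L = plane (osc s t) ⊓ plane (osc x y) := by
  constructor
  · rintro ⟨x, y, hxy, rfl⟩
    obtain ⟨a, b, c, d, hdet, -, h1, -, h2⟩ := exists_homogeneous_pair hxy
    exact ⟨a, b, c, d, hdet, by rw [h1, h2]⟩
  · rintro ⟨s, t, x, y, hdet, rfl⟩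
    obtain ⟨u, r, a, b, hr, hu, hu', rfl, rfl⟩ := exists_param (ne_zero_of_det hdet)
    obtain ⟨v, r', c, d, hr', hv, hv', rfl, rfl⟩ := exists_param (ne_zero_of_det' hdet)
    refine ⟨u, v, ?_, ?_⟩
    · rintro rfl
      have : pt a b ∈ plane (osc c d) := by rw [← hu, hv, pt_mem_plane_osc, mul_comm]
      rw [pt_mem_plane_osc] at this
      exact hdet (by linear_combination r * r' * this)
    · rw [hu', hv', plane_osc_mul hr, plane_osc_mul hr']

theorem isRealAxis_iff :
    IsRealAxis L ↔ IsLine L ∧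
      ∃ s t x y : F, s * y - t * x ≠ 0 ∧ L ≤ plane (osc s t) ∧ L ≤ plane (osc x y) := by
  rw [isRealAxis_iff']
  constructor
  · rintro ⟨s, t, x, y, h, rfl⟩
    exact ⟨isLine_plane_inf (linearIndependent_osc h), s, t, x, y, h, inf_le_left, inf_le_right⟩
  · rintro ⟨hL, s, t, x, y, h, h1, h2⟩
    exact ⟨s, t, x, y, h, hL.eq_of_le (isLine_plane_inf (linearIndependent_osc h)) (le_inf h1 h2)⟩

/-! ### Invariance under the group -/

theorem IsPassant.smul (g : GL (Fin 2) F) (h : IsPassant L) : IsPassant (g • L) := by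
  rw [isPassant_iff] at h ⊢
  refine ⟨isLine_smul g h.1, fun s t hst hL => ?_⟩
  rw [mem_smul_iff] at hL
  obtain ⟨a, b, c, d, hd, hg⟩ := exists_mkGL g⁻¹
  rw [hg, collin_pt] at hL
  refine h.2 _ _ ?_ hL
  by_contra! h0
  have h1 : (a * d - b * c) * s = 0 := by linear_combination d * h0.1 - b * h0.2
  have h2 : (a * d - b * c) * t = 0 := by linear_combination a * h0.2 - c * h0.1
  simp [hd] at h1 h2
  tauto

theorem InOsculatingPlane.smul (g : GL (Fin 2) F) (h : InOsculatingPlane L) :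
    InOsculatingPlane (g • L) := by
  rw [inOsculatingPlane_iff] at h ⊢
  obtain ⟨s, t, hst, hL⟩ := h
  obtain ⟨a, b, c, d, hd, rfl⟩ := exists_mkGL g
  refine ⟨a * s + b * t, c * s + d * t, ?_, ?_⟩
  · by_contra! h0
    have h1 : (a * d - b * c) * s = 0 := by linear_combination d * h0.1 - b * h0.2
    have h2 : (a * d - b * c) * t = 0 := by linear_combination a * h0.2 - c * h0.1
    simp [hd] at h1 h2
    tauto
  · rw [← smul_plane_osc a b c d hd]
    exact (smul_le_smul_iff _).2 hL

theorem IsUnisecant.smul (g : GL (Fin 2) F) (h : IsUnisecant L) : IsUnisecant (g • L) := by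
  rw [isUnisecant_iff] at h ⊢
  obtain ⟨h0, s, t, hst, hL, hu⟩ := h
  refine ⟨isLine_smul g h0, ?_⟩
  obtain ⟨a, b, c, d, hd, rfl⟩ := exists_mkGL g
  refine ⟨a * s + b * t, c * s + d * t, ?_, ?_, ?_⟩
  · by_contra! h0
    have h1 : (a * d - b * c) * s = 0 := by linear_combination d * h0.1 - b * h0.2
    have h2 : (a * d - b * c) * t = 0 := by linear_combination a * h0.2 - c * h0.1
    simp [hd] at h1 h2
    tauto
  · rw [← collin_pt a b c d hd]
    exact (collin_mem_smul _).2 hL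
  · intro x y hxy
    -- `r` is the inverse determinant: by Cramer's rule the given point is the image of an explicit
    -- point of the cubic.
    obtain ⟨r, hr⟩ : ∃ r, (a * d - b * c) * r = 1 := ⟨_, mul_inv_cancel₀ hd⟩
    have e : pt x y = collin (mkGL a b c d hd) (pt ((d * x - b * y) * r)
        ((a * y - c * x) * r)) := by
      rw [collin_pt]
      congr 1
      · linear_combination -x * hr
      · linear_combination -y * hr
    rw [e, collin_mem_smul] at hxy
    have := hu _ _ hxy
    linear_combination (a * d - b * c) * this
      - ((d * x - b * y) * t - (a * y - c * x) * s) * hr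

theorem IsRealAxis.smul (g : GL (Fin 2) F) (h : IsRealAxis L) : IsRealAxis (g • L) := by
  rw [isRealAxis_iff] at h ⊢
  obtain ⟨h0, s, t, x, y, hdet, h1, h2⟩ := h
  refine ⟨isLine_smul g h0, ?_⟩
  obtain ⟨a, b, c, d, hd, rfl⟩ := exists_mkGL g
  refine ⟨a * s + b * t, c * s + d * t, a * x + b * y, c * x + d * y, ?_, ?_, ?_⟩
  · have := mul_ne_zero hd hdet
    intro h3
    exact this (by linear_combination h3)
  · rw [← smul_plane_osc a b c d hd]; exact (smul_le_smul_iff _).2 h1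
  · rw [← smul_plane_osc a b c d hd]; exact (smul_le_smul_iff _).2 h2

/-- The polar form of `pt`: the tangent at `(s : t)` is spanned by `pt s t` and the vectors
`tanv s t u v`. -/
def tanv (s t u v : F) : Fin 4 → F :=
  ![3 * s ^ 2 * u, s ^ 2 * v + 2 * s * t * u, 2 * s * t * v + t ^ 2 * u, 3 * t ^ 2 * v]

theorem collin_tanv (a b c d : F) (h : a * d - b * c ≠ 0) (s t u v : F) :
    collin (mkGL a b c d h) (tanv s t u v) =
      tanv (a * s + b * t) (c * s + d * t) (a * u + b * v) (c * u + d * v) := by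
  rw [collin_mkGL]
  ext i
  fin_cases i <;> simp [tanv] <;> ring

/-- Every second pair `(u : v)` independent of `(s : t)` yields the same tangent, because the polar
form at `(s : t)` itself is three times the point. Admitting all of them makes the description
stable under the group, which the affine derivative is not. -/
theorem isTangent_iff :
    IsTangent L ↔ ∃ s t u v : F, s * v - t * u ≠ 0 ∧ L = join (pt s t) (tanv s t u v) := by
  constructor
  · rintro ⟨_ | x, rfl⟩
    · exact ⟨1, 0, 0, 1, by simp, by simp [tangentLine, pt, tanv]⟩
    · exact ⟨x, 1, 1, 0, by simp, by simp [tangentLine, pt, tanv]⟩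
  · rintro ⟨s, t, u, v, h, rfl⟩
    by_cases ht : t = 0
    · subst ht
      have hs : s ≠ 0 := by rintro rfl; simp at h
      have hv : v ≠ 0 := by rintro rfl; simp at h
      refine ⟨none, ?_⟩
      rw [show tangentLine (none : Option F) = join ![1, 0, 0, 0] ![0, 1, 0, 0] from rfl]
      refine le_antisymm (join_le_iff.2 ⟨?_, ?_⟩) (join_le_iff.2 ⟨?_, ?_⟩) <;> rw [mem_join]
      · exact ⟨s ^ 3, 0, by ext i; fin_cases i <;> simp [pt]⟩
      · exact ⟨3 * s ^ 2 * u, s ^ 2 * v, by ext i; fin_cases i <;> simp [tanv]⟩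
      · exact ⟨(s ^ 3)⁻¹, 0, by ext i; fin_cases i <;> simp [pt, hs]⟩
      · refine ⟨-3 * u / (s ^ 3 * v), (s ^ 2 * v)⁻¹, ?_⟩
        ext i; fin_cases i <;> simp [tanv, pt] <;> field_simp
        ring
    · refine ⟨some (s / t), ?_⟩
      rw [show tangentLine (some (s / t)) = join ![(s / t) ^ 3, (s / t) ^ 2, s / t, 1]
        ![3 * (s / t) ^ 2, 2 * (s / t), 1, 0] from rfl]
      refine le_antisymm (join_le_iff.2 ⟨?_, ?_⟩) (join_le_iff.2 ⟨?_, ?_⟩) <;> rw [mem_join]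
      · exact ⟨t ^ 3, 0, by ext i; fin_cases i <;> simp [pt] <;> field_simp⟩
      · refine ⟨3 * t ^ 2 * v, t * (t * u - s * v), ?_⟩
        ext i; fin_cases i <;> simp [tanv] <;> field_simp <;> ring
      · exact ⟨(t ^ 3)⁻¹, 0, by ext i; fin_cases i <;> simp [pt] <;> field_simp⟩
      · obtain ⟨r, hr⟩ : ∃ r, (s * v - t * u) * r = 1 := ⟨_, mul_inv_cancel₀ h⟩
        refine ⟨3 * v * r / t ^ 2, -(r / t), ?_⟩
        ext i; fin_cases i <;> simp [tanv, pt] <;> field_simp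
        · linear_combination 3 * s ^ 2 * hr
        · linear_combination 2 * s * hr
        · linear_combination hr
        · ring

theorem IsTangent.smul (g : GL (Fin 2) F) (h : IsTangent L) : IsTangent (g • L) := by
  rw [isTangent_iff] at h ⊢
  obtain ⟨s, t, u, v, h0, rfl⟩ := h
  obtain ⟨a, b, c, d, hd, rfl⟩ := exists_mkGL g
  refine ⟨a * s + b * t, c * s + d * t, a * u + b * v, c * u + d * v, ?_, ?_⟩
  · have := mul_ne_zero hd h0
    intro h3
    exact this (by linear_combination h3)
  · rw [smul_join, collin_pt, collin_tanv]

/-! ### First relations between the kinds -/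

theorem IsRealChord.isLine (h : IsRealChord L) : IsLine L := (isRealChord_iff.1 h).1

theorem IsRealAxis.isLine (h : IsRealAxis L) : IsLine L := (isRealAxis_iff.1 h).1

theorem IsRealChord.not_isUnisecant (h : IsRealChord L) : ¬ IsUnisecant L := by
  rw [isRealChord_iff] at h
  rw [isUnisecant_iff]
  rintro ⟨-, s, t, hst, -, hu⟩
  obtain ⟨-, a, b, c, d, hdet, h1, h2⟩ := h
  have e1 := hu _ _ h1
  have e2 := hu _ _ h2
  have hs : s * (a * d - b * c) = 0 := by linear_combination a * (-e2) + c * e1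
  have ht : t * (a * d - b * c) = 0 := by linear_combination d * e1 - b * e2
  simp [hdet] at hs ht
  tauto

theorem IsRealChord.not_isPassant (h : IsRealChord L) : ¬ IsPassant L := by
  rw [isRealChord_iff] at h
  obtain ⟨-, a, b, c, d, hdet, h1, h2⟩ := h
  exact fun h => (isPassant_iff.1 h).2 a b (ne_zero_of_det hdet) h1

theorem IsUnisecant.not_isPassant (h : IsUnisecant L) : ¬ IsPassant L := by
  obtain ⟨-, x, hx, -⟩ := h
  exact fun h => h.2 x hx

/-- A line is a real chord, a unisecant or a passant. -/
theorem IsLine.trichotomy (h : IsLine L) : IsRealChord L ∨ IsUnisecant L ∨ IsPassant L := by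
  by_cases hp : IsPassant L
  · exact .inr (.inr hp)
  · rw [isPassant_iff] at hp
    push Not at hp
    obtain ⟨s, t, hst, hL⟩ := hp h
    by_cases hu : ∀ x y, pt x y ∈ L → x * t = y * s
    · exact .inr (.inl (isUnisecant_iff.2 ⟨h, s, t, hst, hL, hu⟩))
    · push Not at hu
      obtain ⟨x, y, hxy, hne⟩ := hu
      exact .inl (isRealChord_iff.2 ⟨h, s, t, x, y, fun h0 => hne (by linear_combination -h0), hL,
        hxy⟩)

theorem IsRealAxis.inOsculatingPlane (h : IsRealAxis L) : InOsculatingPlane L := by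
  obtain ⟨-, s, t, x, y, hdet, h1, -⟩ := isRealAxis_iff.1 h
  exact inOsculatingPlane_iff.2 ⟨s, t, ne_zero_of_det hdet, h1⟩

theorem IsRealAxis.isPassant (h : IsRealAxis L) : IsPassant L := by
  obtain ⟨hL, s, t, x, y, hdet, h1, h2⟩ := isRealAxis_iff.1 h
  refine isPassant_iff.2 ⟨hL, fun u v huv hmem => ?_⟩
  have e1 := pt_mem_plane_osc.1 (h1 hmem)
  have e2 := pt_mem_plane_osc.1 (h2 hmem)
  have hs : u * (s * y - t * x) = 0 := by linear_combination s * e2 - x * e1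
  have ht : v * (s * y - t * x) = 0 := by linear_combination t * e2 - y * e1
  simp [hdet] at hs ht
  tauto

end Kinds

/-! ### Transport between lines in normal form -/

section Transport

theorem dot_four {K : Type*} [Field K] (c v : Fin 4 → K) :
    c ⬝ᵥ v = c 0 * v 0 + c 1 * v 1 + c 2 * v 2 + c 3 * v 3 := by
  simp [dotProduct, Fin.sum_univ_succ]; ring

variable {F : Type*} [Field F]

theorem join_chord : (join ![1, 0, 0, 0] ![0, 0, 0, 1] : Submodule F (Fin 4 → F)) =
    plane ![0, 1, 0, 0] ⊓ plane ![0, 0, 1, 0] :=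
  join_eq_plane_inf (linearIndependent_of_minor 0 3 (by simp))
    (linearIndependent_of_minor 1 2 (by simp)) (by simp)

theorem join_axis : (join ![0, 1, 0, 0] ![0, 0, 1, 0] : Submodule F (Fin 4 → F)) =
    plane ![1, 0, 0, 0] ⊓ plane ![0, 0, 0, 1] :=
  join_eq_plane_inf (linearIndependent_of_minor 1 2 (by simp))
    (linearIndependent_of_minor 0 3 (by simp)) (by simp)

theorem join_tangent : (join ![0, 0, 1, 0] ![0, 0, 0, 1] : Submodule F (Fin 4 → F)) =
    plane ![1, 0, 0, 0] ⊓ plane ![0, 1, 0, 0] :=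
  join_eq_plane_inf (linearIndependent_of_minor 2 3 (by simp))
    (linearIndependent_of_minor 0 1 (by simp)) (by simp)

theorem join_unisecant_osc (w : F) : join ![0, 1, w, 0] ![0, 0, 0, 1] =
    plane ![1, 0, 0, 0] ⊓ plane ![0, w, -1, 0] :=
  join_eq_plane_inf (linearIndependent_of_minor 1 3 (by simp))
    (linearIndependent_of_minor 0 2 (by simp)) (by simp)

theorem join_unisecant (w : F) : join ![-w, 0, 1, 0] ![0, 0, 0, 1] =
    plane ![1, 0, w, 0] ⊓ plane ![0, 1, 0, 0] :=
  join_eq_plane_inf (linearIndependent_of_minor 2 3 (by simp))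
    (linearIndependent_of_minor 0 1 (by simp)) (by simp)

theorem join_passant (w : F) : join ![0, 0, 1, 0] ![0, w, 0, 1] =
    plane ![1, 0, 0, 0] ⊓ plane ![0, 1, 0, -w] :=
  join_eq_plane_inf (linearIndependent_of_minor 2 3 (by simp))
    (linearIndependent_of_minor 0 1 (by simp)) (by simp)

theorem join_passant_left (w : F) : join ![0, 1, 0, 0] ![w, 0, 1, 0] =
    plane ![1, 0, -w, 0] ⊓ plane ![0, 0, 0, 1] :=
  join_eq_plane_inf (linearIndependent_of_minor 1 2 (by simp))
    (linearIndependent_of_minor 0 3 (by simp)) (by simp)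

theorem join_passant_right (w : F) : join ![w, 1, 0, 0] ![0, 0, 1, 0] =
    plane ![1, -w, 0, 0] ⊓ plane ![0, 0, 0, 1] :=
  join_eq_plane_inf (linearIndependent_of_minor 1 2 (by simp))
    (linearIndependent_of_minor 0 3 (by simp)) (by simp)

variable (a b c d : F) (h : a * d - b * c ≠ 0)

/-- The two points on the chord are both fixed or interchanged: the stabilizer is the normalizer of
the split torus. -/
theorem smul_chord_iff :
    mkGL a b c d h • (join ![1, 0, 0, 0] ![0, 0, 0, 1] : Submodule F (Fin 4 → F)) =
      join ![1, 0, 0, 0] ![0, 0, 0, 1] ↔ (b = 0 ∧ c = 0) ∨ (a = 0 ∧ d = 0) := by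
  nth_rw 2 [join_chord]
  rw [smul_join_eq_iff (linearIndependent_of_minor 0 3 (by simp))
    (linearIndependent_of_minor 1 2 (by simp))]
  simp only [dot_four, collin_mkGL]
  simp
  constructor
  · rintro ⟨rfl | rfl, rfl | rfl⟩ <;> simp at h ⊢
  · rintro (⟨rfl, rfl⟩ | ⟨rfl, rfl⟩) <;> simp

theorem smul_axis_iff (h3 : (3 : F) ≠ 0) :
    mkGL a b c d h • (join ![0, 1, 0, 0] ![0, 0, 1, 0] : Submodule F (Fin 4 → F)) =
      join ![0, 1, 0, 0] ![0, 0, 1, 0] ↔ (b = 0 ∧ c = 0) ∨ (a = 0 ∧ d = 0) := by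
  nth_rw 2 [join_axis]
  rw [smul_join_eq_iff (linearIndependent_of_minor 1 2 (by simp))
    (linearIndependent_of_minor 0 3 (by simp))]
  simp only [dot_four, collin_mkGL]
  simp [h3]
  constructor
  · rintro ⟨rfl | rfl, rfl | rfl, -⟩ <;> simp at h ⊢
  · rintro (⟨rfl, rfl⟩ | ⟨rfl, rfl⟩) <;> simp

/-- In characteristic `3` the coefficients that would constrain the matrix are multiples of `3`. -/
theorem smul_axis_of_three_eq_zero (h3 : (3 : F) = 0) (g : GL (Fin 2) F) :
    g • (join ![0, 1, 0, 0] ![0, 0, 1, 0] : Submodule F (Fin 4 → F)) =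
      join ![0, 1, 0, 0] ![0, 0, 1, 0] := by
  obtain ⟨a, b, c, d, h, rfl⟩ := exists_mkGL g
  nth_rw 2 [join_axis]
  rw [smul_join_eq_iff (linearIndependent_of_minor 1 2 (by simp))
    (linearIndependent_of_minor 0 3 (by simp))]
  simp [collin_mkGL, h3]

theorem smul_tangent_iff :
    mkGL a b c d h • (join ![0, 0, 1, 0] ![0, 0, 0, 1] : Submodule F (Fin 4 → F)) =
      join ![0, 0, 1, 0] ![0, 0, 0, 1] ↔ b = 0 := by
  nth_rw 2 [join_tangent]
  rw [smul_join_eq_iff (linearIndependent_of_minor 2 3 (by simp))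
    (linearIndependent_of_minor 0 1 (by simp))]
  simp only [dot_four, collin_mkGL]
  simp
  constructor
  · rintro ⟨-, -, rfl, -⟩; rfl
  · rintro rfl; simp

/-- `b = 0` fixes the point `P(0)`. The second equation can be solved with `w' = 0` by a choice of
`c` when `2 ≠ 0`. When `2 = 0` it only rescales `w`, so `w = 0` stays apart from `w ≠ 0`. -/
theorem smul_unisecant_osc_iff (w w' : F) :
    mkGL a b c d h • join ![0, 1, w, 0] ![0, 0, 0, 1] = join ![0, 1, w', 0] ![0, 0, 0, 1] ↔
      b = 0 ∧ 2 * c + w * d = w' * a := by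
  rw [join_unisecant_osc w', smul_join_eq_iff (linearIndependent_of_minor 1 3 (by simp))
    (linearIndependent_of_minor 0 2 (by simp))]
  simp only [dot_four, collin_mkGL]
  simp
  constructor
  · rintro ⟨-, h2, rfl, -⟩
    have : (a * d) * (2 * c + w * d - w' * a) = 0 := by linear_combination -h2
    have had : a * d ≠ 0 := by simpa using h
    exact ⟨rfl, sub_eq_zero.1 ((mul_eq_zero.1 this).resolve_left had)⟩
  · rintro ⟨rfl, h2⟩
    simp
    linear_combination -(a * d) * h2

/-- The last equation is the source of the square classes: `w` is rescaled by `(a / d)²`. The line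
leaves no freedom for `b` and `c`. -/
theorem smul_unisecant_iff {w w' : F} (hw : w ≠ 0) :
    mkGL a b c d h • join ![-w, 0, 1, 0] ![0, 0, 0, 1] = join ![-w', 0, 1, 0] ![0, 0, 0, 1] ↔
      b = 0 ∧ c = 0 ∧ w' * d ^ 2 = w * a ^ 2 := by
  rw [join_unisecant w', smul_join_eq_iff (linearIndependent_of_minor 2 3 (by simp))
    (linearIndependent_of_minor 0 1 (by simp))]
  simp only [dot_four, collin_mkGL]
  simp
  constructor
  · rintro ⟨h1, h2, h3, h4⟩
    have hb : b = 0 := by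
      rcases h4 with rfl | rfl
      · rfl
      · simpa using h3
    subst hb
    have had : a ≠ 0 ∧ d ≠ 0 := by simpa using h
    have hc : c = 0 := by simpa [hw, had.1] using h2
    subst hc
    exact ⟨rfl, rfl, mul_left_cancel₀ had.1 (by linear_combination h1)⟩
  · rintro ⟨rfl, rfl, h1⟩
    simp
    linear_combination a * h1

theorem smul_passant_iff (h3 : (3 : F) ≠ 0) {w w' : F} (hw : w' ≠ 0) :
    mkGL a b c d h • join ![0, 0, 1, 0] ![0, w, 0, 1] = join ![0, 0, 1, 0] ![0, w', 0, 1] ↔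
      b = 0 ∧ c = 0 ∧ w' * d ^ 2 = w * a ^ 2 := by
  rw [join_passant w', smul_join_eq_iff (linearIndependent_of_minor 2 3 (by simp))
    (linearIndependent_of_minor 0 1 (by simp))]
  simp only [dot_four, collin_mkGL]
  simp [h3]
  constructor
  · rintro ⟨h1, h2, h4, h5⟩
    have hb : b = 0 := by
      rcases h1 with rfl | rfl
      · simpa using h4
      · rfl
    subst hb
    have had : a ≠ 0 ∧ d ≠ 0 := by simpa using h
    have hc : c = 0 := by simpa [hw, had.2, h3] using h2
    subst hc
    exact ⟨rfl, rfl, mul_left_cancel₀ had.2 (by linear_combination -h5)⟩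
  · rintro ⟨rfl, rfl, h1⟩
    simp
    linear_combination -d * h1

theorem smul_passant_left_iff (h3 : (3 : F) = 0) {w w' : F} (hw : w' ≠ 0) :
    mkGL a b c d h • join ![0, 1, 0, 0] ![w, 0, 1, 0] = join ![0, 1, 0, 0] ![w', 0, 1, 0] ↔
      c = 0 ∧ w' * d ^ 2 = w * a ^ 2 := by
  rw [join_passant_left w', smul_join_eq_iff (linearIndependent_of_minor 1 2 (by simp))
    (linearIndependent_of_minor 0 3 (by simp))]
  simp only [dot_four, collin_mkGL]
  simp only [h3]
  simp
  constructor
  · rintro ⟨h1, h2, h4⟩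
    have h1 := h1.resolve_left hw
    -- Modulo `3` one has `b c² + 2 a c d = -(a d - b c) c`, so the surviving equation forces `c =
    -- 0`.
    have h5 : (a * d - b * c) * c = 0 := by linear_combination -h1 + a * c * d * h3
    have hc : c = 0 := (mul_eq_zero.1 h5).resolve_left h
    subst hc
    have had : a ≠ 0 ∧ d ≠ 0 := by simpa using h
    exact ⟨rfl, mul_left_cancel₀ had.1 (by linear_combination -h2)⟩
  · rintro ⟨rfl, h1⟩
    simp
    linear_combination -a * h1

theorem smul_passant_right_iff (h3 : (3 : F) = 0) {w w' : F} (hw : w ≠ 0) (hw' : w' ≠ 0) :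
    mkGL a b c d h • join ![w, 1, 0, 0] ![0, 0, 1, 0] = join ![w', 1, 0, 0] ![0, 0, 1, 0] ↔
      b = 0 ∧ c = 0 ∧ w' * d = w * a := by
  have h2 : (2 : F) ≠ 0 := fun h2 => one_ne_zero (α := F) (by linear_combination h3 - h2)
  rw [join_passant_right w', smul_join_eq_iff (linearIndependent_of_minor 1 2 (by simp))
    (linearIndependent_of_minor 0 3 (by simp))]
  simp only [dot_four, collin_mkGL]
  simp only [h3]
  simp [hw, hw']
  constructor
  · rintro ⟨h1, rfl, h4⟩
    have had : a ≠ 0 ∧ d ≠ 0 := by simpa using h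
    have hb : b = 0 := by simpa [had, h2] using h4
    subst hb
    exact ⟨rfl, rfl, mul_left_cancel₀ (pow_ne_zero 2 had.1) (by linear_combination -h1)⟩
  · rintro ⟨rfl, rfl, h1⟩
    simp
    linear_combination -a ^ 2 * h1

/-- A matching matrix would have to fix `∞`, and then also the point `(0, 1, 0, 0)` of the axis. The
two lines, however, meet the axis in `(0, 1, 0, 0)` and in `(0, 0, 1, 0)`. -/
theorem smul_passant_left_ne_right (h3 : (3 : F) = 0) {w w' : F} (hw : w ≠ 0) (hw' : w' ≠ 0)
    (g : GL (Fin 2) F) :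
    g • join ![0, 1, 0, 0] ![w, 0, 1, 0] ≠ join ![w', 1, 0, 0] ![0, 0, 1, 0] := by
  obtain ⟨a, b, c, d, h, rfl⟩ := exists_mkGL g
  rw [join_passant_right w', Ne, smul_join_eq_iff (linearIndependent_of_minor 1 2 (by simp))
    (linearIndependent_of_minor 0 3 (by simp))]
  simp only [dot_four, collin_mkGL]
  simp only [h3]
  simp [hw, hw']
  intro h1 h2 hc
  subst hc
  have had : a ≠ 0 ∧ d ≠ 0 := by simpa using h
  simp [had] at h1

end Transport

/-! ### Orbit sizes -/

section Sizes

variable {F : Type*} [Field F] [Finite F]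

theorem card_GL_two :
    Nat.card (GL (Fin 2) F) = (Nat.card F ^ 2 - 1) * (Nat.card F ^ 2 - Nat.card F) := by
  have := Fintype.ofFinite F
  rw [Matrix.card_GL_field, Fin.prod_univ_two, Nat.card_eq_fintype_card]
  simp

/-- The size of an orbit, by a parametrization of the stabilizer. -/
theorem ncard_orbit (L : Submodule F (Fin 4 → F)) {T : Type*} (φ : T → GL (Fin 2) F)
    (hinj : Function.Injective φ) (hφ : ∀ g, g • L = L ↔ ∃ t, φ t = g) :
    ((MulAction.orbit PGL(2, F) L).ncard : ℚ) * Nat.card T =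
      ((Nat.card F : ℚ) ^ 2 - 1) * ((Nat.card F : ℚ) ^ 2 - Nat.card F) := by
  classical
  have := Fintype.ofFinite (GL (Fin 2) F)
  have := Fintype.ofFinite (MulAction.orbit (GL (Fin 2) F) L)
  have := Fintype.ofFinite (MulAction.stabilizer (GL (Fin 2) F) L)
  have h1 := MulAction.card_orbit_mul_card_stabilizer_eq_card_group (GL (Fin 2) F) L
  have h2 : Nat.card T = Nat.card (MulAction.stabilizer (GL (Fin 2) F) L) := by
    refine Nat.card_congr (Equiv.ofBijective
      (fun t => ⟨φ t, MulAction.mem_stabilizer_iff.2 ((hφ _).2 ⟨t, rfl⟩)⟩) ⟨?_, ?_⟩)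
    · intro s t hst
      exact hinj (congrArg Subtype.val hst)
    · rintro ⟨g, hg⟩
      obtain ⟨t, ht⟩ := (hφ g).1 (MulAction.mem_stabilizer_iff.1 hg)
      exact ⟨t, Subtype.ext ht⟩
  rw [← Nat.card_eq_fintype_card, ← Nat.card_eq_fintype_card, ← Nat.card_eq_fintype_card, ← h2,
    card_GL_two] at h1
  rw [orbit_eq, ← Nat.card_coe_set_eq, ← Nat.cast_mul, h1]
  have hq : 1 ≤ Nat.card F := Nat.card_pos
  rw [Nat.cast_mul, Nat.cast_sub (Nat.one_le_pow _ _ hq),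
    Nat.cast_sub (Nat.le_self_pow two_ne_zero _)]
  push_cast
  rfl

end Sizes

/-! ### Orbit sizes by type of stabilizer. -/

section Sizes

variable {F : Type*} [Field F]

theorem mkGL_inj {a b c d a' b' c' d' : F} {h : a * d - b * c ≠ 0} {h' : a' * d' - b' * c' ≠ 0} :
    mkGL a b c d h = mkGL a' b' c' d' h' ↔ a = a' ∧ b = b' ∧ c = c' ∧ d = d' := by
  constructor
  · intro e
    have e : (!![a, b; c, d] : Matrix (Fin 2) (Fin 2) F) = !![a', b'; c', d'] :=
      congrArg Units.val e
    refine ⟨?_, ?_, ?_, ?_⟩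
    · simpa using congrFun (congrFun e 0) 0
    · simpa using congrFun (congrFun e 0) 1
    · simpa using congrFun (congrFun e 1) 0
    · simpa using congrFun (congrFun e 1) 1
  · rintro ⟨rfl, rfl, rfl, rfl⟩; rfl

theorem neg_unit_ne (h2 : (2 : F) ≠ 0) (x : Fˣ) : (x : F) ≠ -x := by
  intro h
  exact mul_ne_zero h2 x.ne_zero (by linear_combination h)

variable [Finite F]

theorem card_units : (Nat.card Fˣ : ℚ) = Nat.card F - 1 := by
  rw [Nat.card_units, Nat.cast_sub Nat.card_pos, Nat.cast_one]

theorem one_lt_card : (1 : ℚ) < Nat.card F := by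
  exact_mod_cast Finite.one_lt_card

variable (L : Submodule F (Fin 4 → F))

/-- Diagonal and antidiagonal matrices form two disjoint families of `(q - 1)²` elements, tagged by
a Boolean. -/
theorem ncard_orbit_monomial
    (hL : ∀ (a b c d : F) h, mkGL a b c d h • L = L ↔ (b = 0 ∧ c = 0) ∨ (a = 0 ∧ d = 0)) :
    ((MulAction.orbit PGL(2, F) L).ncard : ℚ) = (Nat.card F : ℚ) ^ 2 / 2 + Nat.card F / 2 := by
  have h := ncard_orbit L (T := Bool × Fˣ × Fˣ) (fun x => match x with
    | (true, a, d) => mkGL a 0 0 d (by simp)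
    | (false, b, c) => mkGL 0 b c 0 (by simp)) ?_ ?_
  · rw [Nat.card_prod, Nat.card_prod, Nat.card_eq_fintype_card, Fintype.card_bool] at h
    push_cast at h
    rw [card_units] at h
    have h1 := one_lt_card (F := F)
    set q := (Nat.card F : ℚ)
    have h2 : (2 * (q - 1) ^ 2) ≠ 0 := by have := sub_ne_zero.2 h1.ne'; positivity
    exact mul_right_cancel₀ h2 (by linear_combination h)
  · rintro ⟨_ | _, x, y⟩ ⟨_ | _, x', y'⟩ e <;>
      simp only [mkGL_inj] at e <;> simp [Units.ext_iff] at e ⊢ <;> tauto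
  · intro g
    obtain ⟨a, b, c, d, hd, rfl⟩ := exists_mkGL g
    rw [hL]
    constructor
    · rintro (⟨rfl, rfl⟩ | ⟨rfl, rfl⟩)
      · have : a ≠ 0 ∧ d ≠ 0 := by simpa using hd
        exact ⟨(true, Units.mk0 a this.1, Units.mk0 d this.2), rfl⟩
      · have : b ≠ 0 ∧ c ≠ 0 := by simpa using hd
        exact ⟨(false, Units.mk0 b this.1, Units.mk0 c this.2), rfl⟩
    · rintro ⟨⟨_ | _, x, y⟩, e⟩
      · exact .inr ⟨(mkGL_inj.1 e).1.symm, (mkGL_inj.1 e).2.2.2.symm⟩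
      · exact .inl ⟨(mkGL_inj.1 e).2.1.symm, (mkGL_inj.1 e).2.2.1.symm⟩

theorem ncard_orbit_triangular (hL : ∀ (a b c d : F) h, mkGL a b c d h • L = L ↔ b = 0) :
    ((MulAction.orbit PGL(2, F) L).ncard : ℚ) = (Nat.card F : ℚ) + 1 := by
  have h := ncard_orbit L (T := Fˣ × Fˣ × F) (fun x => mkGL x.1 0 x.2.2 x.2.1 (by simp)) ?_ ?_
  · rw [Nat.card_prod, Nat.card_prod] at h
    push_cast at h
    rw [card_units] at h
    have h1 := one_lt_card (F := F)
    set q := (Nat.card F : ℚ)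
    have h2 : (q - 1) ^ 2 * q ≠ 0 := by have := sub_ne_zero.2 h1.ne'; positivity
    exact mul_right_cancel₀ h2 (by linear_combination h)
  · rintro ⟨x, y, z⟩ ⟨x', y', z'⟩ e
    simp only [mkGL_inj] at e
    simp [Units.ext_iff]
    tauto
  · intro g
    obtain ⟨a, b, c, d, hd, rfl⟩ := exists_mkGL g
    rw [hL]
    constructor
    · rintro rfl
      have : a ≠ 0 ∧ d ≠ 0 := by simpa using hd
      exact ⟨(Units.mk0 a this.1, Units.mk0 d this.2, c), rfl⟩
    · rintro ⟨x, e⟩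
      exact (mkGL_inj.1 e).2.1.symm

theorem ncard_orbit_diagonal (hL : ∀ (a b c d : F) h, mkGL a b c d h • L = L ↔ b = 0 ∧ c = 0) :
    ((MulAction.orbit PGL(2, F) L).ncard : ℚ) = (Nat.card F : ℚ) ^ 2 + Nat.card F := by
  have h := ncard_orbit L (T := Fˣ × Fˣ) (fun x => mkGL x.1 0 0 x.2 (by simp)) ?_ ?_
  · rw [Nat.card_prod] at h
    push_cast at h
    rw [card_units] at h
    have h1 := one_lt_card (F := F)
    set q := (Nat.card F : ℚ)
    have h2 : (q - 1) ^ 2 ≠ 0 := by have := sub_ne_zero.2 h1.ne'; positivity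
    exact mul_right_cancel₀ h2 (by linear_combination h)
  · rintro ⟨x, y⟩ ⟨x', y'⟩ e
    simp only [mkGL_inj] at e
    simp [Units.ext_iff]
    tauto
  · intro g
    obtain ⟨a, b, c, d, hd, rfl⟩ := exists_mkGL g
    rw [hL]
    constructor
    · rintro ⟨rfl, rfl⟩
      have : a ≠ 0 ∧ d ≠ 0 := by simpa using hd
      exact ⟨(Units.mk0 a this.1, Units.mk0 d this.2), rfl⟩
    · rintro ⟨x, e⟩
      exact ⟨(mkGL_inj.1 e).2.1.symm, (mkGL_inj.1 e).2.2.1.symm⟩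

/-- The stabilizer is the scalars times the lower unipotent group, of order `(q - 1) q`. -/
theorem ncard_orbit_unipotent (hL : ∀ (a b c d : F) h, mkGL a b c d h • L = L ↔ b = 0 ∧ d = a) :
    ((MulAction.orbit PGL(2, F) L).ncard : ℚ) = (Nat.card F : ℚ) ^ 2 - 1 := by
  have h := ncard_orbit L (T := Fˣ × F) (fun x => mkGL x.1 0 x.2 x.1 (by simp)) ?_ ?_
  · rw [Nat.card_prod] at h
    push_cast at h
    rw [card_units] at h
    have h1 := one_lt_card (F := F)
    set q := (Nat.card F : ℚ)
    have h2 : (q - 1) * q ≠ 0 := by have := sub_ne_zero.2 h1.ne'; positivity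
    exact mul_right_cancel₀ h2 (by linear_combination h)
  · rintro ⟨x, y⟩ ⟨x', y'⟩ e
    simp only [mkGL_inj] at e
    simp [Units.ext_iff]
    tauto
  · intro g
    obtain ⟨a, b, c, d, hd, rfl⟩ := exists_mkGL g
    rw [hL]
    constructor
    · rintro ⟨rfl, rfl⟩
      have : d ≠ 0 := by simpa using hd
      exact ⟨(Units.mk0 d this, c), rfl⟩
    · rintro ⟨x, e⟩
      have := mkGL_inj.1 e
      exact ⟨this.2.1.symm, this.2.2.2.symm.trans this.1⟩

theorem ncard_orbit_scalar
    (hL : ∀ (a b c d : F) h, mkGL a b c d h • L = L ↔ b = 0 ∧ c = 0 ∧ d = a) :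
    ((MulAction.orbit PGL(2, F) L).ncard : ℚ) = (Nat.card F : ℚ) ^ 3 - Nat.card F := by
  have h := ncard_orbit L (T := Fˣ) (fun x => mkGL x 0 0 x (by simp)) ?_ ?_
  · rw [card_units] at h
    have h1 := one_lt_card (F := F)
    set q := (Nat.card F : ℚ)
    have h2 : (q - 1) ≠ 0 := sub_ne_zero.2 h1.ne'
    exact mul_right_cancel₀ h2 (by linear_combination h)
  · rintro x x' e
    simp only [mkGL_inj] at e
    simp [Units.ext_iff]
    tauto
  · intro g
    obtain ⟨a, b, c, d, hd, rfl⟩ := exists_mkGL g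
    rw [hL]
    constructor
    · rintro ⟨rfl, rfl, rfl⟩
      have : d ≠ 0 := by simpa using hd
      exact ⟨Units.mk0 d this, rfl⟩
    · rintro ⟨x, e⟩
      have := mkGL_inj.1 e
      exact ⟨this.2.1.symm, this.2.2.1.symm, this.2.2.2.symm.trans this.1⟩

/-- The two families `d = a` and `d = -a` are disjoint because `2 ≠ 0`; this is the origin of the
factor one half. -/
theorem ncard_orbit_sign (h2 : (2 : F) ≠ 0)
    (hL : ∀ (a b c d : F) h, mkGL a b c d h • L = L ↔ b = 0 ∧ c = 0 ∧ d ^ 2 = a ^ 2) :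
    ((MulAction.orbit PGL(2, F) L).ncard : ℚ) = (Nat.card F : ℚ) ^ 3 / 2 - Nat.card F / 2 := by
  have h := ncard_orbit L (T := Bool × Fˣ)
    (fun x => mkGL x.2 0 0 (if x.1 then x.2 else -x.2) (by split <;> simp)) ?_ ?_
  · rw [Nat.card_prod, Nat.card_eq_fintype_card, Fintype.card_bool] at h
    push_cast at h
    rw [card_units] at h
    have h1 := one_lt_card (F := F)
    set q := (Nat.card F : ℚ)
    have h2 : 2 * (q - 1) ≠ 0 := by have := sub_ne_zero.2 h1.ne'; positivity
    exact mul_right_cancel₀ h2 (by linear_combination h)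
  · rintro ⟨_ | _, x⟩ ⟨_ | _, x'⟩ e <;> have e := mkGL_inj.1 e <;>
      obtain rfl : x = x' := Units.ext e.1 <;> simp at e ⊢
    · exact absurd e.symm (neg_unit_ne h2 x)
    · exact absurd e (neg_unit_ne h2 x)
  · intro g
    obtain ⟨a, b, c, d, hd, rfl⟩ := exists_mkGL g
    rw [hL]
    constructor
    · rintro ⟨rfl, rfl, e⟩
      have ha : a ≠ 0 := by rintro rfl; simp at hd
      rcases sq_eq_sq_iff_eq_or_eq_neg.1 e with rfl | rfl
      · exact ⟨(true, Units.mk0 d ha), by simp⟩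
      · exact ⟨(false, Units.mk0 a ha), by simp⟩
    · rintro ⟨⟨_ | _, x⟩, e⟩ <;> have := mkGL_inj.1 e <;> simp at this
      · exact ⟨this.2.1.symm, this.2.2.1.symm, by rw [← this.2.2.2, ← this.1]; ring⟩
      · exact ⟨this.2.1.symm, this.2.2.1.symm, by rw [← this.2.2.2, ← this.1]⟩

theorem ncard_orbit_affine_sign (h2 : (2 : F) ≠ 0)
    (hL : ∀ (a b c d : F) h, mkGL a b c d h • L = L ↔ c = 0 ∧ d ^ 2 = a ^ 2) :
    ((MulAction.orbit PGL(2, F) L).ncard : ℚ) = (Nat.card F : ℚ) ^ 2 / 2 - 1 / 2 := by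
  have h := ncard_orbit L (T := Bool × Fˣ × F)
    (fun x => mkGL x.2.1 x.2.2 0 (if x.1 then x.2.1 else -x.2.1) (by split <;> simp)) ?_ ?_
  · rw [Nat.card_prod, Nat.card_prod, Nat.card_eq_fintype_card, Fintype.card_bool] at h
    push_cast at h
    rw [card_units] at h
    have h1 := one_lt_card (F := F)
    set q := (Nat.card F : ℚ)
    have h2 : 2 * ((q - 1) * q) ≠ 0 := by have := sub_ne_zero.2 h1.ne'; positivity
    exact mul_right_cancel₀ h2 (by linear_combination h)
  · rintro ⟨_ | _, x, y⟩ ⟨_ | _, x', y'⟩ e <;> have e := mkGL_inj.1 e <;>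
      obtain rfl : x = x' := Units.ext e.1 <;> obtain rfl : y = y' := e.2.1 <;> simp at e ⊢
    · exact absurd e.symm (neg_unit_ne h2 x)
    · exact absurd e (neg_unit_ne h2 x)
  · intro g
    obtain ⟨a, b, c, d, hd, rfl⟩ := exists_mkGL g
    rw [hL]
    constructor
    · rintro ⟨rfl, e⟩
      have ha : a ≠ 0 := by rintro rfl; simp at hd
      rcases sq_eq_sq_iff_eq_or_eq_neg.1 e with rfl | rfl
      · exact ⟨(true, Units.mk0 d ha, b), by simp⟩
      · exact ⟨(false, Units.mk0 a ha, b), by simp⟩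
    · rintro ⟨⟨_ | _, x, y⟩, e⟩ <;> have := mkGL_inj.1 e <;> simp at this
      · exact ⟨this.2.2.1.symm, by rw [← this.2.2.2, ← this.1]; ring⟩
      · exact ⟨this.2.2.1.symm, by rw [← this.2.2.2, ← this.1]⟩

/-- The size of an orbit whose stabilizer is the normalizer of a non-split torus. -/
theorem ncard_orbit_nonsplit {n : F} (hn : ∀ c d : F, (c, d) ≠ 0 → d ^ 2 - c * d + n * c ^ 2 ≠ 0)
    (hL : ∀ (a b c d : F) h, mkGL a b c d h • L = L ↔
      (a = d - c ∧ b = -(c * n)) ∨ (a = -d ∧ b = c * n - d)) :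
    ((MulAction.orbit PGL(2, F) L).ncard : ℚ) = (Nat.card F : ℚ) ^ 2 / 2 - Nat.card F / 2 := by
  have h := ncard_orbit L (T := Bool × {x : F × F // x ≠ 0})
    (fun x => match x with
      | (true, x) => mkGL (x.1.2 - x.1.1) (-(x.1.1 * n)) x.1.1 x.1.2
          (by have := hn _ _ x.2; intro h; exact this (by linear_combination h))
      | (false, x) => mkGL (-x.1.2) (x.1.1 * n - x.1.2) x.1.1 x.1.2
          (by have := hn _ _ x.2; intro h; exact this (by linear_combination -h))) ?_ ?_
  · have hc : (Nat.card {x : F × F // x ≠ 0} : ℚ) = (Nat.card F : ℚ) ^ 2 - 1 := by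
      have e : Nat.card {x : F × F // x ≠ 0} = Nat.card (F × F) - 1 := by
        have := Set.ncard_compl ({0} : Set (F × F))
        rwa [Set.ncard_singleton] at this
      rw [e, Nat.card_prod, Nat.cast_sub (Nat.mul_pos Nat.card_pos Nat.card_pos)]
      push_cast; ring
    rw [Nat.card_prod, Nat.card_eq_fintype_card (α := Bool), Fintype.card_bool] at h
    push_cast at h
    rw [hc] at h
    have h1 := one_lt_card (F := F)
    set q := (Nat.card F : ℚ)
    have h2 : 2 * (q ^ 2 - 1) ≠ 0 := by
      have : q ^ 2 - 1 > 0 := by nlinarith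
      positivity
    exact mul_right_cancel₀ h2 (by linear_combination h)
  · have key : ∀ c d : F, (c, d) ≠ 0 → d - c = -d → -(c * n) = c * n - d → False := by
      intro c d hcd h1 h2
      refine hn c d hcd ?_
      have e1 : c = 2 * d := by linear_combination -h1
      subst e1
      have e2 : d * (1 - 4 * n) = 0 := by linear_combination h2
      linear_combination -d * e2
    rintro ⟨_ | _, ⟨⟨c, d⟩, hx⟩⟩ ⟨_ | _, ⟨⟨c', d'⟩, hx'⟩⟩ e <;> have e := mkGL_inj.1 e <;>
      dsimp only at e <;> obtain ⟨e1, e2, rfl, rfl⟩ := e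
    · rfl
    · exact (key _ _ hx e1.symm e2.symm).elim
    · exact (key _ _ hx e1 e2).elim
    · rfl
  · intro g
    obtain ⟨a, b, c, d, hd, rfl⟩ := exists_mkGL g
    rw [hL]
    have hcd : (c, d) ≠ 0 := by
      intro h; simp at h; simp [h] at hd
    constructor
    · rintro (⟨rfl, rfl⟩ | ⟨rfl, rfl⟩)
      · exact ⟨(true, ⟨(c, d), hcd⟩), rfl⟩
      · exact ⟨(false, ⟨(c, d), hcd⟩), rfl⟩
    · rintro ⟨⟨_ | _, ⟨⟨c, d⟩, hx⟩⟩, e⟩ <;> have e := mkGL_inj.1 e <;>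
        dsimp only at e <;> obtain ⟨e1, e2, rfl, rfl⟩ := e
      · exact .inr ⟨e1.symm, e2.symm⟩
      · exact .inl ⟨e1.symm, e2.symm⟩

end Sizes

/-! ### Normal forms over the base field -/

section NormalForms

variable {F : Type*} [Field F] {L : Submodule F (Fin 4 → F)}

theorem inOsculatingPlane_smul_iff (g : GL (Fin 2) F) :
    InOsculatingPlane (g • L) ↔ InOsculatingPlane L :=
  ⟨fun h => by simpa using h.smul g⁻¹, fun h => h.smul g⟩

theorem isTangent_smul_iff (g : GL (Fin 2) F) : IsTangent (g • L) ↔ IsTangent L :=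
  ⟨fun h => by simpa using h.smul g⁻¹, fun h => h.smul g⟩

theorem isUnisecant_smul_iff (g : GL (Fin 2) F) : IsUnisecant (g • L) ↔ IsUnisecant L :=
  ⟨fun h => by simpa using h.smul g⁻¹, fun h => h.smul g⟩

theorem isRealAxis_smul_iff (g : GL (Fin 2) F) : IsRealAxis (g • L) ↔ IsRealAxis L :=
  ⟨fun h => by simpa using h.smul g⁻¹, fun h => h.smul g⟩

theorem equivJoin_iff {v w : Fin 4 → F} :
    EquivJoin L v w ↔ ∃ g : GL (Fin 2) F, g • join v w = L := mem_orbit_iff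

theorem EquivJoin.smul {v w : Fin 4 → F} (h : EquivJoin L v w) (g : GL (Fin 2) F) :
    EquivJoin (g • L) v w := by
  rw [equivJoin_iff] at h ⊢
  obtain ⟨k, rfl⟩ := h
  exact ⟨g * k, mul_smul g k _⟩

theorem equivJoin_self (v w : Fin 4 → F) : EquivJoin (join v w) v w :=
  MulAction.mem_orbit_self _

theorem EquivJoin.of_smul {g : GL (Fin 2) F} {v w v' w' : Fin 4 → F}
    (h : g • join v w = join v' w') : EquivJoin (join v w) v' w' := by
  rw [← inv_smul_eq_iff.2 h.symm]
  exact (equivJoin_self v' w').smul g⁻¹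

theorem EquivJoin.trans {v w v' w' : Fin 4 → F} (h : EquivJoin L v w)
    (h' : EquivJoin (join v w) v' w') : EquivJoin L v' w' := by
  obtain ⟨g, rfl⟩ := equivJoin_iff.1 h
  exact h'.smul g

theorem exists_move {s t : F} (h : s ≠ 0 ∨ t ≠ 0) : ∃ a c, a * t - s * c ≠ 0 := by
  by_cases ht : t = 0
  · exact ⟨0, 1, by simpa [ht] using h⟩
  · exact ⟨1, 0, by simpa using ht⟩

theorem pt_zero_one : (pt 0 1 : Fin 4 → F) = ![0, 0, 0, 1] := by
  ext i; fin_cases i <;> simp [pt]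

theorem pt_one_zero : (pt 1 0 : Fin 4 → F) = ![1, 0, 0, 0] := by
  ext i; fin_cases i <;> simp [pt]

theorem isRealChord_iff_equivJoin : IsRealChord L ↔ EquivJoin L ![1, 0, 0, 0] ![0, 0, 0, 1] := by
  rw [isRealChord_iff', equivJoin_iff, ← pt_zero_one, ← pt_one_zero]
  constructor
  · rintro ⟨s, t, x, y, h, rfl⟩
    exact ⟨mkGL s x t y (by rwa [mul_comm x t]), by simp [smul_join, collin_pt]⟩
  · rintro ⟨g, rfl⟩
    obtain ⟨a, b, c, d, h, rfl⟩ := exists_mkGL g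
    exact ⟨a, c, b, d, by rwa [mul_comm c b], by simp [smul_join, collin_pt]⟩

theorem join_axis_eq : (join ![0, 1, 0, 0] ![0, 0, 1, 0] : Submodule F (Fin 4 → F)) =
    plane (osc 1 0) ⊓ plane (osc 0 1) := by
  apply join_eq_plane_inf (linearIndependent_of_minor 1 2 (by simp))
    (linearIndependent_osc (by simp))
  simp [osc]

theorem isRealAxis_iff_equivJoin : IsRealAxis L ↔ EquivJoin L ![0, 1, 0, 0] ![0, 0, 1, 0] := by
  rw [isRealAxis_iff', equivJoin_iff, join_axis_eq]
  constructor
  · rintro ⟨s, t, x, y, h, rfl⟩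
    exact ⟨mkGL s x t y (by rwa [mul_comm x t]), by simp [smul_inf, smul_plane_osc]⟩
  · rintro ⟨g, rfl⟩
    obtain ⟨a, b, c, d, h, rfl⟩ := exists_mkGL g
    exact ⟨a, c, b, d, by rwa [mul_comm c b], by simp [smul_inf, smul_plane_osc]⟩

theorem isTangent_iff_equivJoin : IsTangent L ↔ EquivJoin L ![0, 0, 1, 0] ![0, 0, 0, 1] := by
  have e : (![0, 0, 1, 0] : Fin 4 → F) = tanv 0 1 1 0 := by
    ext i; fin_cases i <;> simp [tanv]
  rw [isTangent_iff, equivJoin_iff, ← pt_zero_one, e]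
  constructor
  · rintro ⟨s, t, u, v, h, rfl⟩
    exact ⟨mkGL u s v t (by intro h0; exact h (by linear_combination -h0)),
      by simp [smul_join, collin_pt, collin_tanv, join_comm]⟩
  · rintro ⟨g, rfl⟩
    obtain ⟨a, b, c, d, h, rfl⟩ := exists_mkGL g
    exact ⟨b, d, a, c, by intro h0; exact h (by linear_combination -h0),
      by simp [smul_join, collin_pt, collin_tanv, join_comm]⟩

/-- A line through `P(0)`. -/
theorem IsLine.exists_join_pt_zero (h : IsLine L) (h0 : ![0, 0, 0, 1] ∈ L) :
    ∃ x y z : F, ¬ (x = 0 ∧ y = 0 ∧ z = 0) ∧ L = join ![x, y, z, 0] ![0, 0, 0, 1] := by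
  obtain ⟨w, hw, rfl⟩ := h.eq_join_of_ne h0 (fun h => by simpa using congrFun h 3)
  refine ⟨w 0, w 1, w 2, ?_, ?_⟩
  · rintro ⟨h1, h2, h3⟩
    rw [LinearIndependent.pair_iff] at hw
    have := hw (w 3) (-1) (by ext i; fin_cases i <;> simp [h1, h2, h3])
    simp at this
  · refine le_antisymm (join_le_iff.2 ⟨right_mem_join _ _, mem_join.2 ⟨1, w 3, ?_⟩⟩)
      (join_le_iff.2 ⟨mem_join.2 ⟨-w 3, 1, ?_⟩, left_mem_join _ _⟩) <;>
    · ext i; fin_cases i <;> simp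

/-- The only point of the cubic on the line is moved to `P(0)`. -/
theorem IsUnisecant.exists_smul_join (h : IsUnisecant L) :
    ∃ (g : GL (Fin 2) F) (x y z : F), ¬ (x = 0 ∧ y = 0 ∧ z = 0) ∧
      L = g • join ![x, y, z, 0] ![0, 0, 0, 1] := by
  obtain ⟨hL, s, t, hst, hm, -⟩ := isUnisecant_iff.1 h
  obtain ⟨a, c, hd⟩ := exists_move hst
  have hm' : ![0, 0, 0, 1] ∈ (mkGL a s c t hd)⁻¹ • L := by
    rw [← collin_mem_smul (mkGL a s c t hd), smul_inv_smul, ← pt_zero_one, collin_pt]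
    simpa using hm
  obtain ⟨x, y, z, h0, e⟩ := (isLine_smul _ hL).exists_join_pt_zero hm'
  exact ⟨_, x, y, z, h0, by rw [← e, smul_inv_smul]⟩

theorem join_smul_left {r : F} (hr : r ≠ 0) (v w : Fin 4 → F) : join (r • v) w = join v w := by
  refine le_antisymm (join_le_iff.2 ⟨?_, right_mem_join _ _⟩)
    (join_le_iff.2 ⟨?_, right_mem_join _ _⟩)
  · exact Submodule.smul_mem _ _ (left_mem_join _ _)
  · exact (Submodule.smul_mem_iff _ hr).1 (left_mem_join _ _)

theorem isUnisecant_join_osc (w : F) : IsUnisecant (join ![0, 1, w, 0] ![0, 0, 0, 1]) := by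
  rw [isUnisecant_iff]
  refine ⟨isLine_join (linearIndependent_of_minor 1 3 (by simp)), 0, 1, by simp,
    pt_zero_one (F := F) ▸ right_mem_join _ _, fun x y hxy => ?_⟩
  rw [join_unisecant_osc, Submodule.mem_inf, mem_plane, mem_plane, dot_four] at hxy
  have := hxy.1
  simp [pt] at this
  simp [this]

theorem isUnisecant_join {d : F} :
    IsUnisecant (join ![-d, 0, 1, 0] ![0, 0, 0, 1]) := by
  rw [isUnisecant_iff]
  refine ⟨isLine_join (linearIndependent_of_minor 2 3 (by simp)), 0, 1, by simp,
    pt_zero_one (F := F) ▸ right_mem_join _ _, fun x y hxy => ?_⟩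
  rw [join_unisecant, Submodule.mem_inf, mem_plane, mem_plane, dot_four, dot_four] at hxy
  have h1 := hxy.1
  have h2 := hxy.2
  simp [pt] at h1 h2
  rcases h2 with rfl | rfl
  · simp
  · simpa using h1

/-- With the point at `P(0)`, the osculating plane containing the line passes through `P(0)`, hence
is the one at `0`, and `x = 0`. Among the lines through `P(0)` in that plane the tangent is the one
with `y = 0`; for the others only the ratio `z / y` is left. -/
theorem mem_unisecantsInOsc_iff :
    L ∈ unisecantsInOsc F ↔ ∃ w : F, EquivJoin L ![0, 1, w, 0] ![0, 0, 0, 1] := by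
  constructor
  · rintro ⟨⟨hu, ht⟩, ho⟩
    obtain ⟨g, x, y, z, h0, rfl⟩ := hu.exists_smul_join
    rw [inOsculatingPlane_smul_iff, inOsculatingPlane_iff] at ho
    obtain ⟨s, t, hst, hle⟩ := ho
    have h1 := mem_plane_osc.1 (hle (right_mem_join _ _))
    have h2 := mem_plane_osc.1 (hle (left_mem_join _ _))
    simp at h1
    subst h1
    simp at hst h2
    have hx := h2.resolve_left hst
    subst hx
    have hy : y ≠ 0 := by
      rintro rfl
      refine ht (isTangent_iff_equivJoin.2 (EquivJoin.smul ?_ g))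
      have hz : z ≠ 0 := by simpa using h0
      have e : (![0, 0, z, 0] : Fin 4 → F) = z • ![0, 0, 1, 0] := by simp
      rw [e, join_smul_left hz]
      exact equivJoin_self _ _
    refine ⟨z / y, EquivJoin.smul ?_ g⟩
    have e : (![0, y, z, 0] : Fin 4 → F) = y • ![0, 1, z / y, 0] := by simp [mul_div_cancel₀, hy]
    rw [e, join_smul_left hy]
    exact equivJoin_self _ _
  · rintro ⟨w, h⟩
    obtain ⟨g, rfl⟩ := equivJoin_iff.1 h
    refine ⟨⟨(isUnisecant_join_osc w).smul g, ?_⟩, ?_⟩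
    · rw [isTangent_smul_iff]
      rw [isTangent_iff_equivJoin]
      intro h
      obtain ⟨g, hg⟩ := equivJoin_iff.1 h
      obtain ⟨a, b, c, d, hd, rfl⟩ := exists_mkGL g
      rw [join_unisecant_osc, smul_join_eq_iff (linearIndependent_of_minor 2 3 (by simp))
        (linearIndependent_of_minor 0 2 (by simp))] at hg
      simp only [dot_four, collin_mkGL] at hg
      simp at hg
      obtain ⟨-, h1, rfl, -⟩ := hg
      simp at h1 hd
      tauto
    · refine InOsculatingPlane.smul g (inOsculatingPlane_iff.2 ⟨0, 1, by simp, ?_⟩)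
      rw [join_le_iff, mem_plane_osc, mem_plane_osc]
      simp

/-- Here `x ≠ 0`, and `y² - z x ≠ 0` since otherwise the line would carry a second point of the
cubic. A shear then removes the second coordinate. -/
theorem mem_unisecantsNotInOsc_iff :
    L ∈ unisecantsNotInOsc F ↔ ∃ d : F, d ≠ 0 ∧ EquivJoin L ![-d, 0, 1, 0] ![0, 0, 0, 1] := by
  constructor
  · rintro ⟨hu, ho⟩
    obtain ⟨g, x, y, z, h0, rfl⟩ := hu.exists_smul_join
    rw [inOsculatingPlane_smul_iff] at ho
    rw [isUnisecant_smul_iff] at hu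
    have hx : x ≠ 0 := by
      rintro rfl
      refine ho (inOsculatingPlane_iff.2 ⟨0, 1, by simp, ?_⟩)
      rw [join_le_iff, mem_plane_osc, mem_plane_osc]
      simp
    have key : ∀ v : Fin 4 → F, v ∈ join ![x, y, z, 0] ![0, 0, 0, 1] ↔
        ∃ r s : F, v = ![r * x, r * y, r * z, s] := by
      intro v
      rw [mem_join]
      refine exists_congr fun r => exists_congr fun s => ?_
      rw [eq_comm]
      simp
    -- If `y² = z x`, then `(x, y, z)` is proportional to `(x³, x² y, x y²)`, so the point with
    -- parameters `(x : y)` lies on the line besides `P(0)`.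
    have hz : y ^ 2 - z * x ≠ 0 := by
      intro h1
      refine IsRealChord.not_isUnisecant (isRealChord_iff.2 ⟨?_, 0, 1, x, y, ?_, ?_, ?_⟩) hu
      · exact isLine_join (linearIndependent_of_minor 0 3 (by simpa using hx))
      · simpa using hx
      · rw [pt_zero_one]; exact right_mem_join _ _
      · rw [key]
        refine ⟨x ^ 2, y ^ 3, ?_⟩
        ext i; fin_cases i <;> simp [pt]
        · ring
        · linear_combination x * h1
    obtain ⟨r, hr⟩ : ∃ r, (y ^ 2 - z * x) * r = 1 := ⟨_, mul_inv_cancel₀ hz⟩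
    have hr0 : r ≠ 0 := by rintro rfl; simp at hr
    -- The shear with `c = -y / x` sends `(x, y, z)` to `(x, 0, (z x - y²) / x)`; scaling the third
    -- coordinate to `1` gives the parameter `x² / (y² - z x)`.
    refine ⟨x ^ 2 * r, mul_ne_zero (pow_ne_zero 2 hx) hr0, EquivJoin.smul ?_ g⟩
    refine EquivJoin.of_smul (g := mkGL 1 0 (-y / x) 1 (by simp)) ?_
    rw [join_unisecant, smul_join_eq_iff (linearIndependent_of_minor 0 3 (by simpa using hx))
        (linearIndependent_of_minor 0 1 (by simp))]
    simp only [dot_four, collin_mkGL]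
    simp
    constructor
    · field_simp
      linear_combination -x * hr
    · field_simp
      ring
  · rintro ⟨d, hd, h⟩
    obtain ⟨g, rfl⟩ := equivJoin_iff.1 h
    refine ⟨isUnisecant_join.smul g, ?_⟩
    rw [inOsculatingPlane_smul_iff, inOsculatingPlane_iff]
    rintro ⟨s, t, hst, hle⟩
    have h1 := mem_plane_osc.1 (hle (right_mem_join _ _))
    have h2 := mem_plane_osc.1 (hle (left_mem_join _ _))
    simp at h1
    subst h1
    simp [hd] at h2 hst
    tauto

/-- The osculating plane is moved to the one at `0`. A line in it that misses `P(0)` projects from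
`P(0)` isomorphically onto the two middle coordinates, so it is the graph of a linear form in them.
-/
theorem IsPassant.exists_smul_join (h : IsPassant L) (ho : InOsculatingPlane L) :
    ∃ (g : GL (Fin 2) F) (x y : F), L = g • join ![0, 0, 1, x] ![0, 1, 0, y] := by
  obtain ⟨s, t, hst, hle⟩ := inOsculatingPlane_iff.1 ho
  obtain ⟨a, c, hd⟩ := exists_move hst
  set g := mkGL a s c t hd with hg
  have hP := h.smul g⁻¹
  have hle' : g⁻¹ • L ≤ plane (osc 0 1) := by
    rw [← smul_le_smul_iff g, smul_inv_smul, hg, smul_plane_osc]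
    simpa using hle
  have h0 : ∀ v ∈ g⁻¹ • L, v 0 = 0 := by
    intro v hv
    simpa using mem_plane_osc.1 (hle' hv)
  have h1 : ![0, 0, 0, 1] ∉ g⁻¹ • L := by
    have := (isPassant_iff.1 hP).2 0 1 (by simp)
    rwa [pt_zero_one] at this
  obtain ⟨v, w, hvw, e⟩ := hP.1.exists_join
  have hv : v ∈ g⁻¹ • L := e ▸ left_mem_join _ _
  have hw : w ∈ g⁻¹ • L := e ▸ right_mem_join _ _
  have hv0 := h0 v hv
  have hw0 := h0 w hw
  -- Injectivity of the projection: a vector of the line with both middle coordinates zero is a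
  -- multiple of `P(0)`, which is not on the line.
  have hD : v 1 * w 2 - v 2 * w 1 ≠ 0 := by
    intro hD
    have hmem : ∀ r s : F, r * v 1 + s * w 1 = 0 → r * v 2 + s * w 2 = 0 →
        r * v 3 + s * w 3 = 0 := by
      intro r s e1 e2
      by_contra e3
      refine h1 ?_
      have hm := (g⁻¹ • L).add_mem ((g⁻¹ • L).smul_mem r hv) ((g⁻¹ • L).smul_mem s hw)
      rw [← (g⁻¹ • L).smul_mem_iff e3]
      convert hm using 1
      ext i; fin_cases i <;> simp [hv0, hw0, e1, e2]
    rw [LinearIndependent.pair_iff] at hvw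
    have hli : ∀ r s : F, r * v 1 + s * w 1 = 0 → r * v 2 + s * w 2 = 0 → r = 0 ∧ s = 0 := by
      intro r s e1 e2
      refine hvw r s ?_
      ext i; fin_cases i <;> simp [hv0, hw0, e1, e2, hmem r s e1 e2]
    have h2 := hli (w 2) (-v 2) (by linear_combination hD) (by ring)
    have h3 := hli (w 1) (-v 1) (by ring) (by linear_combination -hD)
    have h4 := hli 1 0 (by simpa using h3.2) (by simpa using h2.2)
    simp at h4
  set D := v 1 * w 2 - v 2 * w 1
  refine ⟨g, (v 1 * w 3 - w 1 * v 3) / D, (w 2 * v 3 - v 2 * w 3) / D, ?_⟩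
  rw [← hP.1.eq_join (v := ![0, 0, 1, (v 1 * w 3 - w 1 * v 3) / D])
    (w := ![0, 1, 0, (w 2 * v 3 - v 2 * w 3) / D]) (linearIndependent_of_minor 2 1 (by simp)),
    smul_inv_smul]
  · rw [← (g⁻¹ • L).smul_mem_iff hD]
    convert (g⁻¹ • L).sub_mem ((g⁻¹ • L).smul_mem (v 1) hw) ((g⁻¹ • L).smul_mem (w 1) hv) using 1
    ext i; fin_cases i <;> simp [hv0, hw0, mul_div_cancel₀, hD] <;> ring
  · rw [← (g⁻¹ • L).smul_mem_iff hD]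
    convert (g⁻¹ • L).sub_mem ((g⁻¹ • L).smul_mem (w 2) hv) ((g⁻¹ • L).smul_mem (v 2) hw) using 1
    ext i; fin_cases i <;> simp [hv0, hw0, mul_div_cancel₀, hD] <;> ring

/-- Passants in an osculating plane, other than the real axes, in characteristic not `3`. -/
theorem isPassant_inOsc_not_isRealAxis_iff (h3 : (3 : F) ≠ 0) :
    (IsPassant L ∧ InOsculatingPlane L ∧ ¬ IsRealAxis L) ↔
      ∃ v : F, v ≠ 0 ∧ EquivJoin L ![0, 0, 1, 0] ![0, v, 0, 1] := by
  constructor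
  · rintro ⟨hp, ho, ha⟩
    obtain ⟨g, x, y, rfl⟩ := hp.exists_smul_join ho
    rw [isRealAxis_smul_iff] at ha
    -- The shear with `c = -x / 3` turns the two vectors into `(0, 0, 1, 0)` and `(0, 1, *, y + x² /
    -- 3)`. If the last entry vanished, the line would be equivalent to the standard real axis;
    -- otherwise its inverse is the parameter.
    have hy : y + x ^ 2 / 3 ≠ 0 := by
      intro hy
      refine ha (isRealAxis_iff_equivJoin.2 ?_)
      refine EquivJoin.of_smul (g := mkGL 1 0 (-x / 3) 1 (by simp)) ?_
      rw [join_axis, smul_join_eq_iff (linearIndependent_of_minor 2 1 (by simp))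
        (linearIndependent_of_minor 0 3 (by simp))]
      simp only [dot_four, collin_mkGL]
      simp
      field_simp at hy ⊢
      constructor
      · ring
      · linear_combination hy
    obtain ⟨r, hr⟩ : ∃ r, (y + x ^ 2 / 3) * r = 1 := ⟨_, mul_inv_cancel₀ hy⟩
    have hr0 : r ≠ 0 := by rintro rfl; simp at hr
    refine ⟨r, hr0, EquivJoin.smul ?_ g⟩
    refine EquivJoin.of_smul (g := mkGL 1 0 (-x / 3) 1 (by simp)) ?_
    rw [join_passant, smul_join_eq_iff (linearIndependent_of_minor 2 1 (by simp))
      (linearIndependent_of_minor 0 1 (by simp))]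
    simp only [dot_four, collin_mkGL]
    simp
    field_simp at hr ⊢
    constructor
    · exact .inr (by ring)
    · linear_combination -hr
  · rintro ⟨v, hv, h⟩
    obtain ⟨g, rfl⟩ := equivJoin_iff.1 h
    have hline : IsLine (join ![0, 0, 1, 0] ![0, v, 0, 1]) :=
      isLine_join (linearIndependent_of_minor 2 3 (by simp))
    refine ⟨IsPassant.smul g (isPassant_iff.2 ⟨hline, fun s t hst hmem => ?_⟩),
      InOsculatingPlane.smul g (inOsculatingPlane_iff.2 ⟨0, 1, by simp, ?_⟩), ?_⟩
    · rw [join_passant, Submodule.mem_inf, mem_plane, mem_plane, dot_four, dot_four] at hmem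
      have h1 := hmem.1
      have h2 := hmem.2
      simp [pt] at h1
      subst h1
      simp [pt, hv] at h2 hst
      tauto
    · rw [join_le_iff, mem_plane_osc, mem_plane_osc]
      simp
    · rw [isRealAxis_smul_iff, isRealAxis_iff]
      rintro ⟨-, s, t, x, y, hdet, h1, h2⟩
      -- The osculating plane at `0` is the only one through the normal form, so two different ones
      -- are impossible.
      have key : ∀ s t : F, join ![0, 0, 1, 0] ![0, v, 0, 1] ≤ plane (osc s t) → s = 0 := by
        intro s t hle
        have e1 := mem_plane_osc.1 (hle (left_mem_join _ _))
        have e2 := mem_plane_osc.1 (hle (right_mem_join _ _))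
        simp [h3] at e1 e2
        rcases e1 with rfl | rfl
        · rfl
        · simpa using e2
      simp [key _ _ h1, key _ _ h2] at hdet

end NormalForms

/-! ### Square classes in a finite field. -/

section Squares

variable {F : Type*} [Field F]

theorem isSquare_mul_of_not_isSquare [Finite F] {a b : F} (ha : ¬ IsSquare a) (hb : ¬ IsSquare b) :
    IsSquare (a * b) := by
  classical
  have := Fintype.ofFinite F
  have h0 : a * b ≠ 0 := mul_ne_zero (by rintro rfl; simp at ha) (by rintro rfl; simp at hb)
  rw [← quadraticChar_one_iff_isSquare h0, map_mul, quadraticChar_neg_one_iff_not_isSquare.2 ha,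
    quadraticChar_neg_one_iff_not_isSquare.2 hb]
  norm_num

/-- All non-squares form one class: if `a b = s²`, then `r = s / a`. -/
theorem exists_sq_ratio_of_not_isSquare [Finite F] {a b : F} (ha : ¬ IsSquare a)
    (hb : ¬ IsSquare b) : ∃ r, r ≠ 0 ∧ a * r ^ 2 = b := by
  obtain ⟨s, hs⟩ := isSquare_mul_of_not_isSquare ha hb
  have ha0 : a ≠ 0 := by rintro rfl; simp at ha
  have hb0 : b ≠ 0 := by rintro rfl; simp at hb
  have hs0 : s ≠ 0 := by rintro rfl; simp [ha0, hb0] at hs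
  refine ⟨s / a, div_ne_zero hs0 ha0, ?_⟩
  field_simp
  linear_combination -hs

theorem exists_sq_ratio_of_isSquare {a b : F} (ha : IsSquare a) (hb : IsSquare b) (ha0 : a ≠ 0)
    (hb0 : b ≠ 0) : ∃ r, r ≠ 0 ∧ a * r ^ 2 = b := by
  obtain ⟨s, rfl⟩ := ha
  obtain ⟨t, rfl⟩ := hb
  simp at ha0 hb0
  exact ⟨t / s, div_ne_zero hb0 ha0, by field_simp⟩

theorem isSquare_iff_of_sq_ratio {a b r s : F} (hr : r ≠ 0) (h : a * r ^ 2 = b * s ^ 2) :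
    IsSquare b → IsSquare a := by
  rintro ⟨t, rfl⟩
  exact ⟨t * s / r, by field_simp; linear_combination h⟩

end Squares

/-! ### Characteristic three: the axis of the osculating developable. -/

section Three

variable {F : Type*} [Field F] {L : Submodule F (Fin 4 → F)}

/-- Cubing is the Frobenius map, injective and hence surjective on a finite field. -/
theorem exists_cube_root [Finite F] (h3 : (3 : F) = 0) (x : F) : ∃ r, r ^ 3 = x := by
  have hinj : Function.Injective (fun r : F => r ^ 3) := by
    intro r s hrs
    have hrs : r ^ 3 = s ^ 3 := hrs
    have : (r - s) ^ 3 = 0 := by linear_combination hrs - (r ^ 2 * s - r * s ^ 2) * h3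
    exact sub_eq_zero.1 (pow_eq_zero_iff three_ne_zero |>.1 this)
  exact Finite.injective_iff_surjective.1 hinj x

/-- In characteristic `3` the osculating forms are `t³ X₀ - s³ X₃`. They all belong to the pencil of
planes through `X₀ = X₃ = 0`. -/
theorem axisOfDevelopable_eq (h3 : (3 : F) = 0) :
    axisOfDevelopable F = join ![0, 1, 0, 0] ![0, 0, 1, 0] := by
  rw [join_axis_eq]
  refine le_antisymm (le_inf ?_ ?_) (le_iInf fun x => ?_)
  · rw [← osculatingPlane_none]; exact iInf_le _ _
  · rw [← osculatingPlane_some]; exact iInf_le _ _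
  · obtain ⟨a, b, -, -, e⟩ := exists_homogeneous x
    rw [e]
    rintro v ⟨h1, h2⟩
    rw [SetLike.mem_coe, mem_plane_osc] at h1 h2
    rw [mem_plane_osc]
    simp at h1 h2
    simp [h1, h2, h3]

theorem smul_axisOfDevelopable (h3 : (3 : F) = 0) (g : GL (Fin 2) F) :
    g • axisOfDevelopable F = axisOfDevelopable F := by
  rw [axisOfDevelopable_eq h3, smul_axis_of_three_eq_zero h3]

theorem isRealAxis_axisOfDevelopable (h3 : (3 : F) = 0) : IsRealAxis (axisOfDevelopable F) := by
  rw [axisOfDevelopable_eq h3, isRealAxis_iff_equivJoin]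
  exact equivJoin_self _ _

theorem isRealAxis_iff_eq_axisOfDevelopable (h3 : (3 : F) = 0) :
    IsRealAxis L ↔ L = axisOfDevelopable F := by
  constructor
  · rw [isRealAxis_iff_equivJoin, equivJoin_iff, ← axisOfDevelopable_eq h3]
    rintro ⟨g, rfl⟩
    exact smul_axisOfDevelopable h3 g
  · rintro rfl; exact isRealAxis_axisOfDevelopable h3

theorem isPassant_join_left {u : F} :
    IsPassant (join ![0, 1, 0, 0] ![u, 0, 1, 0]) ∧
      InOsculatingPlane (join ![0, 1, 0, 0] ![u, 0, 1, 0]) := by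
  refine ⟨isPassant_iff.2 ⟨isLine_join (linearIndependent_of_minor 1 2 (by simp)), ?_⟩,
    inOsculatingPlane_iff.2 ⟨1, 0, by simp, ?_⟩⟩
  · intro s t hst hmem
    rw [join_passant_left, Submodule.mem_inf, mem_plane, mem_plane, dot_four, dot_four] at hmem
    have h1 := hmem.1
    have h2 := hmem.2
    simp [pt] at h2
    subst h2
    simp [pt] at h1 hst
    tauto
  · rw [join_le_iff, mem_plane_osc, mem_plane_osc]
    simp

theorem isPassant_join_right {w : F} :
    IsPassant (join ![w, 1, 0, 0] ![0, 0, 1, 0]) ∧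
      InOsculatingPlane (join ![w, 1, 0, 0] ![0, 0, 1, 0]) := by
  refine ⟨isPassant_iff.2 ⟨isLine_join (linearIndependent_of_minor 1 2 (by simp)), ?_⟩,
    inOsculatingPlane_iff.2 ⟨1, 0, by simp, ?_⟩⟩
  · intro s t hst hmem
    rw [join_passant_right, Submodule.mem_inf, mem_plane, mem_plane, dot_four, dot_four] at hmem
    have h1 := hmem.1
    have h2 := hmem.2
    simp [pt] at h2
    subst h2
    simp [pt] at h1 hst
    tauto
  · rw [join_le_iff, mem_plane_osc, mem_plane_osc]
    simp

/-- The involution `x ↦ 1 / x` reverses the coordinates. It carries the osculating plane at `0` to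
the one at `∞`, where the normal forms for characteristic `3` lie. -/
theorem equivJoin_reverse (x y : F) :
    EquivJoin (join ![0, 0, 1, x] ![0, 1, 0, y]) ![x, 1, 0, 0] ![y, 0, 1, 0] := by
  refine EquivJoin.of_smul (g := mkGL 0 1 1 0 (by simp)) ?_
  rw [smul_join, collin_mkGL, collin_mkGL]
  simp

/-- Passants in an osculating plane, in characteristic `3`. -/
theorem isPassant_inOsc_iff_of_three (h3 : (3 : F) = 0) :
    (IsPassant L ∧ InOsculatingPlane L ∧ L ≠ axisOfDevelopable F) ↔
      (∃ u : F, u ≠ 0 ∧ EquivJoin L ![0, 1, 0, 0] ![u, 0, 1, 0]) ∨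
      ∃ w : F, w ≠ 0 ∧ EquivJoin L ![w, 1, 0, 0] ![0, 0, 1, 0] := by
  have ha := axisOfDevelopable_eq h3
  constructor
  · rintro ⟨hp, ho, hne⟩
    obtain ⟨g, x, y, rfl⟩ := hp.exists_smul_join ho
    by_cases hx : x = 0
    · subst hx
      refine .inl ⟨y, ?_, (equivJoin_reverse 0 y).smul g⟩
      rintro rfl
      apply hne
      rw [join_comm, ← ha, smul_axisOfDevelopable h3]
    · refine .inr ⟨x, hx, ((equivJoin_reverse x y).trans ?_).smul g⟩
      -- The translation by `b` sends `(y, 0, 1, 0)` to `(y, 2b, 1, 0)`, which lies in the target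
      -- when `y = 2 b x`; modulo `3` this means `b = -y / x`.
      refine EquivJoin.of_smul (g := mkGL 1 (-y / x) 0 1 (by simp)) ?_
      rw [join_passant_right, smul_join_eq_iff (linearIndependent_of_minor 1 2 (by simp))
        (linearIndependent_of_minor 0 3 (by simp))]
      simp only [dot_four, collin_mkGL]
      simp [h3]
      field_simp
      linear_combination y * h3
  · have key : ∀ (M : Submodule F (Fin 4 → F)) v, v ∈ M → v 0 ≠ 0 → M ≠ axisOfDevelopable F := by
      rintro M v hv h0 rfl
      rw [ha, join_axis] at hv
      have := hv.1
      rw [SetLike.mem_coe, mem_plane, dot_four] at this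
      simp at this
      exact h0 this
    have hinv : ∀ (g : GL (Fin 2) F) (M : Submodule F (Fin 4 → F)), M ≠ axisOfDevelopable F →
        g • M ≠ axisOfDevelopable F := by
      intro g M hM h
      rw [← smul_axisOfDevelopable h3 g] at h
      exact hM (smul_left_cancel g h)
    rintro (⟨u, hu, h⟩ | ⟨w, hw, h⟩) <;> obtain ⟨g, rfl⟩ := equivJoin_iff.1 h
    · exact ⟨isPassant_join_left.1.smul g, isPassant_join_left.2.smul g,
        hinv g _ (key _ _ (right_mem_join _ _) (by simpa using hu))⟩
    · exact ⟨isPassant_join_right.1.smul g, isPassant_join_right.2.smul g,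
        hinv g _ (key _ _ (left_mem_join _ _) (by simpa using hw))⟩

/-- Every rational plane through the axis is osculating, because its coefficients have cube roots. A
line meeting the axis spans such a plane with it: `s³` and `t³` are the outer coordinates of a
second point, and if both vanish the line is the axis. -/
theorem mem_passantsMeetingAxis_iff [Finite F] (h3 : (3 : F) = 0) :
    L ∈ passantsMeetingAxis F ↔ IsPassant L ∧ InOsculatingPlane L ∧ L ≠ axisOfDevelopable F := by
  constructor
  · rintro ⟨hp, hne, hm⟩
    refine ⟨hp, ?_, hne⟩
    obtain ⟨v, hv, hv0⟩ := Submodule.exists_mem_ne_zero_of_ne_bot hm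
    obtain ⟨w, hw, rfl⟩ := hp.1.eq_join_of_ne hv.1 hv0
    have hv2 := hv.2
    rw [axisOfDevelopable_eq h3, join_axis] at hv2
    have e0 := hv2.1
    have e3 := hv2.2
    rw [SetLike.mem_coe, mem_plane, dot_four] at e0 e3
    simp at e0 e3
    obtain ⟨s, hs⟩ := exists_cube_root h3 (w 0)
    obtain ⟨t, ht⟩ := exists_cube_root h3 (w 3)
    by_cases hst : s ≠ 0 ∨ t ≠ 0
    · refine inOsculatingPlane_iff.2 ⟨s, t, hst, join_le_iff.2 ⟨?_, ?_⟩⟩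
      · rw [mem_plane_osc]; simp [h3, e0, e3]
      · rw [mem_plane_osc, h3, ← hs, ← ht]; ring
    · push Not at hst
      rw [hst.1] at hs
      rw [hst.2] at ht
      refine absurd ?_ hne
      refine hp.1.eq_of_le (isRealAxis_axisOfDevelopable h3).isLine ?_
      rw [axisOfDevelopable_eq h3, join_axis, join_le_iff, Submodule.mem_inf, Submodule.mem_inf,
        mem_plane, mem_plane, mem_plane, mem_plane]
      simp only [dot_four]
      simp [e0, e3, ← hs, ← ht]
  · rintro ⟨hp, ⟨x, hx⟩, hne⟩
    refine ⟨hp, hne, hp.1.inf_ne_bot (isRealAxis_axisOfDevelopable h3).isLine hx (iInf_le _ x) ?_⟩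
    obtain ⟨a, b, hab, -, e⟩ := exists_homogeneous x
    rw [e]
    exact plane_osc_ne_top hab

end Three

/-! ### Extension to the algebraic closure -/

section Extension

variable {F : Type*} [Field F]

local notation "K" => AlgebraicClosure F
local notation "ι" => algebraMap F (AlgebraicClosure F)

theorem algebraMap_two : ι 2 = 2 := map_ofNat _ 2

theorem algebraMap_three : ι 3 = 3 := map_ofNat _ 3

theorem three_ne_zero_closure (h3 : (3 : F) ≠ 0) : (3 : K) ≠ 0 := by
  rw [← algebraMap_three]
  exact (map_ne_zero ι).2 h3

theorem three_eq_zero_closure (h3 : (3 : F) = 0) : (3 : K) = 0 := by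
  rw [← algebraMap_three, h3, map_zero]

/-- The extension of a vector to the algebraic closure. -/
noncomputable def emb (v : Fin 4 → F) : Fin 4 → K := fun i => ι (v i)

theorem emb_dot (c v : Fin 4 → F) : emb c ⬝ᵥ emb v = ι (c ⬝ᵥ v) := by
  simp [dot_four, emb]

theorem emb_pt (s t : F) : emb (pt s t) = pt (ι s) (ι t) := by
  ext i; fin_cases i <;> simp [emb, pt]

theorem emb_osc (s t : F) : emb (osc s t) = osc (ι s) (ι t) := by
  ext i; fin_cases i <;> simp [emb, osc, algebraMap_three]

variable {L L' : Submodule F (Fin 4 → F)}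

theorem extend_le_iff {M : Submodule K (Fin 4 → K)} :
    extend L ≤ M ↔ ∀ v ∈ L, emb v ∈ M := by
  rw [extend, Submodule.span_le, Set.image_subset_iff]
  rfl

theorem emb_mem_extend_of_mem {v : Fin 4 → F} (h : v ∈ L) : emb v ∈ extend L :=
  Submodule.subset_span ⟨v, h, rfl⟩

theorem extend_le_plane_iff {c : Fin 4 → F} : extend L ≤ plane (emb c) ↔ L ≤ plane c := by
  rw [extend_le_iff]
  refine forall₂_congr fun v _ => ?_
  rw [mem_plane, mem_plane, emb_dot, map_eq_zero]

/-- A vector outside `L` is separated from `L` by a linear form over `F`; that form still vanishes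
on the extension of `L` and still not at the vector. Lines may therefore be compared after
extension. -/
theorem emb_mem_extend_iff {v : Fin 4 → F} : emb v ∈ extend L ↔ v ∈ L := by
  refine ⟨fun h => ?_, emb_mem_extend_of_mem⟩
  by_contra hv
  obtain ⟨f, hf, hle⟩ := Submodule.exists_le_ker_of_notMem hv
  set c : Fin 4 → F := fun i => f (Pi.single i 1) with hc
  have hfc : ∀ w, f w = c ⬝ᵥ w := by
    intro w
    rw [LinearMap.pi_apply_eq_sum_univ f w, dotProduct]
    refine Finset.sum_congr rfl fun i _ => ?_
    rw [smul_eq_mul, mul_comm]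
    congr 2
    ext j
    simp [Pi.single_apply, eq_comm]
  have h1 : L ≤ plane c := fun w hw => (hfc w).symm.trans (LinearMap.mem_ker.1 (hle hw))
  have h2 := extend_le_plane_iff.2 h1 h
  rw [mem_plane, emb_dot, map_eq_zero, ← hfc] at h2
  exact hf h2

theorem extend_injective (h : extend L = extend L') : L = L' := by
  ext v
  rw [← emb_mem_extend_iff, h, emb_mem_extend_iff]

theorem extend_join (v w : Fin 4 → F) : extend (join v w) = join (emb v) (emb w) := by
  refine le_antisymm (extend_le_iff.2 fun x hx => ?_) (join_le_iff.2 ⟨?_, ?_⟩)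
  · obtain ⟨a, b, rfl⟩ := mem_join.1 hx
    exact mem_join.2 ⟨ι a, ι b, by ext i; simp [emb, Algebra.smul_def]⟩
  · exact emb_mem_extend_of_mem (left_mem_join _ _)
  · exact emb_mem_extend_of_mem (right_mem_join _ _)

theorem exists_minor {v w : Fin 4 → F} (h : LinearIndependent F ![v, w]) :
    ∃ i j, v i * w j - v j * w i ≠ 0 := by
  by_contra! h0
  rw [LinearIndependent.pair_iff] at h
  obtain ⟨i, hi⟩ : ∃ i, v i ≠ 0 := by
    by_contra! hv
    have := h 1 0 (by ext i; simp [hv])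
    simp at this
  have := h (w i) (-v i) (by ext j; simp; linear_combination -h0 i j)
  exact hi (by simpa using this.2)

/-- A nonzero minor stays nonzero in the larger field. -/
theorem linearIndependent_emb {v w : Fin 4 → F} (h : LinearIndependent F ![v, w]) :
    LinearIndependent K ![emb v, emb w] := by
  obtain ⟨i, j, hij⟩ := exists_minor h
  refine linearIndependent_of_minor i j ?_
  have := (map_ne_zero ι).2 hij
  simpa [emb] using this

theorem isLine_extend (h : IsLine L) : IsLine (extend L) := by
  obtain ⟨v, w, hvw, rfl⟩ := h.exists_join
  rw [extend_join]
  exact isLine_join (linearIndependent_emb hvw)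

theorem extend_plane_inf {c d : Fin 4 → F} (h : LinearIndependent F ![c, d]) :
    extend (plane c ⊓ plane d) = plane (emb c) ⊓ plane (emb d) :=
  (isLine_extend (isLine_plane_inf h)).eq_of_le (isLine_plane_inf (linearIndependent_emb h))
    (le_inf (extend_le_plane_iff.2 inf_le_left) (extend_le_plane_iff.2 inf_le_right))

theorem det_emb {a b c d : F} (h : a * d - b * c ≠ 0) : ι a * ι d - ι b * ι c ≠ 0 := by
  rw [← map_mul, ← map_mul, ← map_sub]
  exact (map_ne_zero ι).2 h

theorem emb_collin (a b c d : F) (h : a * d - b * c ≠ 0) (v : Fin 4 → F) :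
    emb (collin (mkGL a b c d h) v) =
      collin (mkGL (ι a) (ι b) (ι c) (ι d) (det_emb h)) (emb v) := by
  rw [collin_mkGL, collin_mkGL]
  ext i
  fin_cases i <;> simp [emb, algebraMap_three, algebraMap_two]

theorem extend_smul (a b c d : F) (h : a * d - b * c ≠ 0) (hL : IsLine L) :
    extend (mkGL a b c d h • L) = mkGL (ι a) (ι b) (ι c) (ι d) (det_emb h) • extend L := by
  obtain ⟨v, w, -, rfl⟩ := hL.exists_join
  rw [smul_join, extend_join, extend_join, smul_join, emb_collin, emb_collin]

end Extension

/-! ### Frobenius -/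

section Frobenius

variable {F : Type*} [Field F] [Finite F]

local notation "K" => AlgebraicClosure F
local notation "ι" => algebraMap F (AlgebraicClosure F)

variable (F) in
/-- The Frobenius endomorphism of the algebraic closure over the base field. -/
noncomputable def frob : K →ₐ[F] K :=
  letI := Fintype.ofFinite F
  FiniteField.frobeniusAlgHom F K

theorem frob_apply (x : K) : frob F x = x ^ Nat.card F := by
  have := Fintype.ofFinite F
  rw [Nat.card_eq_fintype_card]
  simp only [frob, FiniteField.frobeniusAlgHom_apply]
  congr!

/-- The elements of `F` already exhaust the roots of `X ^ q - X`. -/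
theorem exists_of_frob_eq {x : K} (h : frob F x = x) : ∃ a : F, ι a = x := by
  classical
  have := Fintype.ofFinite F
  by_contra! hx
  have hq : 1 < Fintype.card F := Fintype.one_lt_card
  have h0 := FiniteField.X_pow_card_sub_X_ne_zero K hq
  have hsub : (insert x (Finset.univ.image ι)).val ⊆ (X ^ Fintype.card F - X : K[X]).roots := by
    intro y hy
    rw [mem_roots h0, IsRoot, eval_sub, eval_pow, eval_X, sub_eq_zero]
    rw [Finset.mem_val, Finset.mem_insert] at hy
    rcases hy with rfl | hy
    · rw [← Nat.card_eq_fintype_card, ← frob_apply, h]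
    · obtain ⟨a, -, rfl⟩ := Finset.mem_image.1 hy
      rw [← map_pow, FiniteField.pow_card]
  have h1 := Polynomial.card_le_degree_of_subset_roots hsub
  rw [FiniteField.X_pow_card_sub_X_natDegree_eq K hq, Finset.card_insert_of_notMem,
    Finset.card_image_of_injective _ (algebraMap F K).injective, Finset.card_univ] at h1
  · omega
  · intro h
    obtain ⟨a, -, ha⟩ := Finset.mem_image.1 h
    exact hx a ha

theorem isQuadraticNonrational_iff {x : K} :
    IsQuadraticNonrational x ↔ frob F (frob F x) = x ∧ frob F x ≠ x := by
  rw [IsQuadraticNonrational, frob_apply, frob_apply, sq, pow_mul]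

/-- Subtracting the Frobenius conjugate of the relation shows that `1` and `x` are independent over
`F`. All incidences between rational and imaginary objects are excluded through this. -/
theorem frob_ne_of_eq {x : K} (h : frob F x ≠ x) (a b : F) (e : ι a * x = ι b) : a = 0 ∧ b = 0 := by
  have h1 := congrArg (frob F) e
  rw [map_mul, AlgHom.commutes, AlgHom.commutes] at h1
  have h2 : ι a * (frob F x - x) = 0 := by linear_combination h1 - e
  have h3 := (mul_eq_zero.1 h2).resolve_right (sub_ne_zero.2 h)
  refine ⟨by simpa using h3, ?_⟩
  rw [h3, zero_mul] at e
  simpa using e.symm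

/-- `𝔽_{q²}` is spanned by `1` and any non-rational element. -/
theorem exists_affine {x y : K} (hx : IsQuadraticNonrational x) (hy : IsQuadraticNonrational y) :
    ∃ a b : F, a ≠ 0 ∧ y = ι a * x + ι b := by
  rw [isQuadraticNonrational_iff] at hx hy
  have hd := sub_ne_zero.2 hx.2
  have h1 : frob F ((frob F y - y) / (frob F x - x)) = (frob F y - y) / (frob F x - x) := by
    rw [map_div₀, map_sub, map_sub, hx.1, hy.1, ← neg_sub (frob F y), ← neg_sub (frob F x),
      neg_div_neg_eq]
  obtain ⟨a, ha⟩ := exists_of_frob_eq h1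
  rw [eq_div_iff hd] at ha
  have h2 : frob F (y - ι a * x) = y - ι a * x := by
    rw [map_sub, map_mul, AlgHom.commutes]
    linear_combination -ha
  obtain ⟨b, hb⟩ := exists_of_frob_eq h2
  refine ⟨a, b, ?_, by rw [hb]; ring⟩
  rintro rfl
  rw [map_zero, zero_mul] at ha
  exact sub_ne_zero.2 hy.2 ha.symm

/-- Fractional linear images of non-rational elements of `𝔽_{q²}`. -/
theorem IsQuadraticNonrational.mobius {x : K} (hx : IsQuadraticNonrational x) {a b c d : F}
    (h : a * d - b * c ≠ 0) : ι c * x + ι d ≠ 0 ∧ ι c * frob F x + ι d ≠ 0 ∧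
      IsQuadraticNonrational ((ι a * x + ι b) / (ι c * x + ι d)) ∧
      frob F ((ι a * x + ι b) / (ι c * x + ι d)) =
        (ι a * frob F x + ι b) / (ι c * frob F x + ι d) := by
  rw [isQuadraticNonrational_iff] at hx ⊢
  have h1 : ι c * x + ι d ≠ 0 := by
    intro h0
    have := frob_ne_of_eq hx.2 c (-d) (by rw [map_neg]; linear_combination h0)
    rw [neg_eq_zero] at this
    simp [this.1, this.2] at h
  have h2 : ι c * frob F x + ι d ≠ 0 := by
    have := (map_ne_zero (frob F)).2 h1
    rwa [map_add, map_mul, AlgHom.commutes, AlgHom.commutes] at this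
  have h3 : frob F ((ι a * x + ι b) / (ι c * x + ι d)) =
        (ι a * frob F x + ι b) / (ι c * frob F x + ι d) := by
    simp only [map_div₀, map_add, map_mul, AlgHom.commutes]
  refine ⟨h1, h2, ⟨?_, ?_⟩, h3⟩
  · rw [h3]
    simp only [map_div₀, map_add, map_mul, AlgHom.commutes, hx.1]
  · rw [h3, Ne, div_eq_div_iff h2 h1]
    intro e
    have : (ι a * ι d - ι b * ι c) * (frob F x - x) = 0 := by linear_combination e
    exact (mul_ne_zero (det_emb h) (sub_ne_zero.2 hx.2)) this

/-- A root of an irreducible polynomial `x² + x + n`. -/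
theorem exists_root_quadratic {n : F} (hn : Irreducible (X ^ 2 + X + C n : F[X])) :
    ∃ η : K, IsQuadraticNonrational η ∧ η ^ 2 + η + ι n = 0 ∧ frob F η = -1 - η := by
  have hdeg : (X ^ 2 + X + C n : F[X]).natDegree = 2 := by compute_degree!
  obtain ⟨η, hη⟩ := IsAlgClosed.exists_aeval_eq_zero K (X ^ 2 + X + C n : F[X])
    (by rw [degree_eq_natDegree hn.ne_zero, hdeg]; norm_num)
  have h1 : η ^ 2 + η + ι n = 0 := by simpa using hη
  have hne : frob F η ≠ η := by
    intro h
    obtain ⟨a, rfl⟩ := exists_of_frob_eq h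
    have h2 : a ^ 2 + a + n = 0 := by
      apply (algebraMap F K).injective
      simpa using h1
    have := degree_eq_one_of_irreducible_of_root hn (x := a) (by simpa using h2)
    rw [degree_eq_natDegree hn.ne_zero, hdeg] at this
    norm_num at this
  have h3 : (frob F η) ^ 2 + frob F η + ι n = 0 := by
    have := congrArg (frob F) h1
    simpa using this
  have h4 : frob F η = -1 - η := by
    have : (frob F η - η) * (frob F η + η + 1) = 0 := by linear_combination h3 - h1
    linear_combination (mul_eq_zero.1 this).resolve_left (sub_ne_zero.2 hne)
  refine ⟨η, isQuadraticNonrational_iff.2 ⟨?_, hne⟩, h1, h4⟩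
  rw [h4, map_sub, map_neg, map_one, h4]
  ring

end Frobenius

/-! ### Imaginary chords and axes -/

section ImaginaryRepresentatives

variable {F : Type*} [Field F] (n : F)

theorem isLine_imaginaryChord : IsLine (join ![n, -n, 0, 1] ![1 - n, -1, 1, 0]) :=
  isLine_join (linearIndependent_of_minor 2 3 (by simp))

theorem isLine_imaginaryAxis (h3 : (3 : F) ≠ 0) :
    IsLine (join ![3 * n, n - 1, 0, 3] ![3 * n, -1, 1, 0]) :=
  isLine_join (linearIndependent_of_minor 2 3 (by simpa using h3))

theorem join_imaginaryChord : join ![n, -n, 0, 1] ![1 - n, -1, 1, 0] =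
    plane ![1, 0, n - 1, -n] ⊓ plane ![0, 1, 1, n] :=
  join_eq_plane_inf (linearIndependent_of_minor 2 3 (by simp))
    (linearIndependent_of_minor 0 1 (by simp)) (by simp)

theorem join_imaginaryAxis (h3 : (3 : F) ≠ 0) :
    join ![3 * n, n - 1, 0, 3] ![3 * n, -1, 1, 0] =
      plane ![1, 0, -(3 * n), -n] ⊓ plane ![0, 3, 3, 1 - n] :=
  join_eq_plane_inf (linearIndependent_of_minor 2 3 (by simpa using h3))
    (linearIndependent_of_minor 0 1 (by simpa using h3)) (by simp; ring_nf; simp)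

end ImaginaryRepresentatives

/-! ### Orbits and stabilizers of imaginary chords and axes. -/

section Imaginary

variable {F : Type*} [Field F] [Finite F] {L : Submodule F (Fin 4 → F)}

local notation "K" => AlgebraicClosure F
local notation "ι" => algebraMap F (AlgebraicClosure F)

theorem isImaginaryChord_iff :
    IsImaginaryChord L ↔ IsLine L ∧ ∃ ξ : K, IsQuadraticNonrational ξ ∧
      extend L = join (pt ξ 1) (pt (frob F ξ) 1) := by
  simp only [IsImaginaryChord, cubicPoint_some, frob_apply]

theorem isImaginaryAxis_iff :
    IsImaginaryAxis L ↔ IsLine L ∧ ∃ ξ : K, IsQuadraticNonrational ξ ∧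
      extend L = plane (osc ξ 1) ⊓ plane (osc (frob F ξ) 1) := by
  simp only [IsImaginaryAxis, osculatingPlane_some, frob_apply]

theorem IsQuadraticNonrational.det_ne {ξ : K} (h : IsQuadraticNonrational ξ) :
    ξ * 1 - 1 * frob F ξ ≠ 0 := by
  rw [mul_one, one_mul]
  exact sub_ne_zero.2 (isQuadraticNonrational_iff.1 h).2.symm

theorem isImaginaryChord_of_mem (hL : IsLine L) {ξ : K} (h : IsQuadraticNonrational ξ)
    (h1 : pt ξ 1 ∈ extend L) (h2 : pt (frob F ξ) 1 ∈ extend L) : IsImaginaryChord L :=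
  isImaginaryChord_iff.2 ⟨hL, ξ, h,
    (isLine_extend hL).eq_join (linearIndependent_pt h.det_ne) h1 h2⟩

theorem isImaginaryAxis_of_le (hL : IsLine L) {ξ : K} (h : IsQuadraticNonrational ξ)
    (h1 : extend L ≤ plane (osc ξ 1)) (h2 : extend L ≤ plane (osc (frob F ξ) 1)) :
    IsImaginaryAxis L :=
  isImaginaryAxis_iff.2 ⟨hL, ξ, h,
    (isLine_extend hL).eq_of_le (isLine_plane_inf (linearIndependent_osc h.det_ne)) (le_inf h1 h2)⟩

theorem IsImaginaryChord.smul (g : GL (Fin 2) F) (h : IsImaginaryChord L) :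
    IsImaginaryChord (g • L) := by
  obtain ⟨hL, ξ, hξ, e⟩ := isImaginaryChord_iff.1 h
  obtain ⟨a, b, c, d, hd, rfl⟩ := exists_mkGL g
  obtain ⟨h1, h2, h3, h4⟩ := hξ.mobius hd
  refine isImaginaryChord_of_mem (isLine_smul _ hL) h3 ?_ ?_
  · rw [← pt_mul_mem h1, mul_div_cancel₀ _ h1, mul_one, extend_smul _ _ _ _ _ hL, e, smul_join,
      collin_pt, mul_one, mul_one]
    exact left_mem_join _ _
  · rw [h4, ← pt_mul_mem h2, mul_div_cancel₀ _ h2, mul_one, extend_smul _ _ _ _ _ hL, e, smul_join,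
      collin_pt, collin_pt, mul_one, mul_one]
    exact right_mem_join _ _

theorem IsImaginaryAxis.smul (g : GL (Fin 2) F) (h : IsImaginaryAxis L) :
    IsImaginaryAxis (g • L) := by
  obtain ⟨hL, ξ, hξ, e⟩ := isImaginaryAxis_iff.1 h
  obtain ⟨a, b, c, d, hd, rfl⟩ := exists_mkGL g
  obtain ⟨h1, h2, h3, h4⟩ := hξ.mobius hd
  refine isImaginaryAxis_of_le (isLine_smul _ hL) h3 ?_ ?_
  · rw [← plane_osc_mul h1, mul_div_cancel₀ _ h1, mul_one, extend_smul _ _ _ _ _ hL, e, smul_inf,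
      smul_plane_osc, mul_one, mul_one]
    exact inf_le_left
  · rw [h4, ← plane_osc_mul h2, mul_div_cancel₀ _ h2, mul_one, extend_smul _ _ _ _ _ hL, e,
      smul_inf, smul_plane_osc, smul_plane_osc, mul_one, mul_one]
    exact inf_le_right

section Representatives

variable {n : F}

theorem extend_imaginaryChord {η : K} (hη : IsQuadraticNonrational η) (h1 : η ^ 2 + η + ι n = 0)
    (h2 : frob F η = -1 - η) : extend (join ![n, -n, 0, 1] ![1 - n, -1, 1, 0]) =
      join (pt η 1) (pt (frob F η) 1) := by
  have h3 : ∀ x : K, x ^ 2 + x + ι n = 0 →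
      pt x 1 ∈ extend (join ![n, -n, 0, 1] ![1 - n, -1, 1, 0]) := by
    intro x hx
    rw [extend_join, mem_join]
    -- The last two coordinates of the spanning vectors form a unit pattern, so the coefficients are
    -- the last two coordinates `1` and `x` of the point.
    refine ⟨1, x, ?_⟩
    ext i; fin_cases i <;> simp [emb, pt]
    · linear_combination (1 - x) * hx
    · linear_combination -hx
  refine (isLine_extend (isLine_imaginaryChord n)).eq_join (linearIndependent_pt hη.det_ne)
    (h3 _ h1) (h3 _ ?_)
  rw [h2]; linear_combination h1

theorem extend_imaginaryAxis (h3 : (3 : F) ≠ 0) {η : K} (hη : IsQuadraticNonrational η)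
    (h1 : η ^ 2 + η + ι n = 0) (h2 : frob F η = -1 - η) :
    extend (join ![3 * n, n - 1, 0, 3] ![3 * n, -1, 1, 0]) =
      plane (osc η 1) ⊓ plane (osc (frob F η) 1) := by
  have h4 : ∀ x : K, x ^ 2 + x + ι n = 0 →
      extend (join ![3 * n, n - 1, 0, 3] ![3 * n, -1, 1, 0]) ≤ plane (osc x 1) := by
    intro x hx
    rw [extend_join, join_le_iff, mem_plane_osc, mem_plane_osc]
    simp [emb, algebraMap_three]
    constructor
    · linear_combination (3 - 3 * x) * hx
    · linear_combination 3 * hx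
  refine (isLine_extend (isLine_imaginaryAxis n h3)).eq_of_le
    (isLine_plane_inf (linearIndependent_osc hη.det_ne)) (le_inf (h4 _ h1) (h4 _ ?_))
  rw [h2]; linear_combination h1

/-- A rational affine map carries `η` to any other non-rational `ξ` of the quadratic extension and,
commuting with Frobenius, carries the conjugate along. The two extended chords then agree, hence so
do the lines. -/
theorem isImaginaryChord_iff_equivJoin (hn : Irreducible (X ^ 2 + X + C n : F[X])) :
    IsImaginaryChord L ↔ EquivJoin L ![n, -n, 0, 1] ![1 - n, -1, 1, 0] := by
  obtain ⟨η, hη, h1, h2⟩ := exists_root_quadratic hn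
  have hext := extend_imaginaryChord hη h1 h2
  have hline := isLine_imaginaryChord n
  rw [equivJoin_iff]
  constructor
  · intro h
    obtain ⟨hL, ξ, hξ, e⟩ := isImaginaryChord_iff.1 h
    obtain ⟨a, b, ha, rfl⟩ := exists_affine hη hξ
    refine ⟨mkGL a b 0 1 (by simpa using ha), extend_injective ?_⟩
    rw [extend_smul _ _ _ _ _ hline, hext, e, smul_join, collin_pt, collin_pt]
    simp
  · rintro ⟨g, rfl⟩
    exact (isImaginaryChord_iff.2 ⟨hline, η, hη, hext⟩).smul g

theorem isImaginaryAxis_iff_equivJoin (h3 : (3 : F) ≠ 0)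
    (hn : Irreducible (X ^ 2 + X + C n : F[X])) :
    IsImaginaryAxis L ↔ EquivJoin L ![3 * n, n - 1, 0, 3] ![3 * n, -1, 1, 0] := by
  obtain ⟨η, hη, h1, h2⟩ := exists_root_quadratic hn
  have hext := extend_imaginaryAxis h3 hη h1 h2
  have hline := isLine_imaginaryAxis n h3
  rw [equivJoin_iff]
  constructor
  · intro h
    obtain ⟨hL, ξ, hξ, e⟩ := isImaginaryAxis_iff.1 h
    obtain ⟨a, b, ha, rfl⟩ := exists_affine hη hξ
    refine ⟨mkGL a b 0 1 (by simpa using ha), extend_injective ?_⟩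
    rw [extend_smul _ _ _ _ _ hline, hext, e, smul_inf, smul_plane_osc, smul_plane_osc]
    simp
  · rintro ⟨g, rfl⟩
    exact (isImaginaryAxis_iff.2 ⟨hline, η, hη, hext⟩).smul g

/-- The form is the norm `(s - t η) (s - t η')` with `η' = -1 - η`, and neither factor vanishes for
rational `s`, `t`, not both zero. -/
theorem quadratic_ne_zero (hn : Irreducible (X ^ 2 + X + C n : F[X])) {s t : F}
    (h : s ≠ 0 ∨ t ≠ 0) : s ^ 2 + s * t + n * t ^ 2 ≠ 0 := by
  obtain ⟨η, hη, h1, h2⟩ := exists_root_quadratic hn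
  rw [isQuadraticNonrational_iff] at hη
  intro h0
  have h0' : (ι s) ^ 2 + ι s * ι t + ι n * (ι t) ^ 2 = 0 := by
    rw [← map_pow, ← map_pow, ← map_mul, ← map_mul, ← map_add, ← map_add, h0, map_zero]
  have h3 : (ι s - ι t * η) * (ι s - ι t * (-1 - η)) = 0 := by
    linear_combination h0' - (ι t) ^ 2 * h1
  have h4 : t = 0 ∧ s = 0 := by
    rcases mul_eq_zero.1 h3 with h4 | h4
    · exact frob_ne_of_eq hη.2 t s (by linear_combination -h4)
    · have := frob_ne_of_eq hη.2 t (-s - t) (by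
        rw [map_sub, map_neg]; linear_combination h4)
      refine ⟨this.1, ?_⟩
      simpa [this.1] using this.2
  tauto

/-- The matrices stabilizing a pair of conjugate points. -/
theorem torus_of_quadratic {a b c d : F} {η : K}
    (hη : IsQuadraticNonrational η) (h1 : η ^ 2 + η + ι n = 0)
    (h : (ι a * η + ι b) ^ 2 + (ι a * η + ι b) * (ι c * η + ι d)
      + ι n * (ι c * η + ι d) ^ 2 = 0) :
    (a = d - c ∧ b = -(c * n)) ∨ (a = -d ∧ b = c * n - d) := by
  rw [isQuadraticNonrational_iff] at hη
  have h3 : (ι a * η + ι b - η * (ι c * η + ι d)) *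
      (ι a * η + ι b - (-1 - η) * (ι c * η + ι d)) = 0 := by
    linear_combination h - (ι c * η + ι d) ^ 2 * h1
  rcases mul_eq_zero.1 h3 with h4 | h4
  · left
    have := frob_ne_of_eq hη.2 (a + c - d) (-(b + c * n)) (by
      simp only [map_sub, map_neg, map_add, map_mul]
      linear_combination h4 + ι c * h1)
    exact ⟨by linear_combination this.1, by linear_combination -this.2⟩
  · right
    have := frob_ne_of_eq hη.2 (a + d) (-(b + d - c * n)) (by
      simp only [map_sub, map_neg, map_add, map_mul]
      linear_combination h4 - ι c * h1)
    exact ⟨by linear_combination this.1, by linear_combination -this.2⟩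

theorem smul_imaginaryChord_iff (hn : Irreducible (X ^ 2 + X + C n : F[X])) (a b c d : F)
    (h : a * d - b * c ≠ 0) :
    mkGL a b c d h • join ![n, -n, 0, 1] ![1 - n, -1, 1, 0] =
        join ![n, -n, 0, 1] ![1 - n, -1, 1, 0] ↔
      (a = d - c ∧ b = -(c * n)) ∨ (a = -d ∧ b = c * n - d) := by
  have hline := isLine_imaginaryChord n
  constructor
  · intro e
    obtain ⟨η, hη, h1, h2⟩ := exists_root_quadratic hn
    have hext := extend_imaginaryChord hη h1 h2
    refine torus_of_quadratic hη h1 ?_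
    have hm : pt (ι a * η + ι b) (ι c * η + ι d) ∈
        extend (join ![n, -n, 0, 1] ![1 - n, -1, 1, 0]) := by
      rw [← e, extend_smul _ _ _ _ _ hline, hext, smul_join, collin_pt, collin_pt, mul_one, mul_one]
      exact left_mem_join _ _
    rw [join_imaginaryChord, extend_plane_inf (linearIndependent_of_minor 0 1 (by simp)),
      Submodule.mem_inf, mem_plane, mem_plane, dot_four, dot_four] at hm
    -- At the point with parameters `(S : T)` the second equation of the chord is `T (S² + S T + n
    -- T²)`, and `T = c η + d` is nonzero. So the image of `η` is again a root of the quadratic.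
    have e1 := hm.2
    simp [emb, pt] at e1
    refine (mul_eq_zero.1 (?_ : (ι c * η + ι d) * _ = 0)).resolve_left (hη.mobius h).1
    linear_combination e1
  · intro h0
    nth_rw 2 [join_imaginaryChord]
    rw [smul_join_eq_iff (linearIndependent_of_minor 2 3 (by simp))
      (linearIndependent_of_minor 0 1 (by simp))]
    simp only [dot_four, collin_mkGL]
    simp
    rcases h0 with ⟨rfl, rfl⟩ | ⟨rfl, rfl⟩ <;> refine ⟨?_, ?_, ?_, ?_⟩ <;> ring

theorem smul_imaginaryAxis_iff (h3 : (3 : F) ≠ 0) (hn : Irreducible (X ^ 2 + X + C n : F[X]))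
    (a b c d : F) (h : a * d - b * c ≠ 0) :
    mkGL a b c d h • join ![3 * n, n - 1, 0, 3] ![3 * n, -1, 1, 0] =
        join ![3 * n, n - 1, 0, 3] ![3 * n, -1, 1, 0] ↔
      (a = d - c ∧ b = -(c * n)) ∨ (a = -d ∧ b = c * n - d) := by
  have hline := isLine_imaginaryAxis n h3
  constructor
  · intro e
    obtain ⟨η, hη, h1, h2⟩ := exists_root_quadratic hn
    have hext := extend_imaginaryAxis h3 hη h1 h2
    refine torus_of_quadratic hη h1 ?_
    have hm : extend (join ![3 * n, n - 1, 0, 3] ![3 * n, -1, 1, 0]) ≤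
        plane (osc (ι a * η + ι b) (ι c * η + ι d)) := by
      rw [← e, extend_smul _ _ _ _ _ hline, hext, smul_inf, smul_plane_osc, smul_plane_osc, mul_one,
        mul_one]
      exact inf_le_left
    rw [extend_join, join_le_iff, mem_plane_osc, mem_plane_osc] at hm
    have e1 := hm.2
    simp [emb, algebraMap_three] at e1
    have h3' := three_ne_zero_closure h3
    -- The osculating form at `(S : T)` takes the value `3 T (S² + S T + n T²)` at the second
    -- spanning vector, and `3 T` is nonzero.
    refine (mul_eq_zero.1 (?_ : (3 * (ι c * η + ι d)) * _ = 0)).resolve_left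
      (mul_ne_zero h3' (hη.mobius h).1)
    linear_combination e1
  · intro h0
    nth_rw 2 [join_imaginaryAxis n h3]
    rw [smul_join_eq_iff (linearIndependent_of_minor 2 3 (by simpa using h3))
      (linearIndependent_of_minor 0 1 (by simpa using h3))]
    simp only [dot_four, collin_mkGL]
    simp
    rcases h0 with ⟨rfl, rfl⟩ | ⟨rfl, rfl⟩ <;> refine ⟨?_, ?_, ?_, ?_⟩ <;> ring

end Representatives

/-! ### Relations with the other kinds -/

theorem IsImaginaryChord.not_inOsculatingPlane (h : IsImaginaryChord L) :
    ¬ InOsculatingPlane L := by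
  obtain ⟨hL, ξ, hξ, e⟩ := isImaginaryChord_iff.1 h
  rw [inOsculatingPlane_iff]
  rintro ⟨s, t, hst, hle⟩
  have h1 := extend_le_plane_iff.2 hle
  rw [e, emb_osc] at h1
  have h2 := pt_mem_plane_osc.1 (h1 (left_mem_join _ _))
  have := frob_ne_of_eq (isQuadraticNonrational_iff.1 hξ).2 t s (by linear_combination h2)
  tauto

theorem IsImaginaryAxis.isPassant (h : IsImaginaryAxis L) : IsPassant L := by
  obtain ⟨hL, ξ, hξ, e⟩ := isImaginaryAxis_iff.1 h
  refine isPassant_iff.2 ⟨hL, fun s t hst hm => ?_⟩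
  have h1 := emb_mem_extend_of_mem hm
  rw [e, emb_pt] at h1
  have h2 := pt_mem_plane_osc.1 h1.1
  have := frob_ne_of_eq (isQuadraticNonrational_iff.1 hξ).2 t s (by linear_combination -h2)
  tauto

/-- A point of the cubic lies in only one osculating plane, whereas a point of an imaginary axis
lies in two conjugate ones. -/
theorem IsImaginaryChord.not_isImaginaryAxis (h : IsImaginaryChord L) : ¬ IsImaginaryAxis L := by
  obtain ⟨hL, ξ, hξ, e⟩ := isImaginaryChord_iff.1 h
  rw [isImaginaryAxis_iff]
  rintro ⟨-, ζ, hζ, e'⟩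
  have h1 : pt ξ 1 ∈ extend L := by rw [e]; exact left_mem_join _ _
  rw [e'] at h1
  have h2 := pt_mem_plane_osc.1 h1.1
  have h3 := pt_mem_plane_osc.1 h1.2
  refine (isQuadraticNonrational_iff.1 hζ).2 ?_
  linear_combination h2 - h3

theorem IsImaginaryChord.isPassant (h : IsImaginaryChord L) : IsPassant L := by
  obtain ⟨hL, ξ, hξ, e⟩ := isImaginaryChord_iff.1 h
  refine isPassant_iff.2 ⟨hL, fun s t hst hm => ?_⟩
  have h1 := emb_mem_extend_of_mem hm
  rw [e, emb_pt, mem_join] at h1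
  obtain ⟨a, b, hab⟩ := h1
  set x := frob F ξ with hx
  have hne := (isQuadraticNonrational_iff.1 hξ).2
  have e3 : a + b = ι t ^ 3 := by simpa [pt] using congrFun hab 3
  have e2 : a * ξ + b * x = ι s * ι t ^ 2 := by simpa [pt] using congrFun hab 2
  have e1 : a * ξ ^ 2 + b * x ^ 2 = ι s ^ 2 * ι t := by simpa [pt] using congrFun hab 1
  have e0 : a * ξ ^ 3 + b * x ^ 3 = ι s ^ 3 := by simpa [pt] using congrFun hab 0
  -- The coordinates of a vector on the chord are power sums in `ξ` and `x`, so they satisfy the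
  -- linear recurrence with characteristic roots `ξ` and `x`. Three consecutive coordinates of a
  -- point of the cubic turn it into this product.
  have key : ι t * ((ι s - ι t * ξ) * (ι s - ι t * x)) = 0 := by
    linear_combination -e1 + (ξ + x) * e2 - ξ * x * e3
  by_cases ht : t = 0
  · subst ht
    have key2 : ι s * ((ι s - ι 0 * ξ) * (ι s - ι 0 * x)) = 0 := by
      rw [map_zero] at e1 e2 e3 ⊢
      linear_combination -e0 + (ξ + x) * e1 - ξ * x * e2
    have hs : s = 0 := by simpa using key2
    tauto
  · have ht' : ι t ≠ 0 := (map_ne_zero ι).2 ht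
    rcases mul_eq_zero.1 ((mul_eq_zero.1 key).resolve_left ht') with h4 | h4
    · exact ht (frob_ne_of_eq hne t s (by linear_combination -h4)).1
    · refine ht (frob_ne_of_eq (x := x) ?_ t s (by linear_combination -h4)).1
      rw [hx, (isQuadraticNonrational_iff.1 hξ).1]
      exact hne.symm

/-- Checked on the representative: containment in the plane at `(s : t)` requires `3 t (s² + s t + n
t²) = 0`, hence `t = 0`, and the plane at infinity does not contain the line. -/
theorem IsImaginaryAxis.not_inOsculatingPlane (h3 : (3 : F) ≠ 0) {n : F}
    (hn : Irreducible (X ^ 2 + X + C n : F[X])) (h : IsImaginaryAxis L) :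
    ¬ InOsculatingPlane L := by
  obtain ⟨g, rfl⟩ := equivJoin_iff.1 ((isImaginaryAxis_iff_equivJoin h3 hn).1 h)
  rw [inOsculatingPlane_smul_iff, inOsculatingPlane_iff]
  rintro ⟨s, t, hst, hle⟩
  have h1 := mem_plane_osc.1 (hle (left_mem_join _ _))
  have h2 := mem_plane_osc.1 (hle (right_mem_join _ _))
  simp at h1 h2
  have h4 : (3 * t) * (s ^ 2 + s * t + n * t ^ 2) = 0 := by linear_combination h2
  have ht : t = 0 := by simpa [h3, quadratic_ne_zero hn hst] using h4
  subst ht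
  simp [h3] at h1 hst
  tauto

/-- In characteristic `3` the osculating form at `ξ` is `X₀ - ξ³ X₃`, and `ξ³` is again moved by
Frobenius. So both outer coordinates vanish on rational vectors, and imaginary axes give no class of
their own. -/
theorem IsImaginaryAxis.eq_axisOfDevelopable (h3 : (3 : F) = 0) (h : IsImaginaryAxis L) :
    L = axisOfDevelopable F := by
  obtain ⟨hL, ξ, hξ, e⟩ := isImaginaryAxis_iff.1 h
  refine hL.eq_of_le (isRealAxis_axisOfDevelopable h3).isLine fun v hv => ?_
  have h1 := emb_mem_extend_of_mem hv
  have h3' := three_eq_zero_closure h3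
  rw [e] at h1
  have h2 := mem_plane_osc.1 h1.1
  rw [h3'] at h2
  simp [emb] at h2
  have hne : frob F (ξ ^ 3) ≠ ξ ^ 3 := by
    rw [map_pow]
    intro h4
    refine sub_ne_zero.2 (isQuadraticNonrational_iff.1 hξ).2 (pow_eq_zero_iff three_ne_zero |>.1 ?_)
    linear_combination h4 - (frob F ξ ^ 2 * ξ - frob F ξ * ξ ^ 2) * h3'
  have := frob_ne_of_eq hne (v 3) (v 0) (by linear_combination -h2)
  rw [axisOfDevelopable_eq h3, join_axis, Submodule.mem_inf, mem_plane, mem_plane, dot_four,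
    dot_four]
  simp [this]

end Imaginary

/-! ### The classes as orbits -/

section Orbits

variable {F : Type*} [Field F] {L : Submodule F (Fin 4 → F)}

theorem two_eq_zero_iff : (2 : F) = 0 ↔ ringChar F = 2 := by
  have h := ringChar.spec F 2
  rw [Nat.cast_two, Nat.dvd_prime Nat.prime_two] at h
  rw [h]
  exact or_iff_right (CharP.ringChar_ne_one)

theorem three_eq_zero_iff : (3 : F) = 0 ↔ ringChar F = 3 := by
  have h := ringChar.spec F 3
  rw [Nat.cast_ofNat, Nat.dvd_prime Nat.prime_three] at h
  rw [h]
  exact or_iff_right (CharP.ringChar_ne_one)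

theorem two_ne_zero_of_three (h3 : (3 : F) = 0) : (2 : F) ≠ 0 :=
  fun h2 => one_ne_zero (α := F) (by linear_combination h3 - h2)

theorem equivJoin_unisecant {d e r : F} (he : e ≠ 0) (hr : r ≠ 0) (h : d * r ^ 2 = e) :
    EquivJoin (join ![-e, 0, 1, 0] ![0, 0, 0, 1]) ![-d, 0, 1, 0] ![0, 0, 0, 1] := by
  refine EquivJoin.of_smul (g := mkGL 1 0 0 r (by simpa using hr)) ?_
  rw [smul_unisecant_iff _ _ _ _ _ he]
  simp [h]

theorem equivJoin_passant (h3 : (3 : F) ≠ 0) {d e r : F} (hd : d ≠ 0) (hr : r ≠ 0)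
    (h : d * r ^ 2 = e) :
    EquivJoin (join ![0, 0, 1, 0] ![0, e, 0, 1]) ![0, 0, 1, 0] ![0, d, 0, 1] := by
  refine EquivJoin.of_smul (g := mkGL 1 0 0 r (by simpa using hr)) ?_
  rw [smul_passant_iff _ _ _ _ _ h3 hd]
  simp [h]

theorem equivJoin_passant_left (h3 : (3 : F) = 0) {d e r : F} (hd : d ≠ 0) (hr : r ≠ 0)
    (h : d * r ^ 2 = e) :
    EquivJoin (join ![0, 1, 0, 0] ![e, 0, 1, 0]) ![0, 1, 0, 0] ![d, 0, 1, 0] := by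
  refine EquivJoin.of_smul (g := mkGL 1 0 0 r (by simpa using hr)) ?_
  rw [smul_passant_left_iff _ _ _ _ _ h3 hd]
  simp [h]

theorem equivJoin_passant_right (h3 : (3 : F) = 0) {d e : F} (hd : d ≠ 0) (he : e ≠ 0) :
    EquivJoin (join ![e, 1, 0, 0] ![0, 0, 1, 0]) ![d, 1, 0, 0] ![0, 0, 1, 0] := by
  refine EquivJoin.of_smul (g := mkGL d 0 0 e (by simp [hd, he])) ?_
  rw [smul_passant_right_iff _ _ _ _ _ h3 he hd]
  simp [mul_comm]

theorem lines_O1 : LineClass.O1.lines F =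
    MulAction.orbit PGL(2, F) (join ![1, 0, 0, 0] ![0, 0, 0, 1]) :=
  Set.ext fun _ => isRealChord_iff_equivJoin

theorem lines_O1d : LineClass.O1d.lines F =
    MulAction.orbit PGL(2, F) (join ![0, 1, 0, 0] ![0, 0, 1, 0]) :=
  Set.ext fun _ => isRealAxis_iff_equivJoin

theorem lines_O2 : LineClass.O2.lines F =
    MulAction.orbit PGL(2, F) (join ![0, 0, 1, 0] ![0, 0, 0, 1]) :=
  Set.ext fun _ => isTangent_iff_equivJoin

theorem lines_O3 [Finite F] {n : F} (hn : Irreducible (X ^ 2 + X + C n : F[X])) :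
    LineClass.O3.lines F = MulAction.orbit PGL(2, F) (join ![n, -n, 0, 1] ![1 - n, -1, 1, 0]) :=
  Set.ext fun _ => isImaginaryChord_iff_equivJoin hn

theorem lines_O3d [Finite F] (h3 : (3 : F) ≠ 0) {n : F}
    (hn : Irreducible (X ^ 2 + X + C n : F[X])) : LineClass.O3d.lines F =
    MulAction.orbit PGL(2, F) (join ![3 * n, n - 1, 0, 3] ![3 * n, -1, 1, 0]) :=
  Set.ext fun _ => isImaginaryAxis_iff_equivJoin h3 hn

theorem equivJoin_unisecant_osc (h2 : (2 : F) ≠ 0) (w : F) :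
    EquivJoin (join ![0, 1, w, 0] ![0, 0, 0, 1]) ![0, 1, 0, 0] ![0, 0, 0, 1] := by
  refine EquivJoin.of_smul (g := mkGL 1 0 (-w / 2) 1 (by simp)) ?_
  rw [smul_unisecant_osc_iff]
  field_simp
  simp

theorem lines_O4 (h2 : (2 : F) ≠ 0) : LineClass.O4.lines F =
    MulAction.orbit PGL(2, F) (join ![0, 1, 0, 0] ![0, 0, 0, 1]) := by
  ext L
  refine mem_unisecantsInOsc_iff.trans ⟨?_, fun h => ⟨0, h⟩⟩
  rintro ⟨w, hw⟩
  exact hw.trans (equivJoin_unisecant_osc h2 w)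

theorem lines_O4minus : LineClass.O4minus_char2.lines F =
    MulAction.orbit PGL(2, F) (join ![0, 1, 0, 0] ![0, 0, 0, 1]) := rfl

theorem lines_O4plus : LineClass.O4plus_char2.lines F =
    MulAction.orbit PGL(2, F) (join ![0, 1, 1, 0] ![0, 0, 0, 1]) := by
  ext L
  refine ⟨?_, fun h => ⟨1, one_ne_zero, h⟩⟩
  rintro ⟨w, hw, h⟩
  refine h.trans (EquivJoin.of_smul (g := mkGL w 0 0 1 (by simpa using hw)) ?_)
  rw [smul_unisecant_osc_iff]
  simp

theorem lines_O5minus [Finite F] {d : F} (hd : ¬ IsSquare d) : LineClass.O5minus.lines F =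
    MulAction.orbit PGL(2, F) (join ![-d, 0, 1, 0] ![0, 0, 0, 1]) := by
  ext L
  refine ⟨?_, fun h => ⟨d, hd, h⟩⟩
  rintro ⟨e, he, h⟩
  obtain ⟨r, hr, h1⟩ := exists_sq_ratio_of_not_isSquare hd he
  exact h.trans (equivJoin_unisecant (by rintro rfl; simp at he) hr h1)

theorem lines_O5plus : LineClass.O5plus.lines F =
    MulAction.orbit PGL(2, F) (join ![-1, 0, 1, 0] ![0, 0, 0, 1]) := by
  ext L
  refine ⟨?_, fun h => ⟨1, one_ne_zero, IsSquare.one, h⟩⟩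
  rintro ⟨e, he0, he, h⟩
  obtain ⟨r, hr, h1⟩ := exists_sq_ratio_of_isSquare IsSquare.one he one_ne_zero he0
  exact h.trans (equivJoin_unisecant he0 hr h1)

theorem lines_O5_char2 [Finite F] (h2 : (2 : F) = 0) : LineClass.O5_char2.lines F =
    MulAction.orbit PGL(2, F) (join ![1, 0, 1, 0] ![0, 0, 0, 1]) := by
  have h1 : (-1 : F) = 1 := by linear_combination -h2
  -- In characteristic `2` there is a single nonzero square class, so the parameter can be scaled to
  -- `1`.
  have hsq : ∀ a : F, IsSquare a := FiniteField.isSquare_of_char_two (two_eq_zero_iff.1 h2)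
  ext L
  refine mem_unisecantsNotInOsc_iff.trans ⟨?_, fun h => ⟨1, one_ne_zero, by rwa [h1]⟩⟩
  rintro ⟨e, he, h⟩
  obtain ⟨r, hr, h3⟩ := exists_sq_ratio_of_isSquare IsSquare.one (hsq e) one_ne_zero he
  have := h.trans (equivJoin_unisecant he hr h3)
  rwa [h1] at this

theorem lines_O5dminus [Finite F] (h3 : (3 : F) ≠ 0) {v : F} (hv : ¬ IsSquare (3 * v)) :
    LineClass.O5dminus.lines F =
      MulAction.orbit PGL(2, F) (join ![0, 0, 1, 0] ![0, v, 0, 1]) := by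
  ext L
  refine ⟨?_, fun h => ⟨v, hv, h⟩⟩
  rintro ⟨e, he, h⟩
  obtain ⟨r, hr, h1⟩ := exists_sq_ratio_of_not_isSquare hv he
  exact h.trans (equivJoin_passant h3 (by rintro rfl; simp at hv) hr
    (mul_left_cancel₀ h3 (by linear_combination h1)))

theorem lines_O5dplus (h3 : (3 : F) ≠ 0) : LineClass.O5dplus.lines F =
    MulAction.orbit PGL(2, F) (join ![0, 0, 1, 0] ![0, 1 / 3, 0, 1]) := by
  have h30 : (1 / 3 : F) ≠ 0 := div_ne_zero one_ne_zero h3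
  ext L
  refine ⟨?_, fun h => ⟨1 / 3, h30, by rw [mul_div_cancel₀ _ h3]; exact IsSquare.one, h⟩⟩
  rintro ⟨e, he0, he, h⟩
  obtain ⟨r, hr, h1⟩ := exists_sq_ratio_of_isSquare IsSquare.one he one_ne_zero
    (mul_ne_zero h3 he0)
  exact h.trans (equivJoin_passant h3 h30 hr (by field_simp; linear_combination h1))

/-- An imaginary chord lies in no rational osculating plane, so a passant in such a plane is
automatically true. -/
theorem mem_passantsInOsc_iff [Finite F] (h3 : (3 : F) ≠ 0) : L ∈ passantsInOsc F ↔
    ∃ v : F, v ≠ 0 ∧ EquivJoin L ![0, 0, 1, 0] ![0, v, 0, 1] := by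
  rw [← isPassant_inOsc_not_isRealAxis_iff h3]
  exact ⟨fun h => ⟨h.1.1, h.2⟩,
    fun h => ⟨⟨h.1, fun hc => hc.not_inOsculatingPlane h.2.1⟩, h.2⟩⟩

theorem lines_O5d_char2 [Finite F] (h2 : (2 : F) = 0) : LineClass.O5d_char2.lines F =
    MulAction.orbit PGL(2, F) (join ![0, 0, 1, 0] ![0, 1, 0, 1]) := by
  have hsq : ∀ a : F, IsSquare a := FiniteField.isSquare_of_char_two (two_eq_zero_iff.1 h2)
  have h3 : (3 : F) ≠ 0 := fun h3 => two_ne_zero_of_three h3 h2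
  ext L
  refine (mem_passantsInOsc_iff h3).trans ⟨?_, fun h => ⟨1, one_ne_zero, h⟩⟩
  rintro ⟨e, he, h⟩
  obtain ⟨r, hr, h1⟩ := exists_sq_ratio_of_isSquare IsSquare.one (hsq e) one_ne_zero he
  exact h.trans (equivJoin_passant h3 one_ne_zero hr h1)

theorem lines_O7 (h3 : (3 : F) = 0) : LineClass.O7_char3.lines F =
    MulAction.orbit PGL(2, F) (join ![0, 1, 0, 0] ![0, 0, 1, 0]) := by
  ext L
  exact (isRealAxis_iff_eq_axisOfDevelopable h3).symm.trans isRealAxis_iff_equivJoin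

theorem lines_O81minus [Finite F] (h3 : (3 : F) = 0) {u : F} (hu : ¬ IsSquare u) :
    LineClass.O81minus_char3.lines F =
      MulAction.orbit PGL(2, F) (join ![0, 1, 0, 0] ![u, 0, 1, 0]) := by
  ext L
  refine ⟨?_, fun h => ⟨u, hu, h⟩⟩
  rintro ⟨e, he, h⟩
  obtain ⟨r, hr, h1⟩ := exists_sq_ratio_of_not_isSquare hu he
  exact h.trans (equivJoin_passant_left h3 (by rintro rfl; simp at hu) hr h1)

theorem lines_O81plus (h3 : (3 : F) = 0) : LineClass.O81plus_char3.lines F =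
    MulAction.orbit PGL(2, F) (join ![0, 1, 0, 0] ![1, 0, 1, 0]) := by
  ext L
  refine ⟨?_, fun h => ⟨1, one_ne_zero, IsSquare.one, h⟩⟩
  rintro ⟨e, he0, he, h⟩
  obtain ⟨r, hr, h1⟩ := exists_sq_ratio_of_isSquare IsSquare.one he one_ne_zero he0
  exact h.trans (equivJoin_passant_left h3 one_ne_zero hr h1)

theorem lines_O82 (h3 : (3 : F) = 0) : LineClass.O82_char3.lines F =
    MulAction.orbit PGL(2, F) (join ![1, 1, 0, 0] ![0, 0, 1, 0]) := by
  ext L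
  refine ⟨?_, fun h => ⟨1, one_ne_zero, h⟩⟩
  rintro ⟨e, he, h⟩
  exact h.trans (equivJoin_passant_right h3 one_ne_zero he)

end Orbits

/-! ### The sizes of the orbits -/

section OrbitSizes

variable {F : Type*} [Field F] [Finite F]

theorem ncard_O1 :
    ((LineClass.O1.lines F).ncard : ℚ) = (Nat.card F : ℚ) ^ 2 / 2 + Nat.card F / 2 := by
  rw [lines_O1]
  exact ncard_orbit_monomial _ smul_chord_iff

theorem ncard_O1d (h3 : (3 : F) ≠ 0) :
    ((LineClass.O1d.lines F).ncard : ℚ) = (Nat.card F : ℚ) ^ 2 / 2 + Nat.card F / 2 := by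
  rw [lines_O1d]
  exact ncard_orbit_monomial _ fun a b c d h => smul_axis_iff a b c d h h3

theorem ncard_O2 : ((LineClass.O2.lines F).ncard : ℚ) = (Nat.card F : ℚ) + 1 := by
  rw [lines_O2]
  exact ncard_orbit_triangular _ smul_tangent_iff

theorem torus_ne_zero {n : F} (hn : Irreducible (X ^ 2 + X + C n : F[X])) (c d : F)
    (h : (c, d) ≠ 0) : d ^ 2 - c * d + n * c ^ 2 ≠ 0 := by
  have := quadratic_ne_zero hn (s := -d) (t := c) (by
    by_contra! h0
    exact h (by simp [h0.2, neg_eq_zero.1 h0.1]))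
  intro h0
  exact this (by linear_combination h0)

theorem ncard_O3 {n : F} (hn : Irreducible (X ^ 2 + X + C n : F[X])) :
    ((LineClass.O3.lines F).ncard : ℚ) = (Nat.card F : ℚ) ^ 2 / 2 - Nat.card F / 2 := by
  rw [lines_O3 hn]
  exact ncard_orbit_nonsplit _ (torus_ne_zero hn) (smul_imaginaryChord_iff hn)

theorem ncard_O3d (h3 : (3 : F) ≠ 0) {n : F} (hn : Irreducible (X ^ 2 + X + C n : F[X])) :
    ((LineClass.O3d.lines F).ncard : ℚ) = (Nat.card F : ℚ) ^ 2 / 2 - Nat.card F / 2 := by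
  rw [lines_O3d h3 hn]
  exact ncard_orbit_nonsplit _ (torus_ne_zero hn) (smul_imaginaryAxis_iff h3 hn)

theorem ncard_O4 (h2 : (2 : F) ≠ 0) :
    ((LineClass.O4.lines F).ncard : ℚ) = (Nat.card F : ℚ) ^ 2 + Nat.card F := by
  rw [lines_O4 h2]
  refine ncard_orbit_diagonal _ fun a b c d h => ?_
  rw [smul_unisecant_osc_iff]
  simp [h2]

theorem ncard_O4minus (h2 : (2 : F) = 0) :
    ((LineClass.O4minus_char2.lines F).ncard : ℚ) = (Nat.card F : ℚ) + 1 := by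
  rw [lines_O4minus]
  refine ncard_orbit_triangular _ fun a b c d h => ?_
  rw [smul_unisecant_osc_iff]
  simp [h2]

theorem ncard_O4plus (h2 : (2 : F) = 0) :
    ((LineClass.O4plus_char2.lines F).ncard : ℚ) = (Nat.card F : ℚ) ^ 2 - 1 := by
  rw [lines_O4plus]
  refine ncard_orbit_unipotent _ fun a b c d h => ?_
  rw [smul_unisecant_osc_iff]
  simp [h2]

theorem ncard_orbit_unisecant (h2 : (2 : F) ≠ 0) {d : F} (hd : d ≠ 0) :
    ((MulAction.orbit PGL(2, F) (join ![-d, 0, 1, 0] ![0, 0, 0, 1])).ncard : ℚ) =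
      (Nat.card F : ℚ) ^ 3 / 2 - Nat.card F / 2 := by
  refine ncard_orbit_sign _ h2 fun a b c d h => ?_
  rw [smul_unisecant_iff _ _ _ _ _ hd, mul_right_inj' hd]

theorem ncard_O5minus (h2 : (2 : F) ≠ 0) {d : F} (hd : ¬ IsSquare d) :
    ((LineClass.O5minus.lines F).ncard : ℚ) = (Nat.card F : ℚ) ^ 3 / 2 - Nat.card F / 2 := by
  rw [lines_O5minus hd]
  exact ncard_orbit_unisecant h2 (by rintro rfl; simp at hd)

theorem ncard_O5plus (h2 : (2 : F) ≠ 0) :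
    ((LineClass.O5plus.lines F).ncard : ℚ) = (Nat.card F : ℚ) ^ 3 / 2 - Nat.card F / 2 := by
  rw [lines_O5plus]
  exact ncard_orbit_unisecant h2 one_ne_zero

omit [Finite F] in
theorem sq_eq_sq_iff_of_two (h2 : (2 : F) = 0) {a d : F} : d ^ 2 = a ^ 2 ↔ d = a := by
  refine ⟨fun h => ?_, fun h => h ▸ rfl⟩
  have : (d - a) ^ 2 = 0 := by linear_combination h - (d * a - a ^ 2) * h2
  exact sub_eq_zero.1 (pow_eq_zero_iff two_ne_zero |>.1 this)

theorem ncard_O5_char2 (h2 : (2 : F) = 0) :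
    ((LineClass.O5_char2.lines F).ncard : ℚ) = (Nat.card F : ℚ) ^ 3 - Nat.card F := by
  have h1 : (1 : F) = -1 := by linear_combination h2
  rw [lines_O5_char2 h2]
  refine ncard_orbit_scalar _ fun a b c d h => ?_
  have := smul_unisecant_iff a b c d h (w := 1) (w' := 1) one_ne_zero
  rw [← h1] at this
  rw [this, one_mul, one_mul, sq_eq_sq_iff_of_two h2]

theorem ncard_orbit_passant (h2 : (2 : F) ≠ 0) (h3 : (3 : F) ≠ 0) {v : F} (hv : v ≠ 0) :
    ((MulAction.orbit PGL(2, F) (join ![0, 0, 1, 0] ![0, v, 0, 1])).ncard : ℚ) =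
      (Nat.card F : ℚ) ^ 3 / 2 - Nat.card F / 2 := by
  refine ncard_orbit_sign _ h2 fun a b c d h => ?_
  rw [smul_passant_iff _ _ _ _ _ h3 hv, mul_right_inj' hv]

theorem ncard_O5dminus (h2 : (2 : F) ≠ 0) (h3 : (3 : F) ≠ 0) {v : F} (hv : ¬ IsSquare (3 * v)) :
    ((LineClass.O5dminus.lines F).ncard : ℚ) = (Nat.card F : ℚ) ^ 3 / 2 - Nat.card F / 2 := by
  rw [lines_O5dminus h3 hv]
  exact ncard_orbit_passant h2 h3 (by rintro rfl; simp at hv)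

theorem ncard_O5dplus (h2 : (2 : F) ≠ 0) (h3 : (3 : F) ≠ 0) :
    ((LineClass.O5dplus.lines F).ncard : ℚ) = (Nat.card F : ℚ) ^ 3 / 2 - Nat.card F / 2 := by
  rw [lines_O5dplus h3]
  exact ncard_orbit_passant h2 h3 (div_ne_zero one_ne_zero h3)

theorem ncard_O5d_char2 (h2 : (2 : F) = 0) :
    ((LineClass.O5d_char2.lines F).ncard : ℚ) = (Nat.card F : ℚ) ^ 3 - Nat.card F := by
  have h3 : (3 : F) ≠ 0 := fun h3 => two_ne_zero_of_three h3 h2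
  rw [lines_O5d_char2 h2]
  refine ncard_orbit_scalar _ fun a b c d h => ?_
  rw [smul_passant_iff _ _ _ _ _ h3 one_ne_zero, one_mul, one_mul, sq_eq_sq_iff_of_two h2]

omit [Finite F] in
theorem ncard_O7 : ((LineClass.O7_char3.lines F).ncard : ℚ) = 1 := by
  rw [LineClass.lines, Set.ncard_singleton, Nat.cast_one]

theorem ncard_orbit_passant_left (h3 : (3 : F) = 0) {u : F} (hu : u ≠ 0) :
    ((MulAction.orbit PGL(2, F) (join ![0, 1, 0, 0] ![u, 0, 1, 0])).ncard : ℚ) =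
      (Nat.card F : ℚ) ^ 2 / 2 - 1 / 2 := by
  refine ncard_orbit_affine_sign _ (two_ne_zero_of_three h3) fun a b c d h => ?_
  rw [smul_passant_left_iff _ _ _ _ _ h3 hu, mul_right_inj' hu]

theorem ncard_O81minus (h3 : (3 : F) = 0) {u : F} (hu : ¬ IsSquare u) :
    ((LineClass.O81minus_char3.lines F).ncard : ℚ) = (Nat.card F : ℚ) ^ 2 / 2 - 1 / 2 := by
  rw [lines_O81minus h3 hu]
  exact ncard_orbit_passant_left h3 (by rintro rfl; simp at hu)

theorem ncard_O81plus (h3 : (3 : F) = 0) :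
    ((LineClass.O81plus_char3.lines F).ncard : ℚ) = (Nat.card F : ℚ) ^ 2 / 2 - 1 / 2 := by
  rw [lines_O81plus h3]
  exact ncard_orbit_passant_left h3 one_ne_zero

theorem ncard_O82 (h3 : (3 : F) = 0) :
    ((LineClass.O82_char3.lines F).ncard : ℚ) = (Nat.card F : ℚ) ^ 3 - Nat.card F := by
  rw [lines_O82 h3]
  refine ncard_orbit_scalar _ fun a b c d h => ?_
  rw [smul_passant_right_iff _ _ _ _ _ h3 one_ne_zero one_ne_zero, one_mul, one_mul]

/-- The number of lines. -/
theorem ncard_isLine : ({L : Submodule F (Fin 4 → F) | IsLine L}.ncard : ℚ) =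
    ((Nat.card F : ℚ) ^ 2 + 1) * ((Nat.card F : ℚ) ^ 2 + Nat.card F + 1) := by
  classical
  have := Fintype.ofFinite F
  -- Double counting: ordered independent pairs of vectors are sorted by their span, and each line
  -- is the span of `(q² - 1)(q² - q)` of them.
  have e1 := Nat.card_congr (Equiv.sigmaFiberEquiv
    (fun s : {s : Fin 2 → Fin 4 → F // LinearIndependent F s} =>
      (⟨Submodule.span F (Set.range s.1), finrank_span_eq_card s.2⟩ :
        {L : Submodule F (Fin 4 → F) // IsLine L})))
  have e2 : ∀ L : {L : Submodule F (Fin 4 → F) // IsLine L},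
      Nat.card {s : {s : Fin 2 → Fin 4 → F // LinearIndependent F s} //
        (⟨Submodule.span F (Set.range s.1), finrank_span_eq_card s.2⟩ :
          {L : Submodule F (Fin 4 → F) // IsLine L}) = L} =
      (Nat.card F ^ 2 - 1) * (Nat.card F ^ 2 - Nat.card F) := by
    intro L
    have h1 := card_linearIndependent (K := F) (V := L.1) (k := 2) L.2.ge
    rw [show Module.finrank F L.1 = 2 from L.2, Fin.prod_univ_two, ← Nat.card_eq_fintype_card] at h1
    simp only [Fin.val_zero, Fin.val_one, pow_zero, pow_one] at h1
    rw [← h1]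
    refine Nat.card_congr ⟨fun s => ⟨fun i => ⟨s.1.1 i, ?_⟩, ?_⟩,
      fun t => ⟨⟨fun i => t.1 i, ?_⟩, ?_⟩, fun s => rfl, fun t => rfl⟩
    · exact (congrArg Subtype.val s.2 : _ = L.1).le (Submodule.subset_span ⟨i, rfl⟩)
    · exact LinearIndependent.of_comp L.1.subtype s.1.2
    · exact t.2.map' L.1.subtype L.1.ker_subtype
    · have hli : LinearIndependent F (fun i => (t.1 i : Fin 4 → F)) :=
        t.2.map' L.1.subtype L.1.ker_subtype
      refine Subtype.ext (Submodule.eq_of_le_of_finrank_eq ?_ ?_)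
      · rw [Submodule.span_le]
        rintro _ ⟨i, rfl⟩
        exact (t.1 i).2
      · exact (finrank_span_eq_card hli).trans L.2.symm
  have h2 := card_linearIndependent (K := F) (V := Fin 4 → F) (k := 2) (by simp)
  rw [Nat.card_sigma, Finset.sum_congr rfl fun L _ => e2 L, Finset.sum_const, Finset.card_univ, h2,
    Fin.prod_univ_two, ← Nat.card_eq_fintype_card, ← Nat.card_eq_fintype_card (α := F)] at e1
  simp only [Fin.val_zero, Fin.val_one, pow_zero, pow_one, Module.finrank_fintype_fun_eq_card,
    Fintype.card_fin, smul_eq_mul] at e1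
  have hq : 1 ≤ Nat.card F := Nat.card_pos
  have e3 := congrArg (Nat.cast (R := ℚ)) e1
  rw [Nat.cast_mul, Nat.cast_mul, Nat.cast_mul, Nat.cast_sub (Nat.one_le_pow _ _ hq),
    Nat.cast_sub (Nat.le_self_pow two_ne_zero _), Nat.cast_sub (Nat.one_le_pow _ _ hq),
    Nat.cast_sub (Nat.le_self_pow (by norm_num) _)] at e3
  push_cast at e3
  rw [← Nat.card_coe_set_eq]
  have h1 := one_lt_card (F := F)
  change (Nat.card {L : Submodule F (Fin 4 → F) // IsLine L} : ℚ) = _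
  set q := (Nat.card F : ℚ)
  have h5 : (q ^ 2 - 1) * (q ^ 2 - q) ≠ 0 := by
    have e : (q ^ 2 - 1) * (q ^ 2 - q) = (q - 1) ^ 2 * (q * (q + 1)) := by ring
    rw [e]
    have := sub_ne_zero.2 h1.ne'
    positivity
  exact mul_right_cancel₀ h5 (by linear_combination e3)

end OrbitSizes

/-! ### The partition of the set of lines -/

section Partition

variable {F : Type*} [Field F] {L : Submodule F (Fin 4 → F)}

theorem EquivJoin.exists_mkGL {v w v' w' : Fin 4 → F} (h : EquivJoin L v w)
    (h' : EquivJoin L v' w') :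
    ∃ a b c d : F, ∃ hdet : a * d - b * c ≠ 0, mkGL a b c d hdet • join v w = join v' w' := by
  obtain ⟨g, rfl⟩ := equivJoin_iff.1 h
  obtain ⟨k, hk⟩ := equivJoin_iff.1 h'
  obtain ⟨a, b, c, d, hdet, e⟩ := TwistedCubic.exists_mkGL (k⁻¹ * g)
  exact ⟨a, b, c, d, hdet, by rw [← e, mul_smul, inv_smul_eq_iff, hk]⟩

theorem IsTangent.isUnisecant (h : IsTangent L) : IsUnisecant L := by
  obtain ⟨g, rfl⟩ := equivJoin_iff.1 (isTangent_iff_equivJoin.1 h)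
  rw [isUnisecant_smul_iff, isUnisecant_iff]
  refine ⟨isLine_join (linearIndependent_of_minor 2 3 (by simp)), 0, 1, by simp,
    pt_zero_one (F := F) ▸ right_mem_join _ _, fun x y hxy => ?_⟩
  rw [mem_join] at hxy
  obtain ⟨r, s, h⟩ := hxy
  have := congrFun h 0
  simpa [pt] using this.symm

theorem IsTangent.inOsculatingPlane (h : IsTangent L) : InOsculatingPlane L := by
  obtain ⟨g, rfl⟩ := equivJoin_iff.1 (isTangent_iff_equivJoin.1 h)
  rw [inOsculatingPlane_smul_iff, inOsculatingPlane_iff]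
  refine ⟨0, 1, by simp, join_le_iff.2 ⟨?_, ?_⟩⟩ <;> simp [mem_plane, osc]

theorem IsPassant.not_isUnisecant (h : IsPassant L) : ¬ IsUnisecant L :=
  fun hu => hu.not_isPassant h

theorem IsPassant.not_isRealChord (h : IsPassant L) : ¬ IsRealChord L :=
  fun hu => hu.not_isPassant h

theorem IsPassant.not_isTangent (h : IsPassant L) : ¬ IsTangent L :=
  fun hu => hu.isUnisecant.not_isPassant h

theorem IsUnisecant.not_isRealChord (h : IsUnisecant L) : ¬ IsRealChord L :=
  fun hu => hu.not_isUnisecant h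

/-- With `2 = 0` the transport equation reads `w d = 0`, incompatible with an invertible matrix. -/
theorem not_mem_O4minus_of_mem_O4plus (h2 : (2 : F) = 0) (h : L ∈ LineClass.O4plus_char2.lines F) :
    L ∉ LineClass.O4minus_char2.lines F := by
  obtain ⟨w, hw, h⟩ := h
  intro h'
  obtain ⟨a, b, c, d, hdet, e⟩ := h.exists_mkGL h'
  rw [smul_unisecant_osc_iff] at e
  obtain ⟨rfl, e⟩ := e
  simp [h2, hw] at e
  simp [e] at hdet

theorem not_mem_O5minus_of_mem_O5plus (h : L ∈ LineClass.O5plus.lines F) :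
    L ∉ LineClass.O5minus.lines F := by
  obtain ⟨d, hd, hsq, h⟩ := h
  rintro ⟨d', hd', h'⟩
  obtain ⟨a, b, c, k, hdet, e⟩ := h.exists_mkGL h'
  rw [smul_unisecant_iff _ _ _ _ _ hd] at e
  obtain ⟨rfl, rfl, e⟩ := e
  exact hd' (isSquare_iff_of_sq_ratio (r := k) (by rintro rfl; simp at hdet) e hsq)

theorem not_mem_O5dminus_of_mem_O5dplus (h3 : (3 : F) ≠ 0) (h : L ∈ LineClass.O5dplus.lines F) :
    L ∉ LineClass.O5dminus.lines F := by
  obtain ⟨d, hd, hsq, h⟩ := h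
  rintro ⟨d', hd', h'⟩
  obtain ⟨a, b, c, k, hdet, e⟩ := h.exists_mkGL h'
  rw [smul_passant_iff _ _ _ _ _ h3 (by rintro rfl; simp at hd')] at e
  obtain ⟨rfl, rfl, e⟩ := e
  exact hd' (isSquare_iff_of_sq_ratio (r := k) (s := a) (by rintro rfl; simp at hdet)
    (by linear_combination 3 * e) hsq)

theorem not_mem_O81minus_of_mem_O81plus (h3 : (3 : F) = 0)
    (h : L ∈ LineClass.O81plus_char3.lines F) : L ∉ LineClass.O81minus_char3.lines F := by
  obtain ⟨d, hd, hsq, h⟩ := h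
  rintro ⟨d', hd', h'⟩
  obtain ⟨a, b, c, k, hdet, e⟩ := h.exists_mkGL h'
  rw [smul_passant_left_iff _ _ _ _ _ h3 (by rintro rfl; simp at hd')] at e
  obtain ⟨rfl, e⟩ := e
  exact hd' (isSquare_iff_of_sq_ratio (r := k) (by rintro rfl; simp at hdet) e hsq)

theorem not_mem_O81_of_mem_O82 (h3 : (3 : F) = 0) (h : L ∈ LineClass.O82_char3.lines F) :
    L ∉ LineClass.O81minus_char3.lines F ∧ L ∉ LineClass.O81plus_char3.lines F := by
  obtain ⟨w, hw, h⟩ := h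
  have key : ∀ u : F, u ≠ 0 → ¬ EquivJoin L ![0, 1, 0, 0] ![u, 0, 1, 0] := fun u hu h' => by
    obtain ⟨a, b, c, k, hdet, e⟩ := h'.exists_mkGL h
    exact smul_passant_left_ne_right h3 hu hw _ e
  exact ⟨fun ⟨u, hu, h'⟩ => key u (by rintro rfl; simp at hu) h', fun ⟨u, hu, _, h'⟩ => key u hu h'⟩

theorem unisecantsInOsc_eq_union : unisecantsInOsc F =
    LineClass.O4minus_char2.lines F ∪ LineClass.O4plus_char2.lines F := by
  ext L
  rw [mem_unisecantsInOsc_iff]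
  constructor
  · rintro ⟨w, h⟩
    by_cases hw : w = 0
    · subst hw; exact .inl h
    · exact .inr ⟨w, hw, h⟩
  · rintro (h | ⟨w, hw, h⟩)
    · exact ⟨0, h⟩
    · exact ⟨w, h⟩

theorem unisecantsNotInOsc_eq_union : unisecantsNotInOsc F =
    LineClass.O5minus.lines F ∪ LineClass.O5plus.lines F := by
  ext L
  rw [mem_unisecantsNotInOsc_iff]
  constructor
  · rintro ⟨w, hw, h⟩
    by_cases hs : IsSquare w
    · exact .inr ⟨w, hw, hs, h⟩
    · exact .inl ⟨w, hs, h⟩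
  · rintro (⟨w, hw, h⟩ | ⟨w, hw, -, h⟩)
    · exact ⟨w, by rintro rfl; simp at hw, h⟩
    · exact ⟨w, hw, h⟩

theorem passantsInOsc_eq_union [Finite F] (h3 : (3 : F) ≠ 0) : passantsInOsc F =
    LineClass.O5dminus.lines F ∪ LineClass.O5dplus.lines F := by
  ext L
  rw [mem_passantsInOsc_iff h3]
  constructor
  · rintro ⟨w, hw, h⟩
    by_cases hs : IsSquare (3 * w)
    · exact .inr ⟨w, hw, hs, h⟩
    · exact .inl ⟨w, hs, h⟩
  · rintro (⟨w, hw, h⟩ | ⟨w, hw, -, h⟩)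
    · exact ⟨w, by rintro rfl; simp at hw, h⟩
    · exact ⟨w, hw, h⟩

theorem passantsMeetingAxis_eq_union [Finite F] (h3 : (3 : F) = 0) : passantsMeetingAxis F =
    LineClass.O81minus_char3.lines F ∪ LineClass.O81plus_char3.lines F ∪
      LineClass.O82_char3.lines F := by
  ext L
  rw [mem_passantsMeetingAxis_iff h3, isPassant_inOsc_iff_of_three h3]
  constructor
  · rintro (⟨u, hu, h⟩ | h)
    · by_cases hs : IsSquare u
      · exact .inl (.inr ⟨u, hu, hs, h⟩)
      · exact .inl (.inl ⟨u, hs, h⟩)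
    · exact .inr h
  · rintro ((⟨w, hw, h⟩ | ⟨w, hw, -, h⟩) | h)
    · exact .inl ⟨w, by rintro rfl; simp at hw, h⟩
    · exact .inl ⟨w, hw, h⟩
    · exact .inr h

open scoped Classical in
/-- The class of a line. -/
noncomputable def classOf (L : Submodule F (Fin 4 → F)) : LineClass :=
  if IsRealChord L then .O1
  else if IsTangent L then .O2
  else if IsUnisecant L then
    if InOsculatingPlane L then
      if ringChar F = 2 then
        if L ∈ LineClass.O4minus_char2.lines F then .O4minus_char2 else .O4plus_char2
      else .O4
    else
      if ringChar F = 2 then .O5_char2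
      else if L ∈ LineClass.O5minus.lines F then .O5minus else .O5plus
  else if IsImaginaryChord L then .O3
  else if InOsculatingPlane L then
    if ringChar F = 3 then
      if L = axisOfDevelopable F then .O7_char3
      else if L ∈ LineClass.O81minus_char3.lines F then .O81minus_char3
      else if L ∈ LineClass.O81plus_char3.lines F then .O81plus_char3
      else .O82_char3
    else if IsRealAxis L then .O1d
    else if ringChar F = 2 then .O5d_char2
    else if L ∈ LineClass.O5dminus.lines F then .O5dminus
    else .O5dplus
  else if IsImaginaryAxis L then .O3d
  else .O6

variable [Finite F]

/-- Exhaustion: `classOf` is a decision tree on invariant properties, and each leaf occurs in the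
given characteristic and contains the line. -/
theorem mem_lines_classOf (hL : IsLine L) :
    (classOf L).Occurs (ringChar F) ∧ L ∈ (classOf L).lines F := by
  have hu2 : L ∈ unisecantsInOsc F → L ∉ LineClass.O4minus_char2.lines F →
      L ∈ LineClass.O4plus_char2.lines F := fun h h' =>
    (unisecantsInOsc_eq_union (F := F) ▸ h).resolve_left h'
  have hu5 : L ∈ unisecantsNotInOsc F → L ∉ LineClass.O5minus.lines F →
      L ∈ LineClass.O5plus.lines F := fun h h' =>
    (unisecantsNotInOsc_eq_union (F := F) ▸ h).resolve_left h'
  have hp5 : (3 : F) ≠ 0 → L ∈ passantsInOsc F → L ∉ LineClass.O5dminus.lines F →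
      L ∈ LineClass.O5dplus.lines F := fun h3 h h' =>
    (passantsInOsc_eq_union h3 ▸ h).resolve_left h'
  have hp3 : (3 : F) = 0 → IsPassant L ∧ InOsculatingPlane L ∧ L ≠ axisOfDevelopable F →
      L ∉ LineClass.O81minus_char3.lines F → L ∉ LineClass.O81plus_char3.lines F →
      L ∈ LineClass.O82_char3.lines F := fun h3 h h1 h2 => by
    rw [← mem_passantsMeetingAxis_iff h3, passantsMeetingAxis_eq_union h3] at h
    exact h.resolve_left (not_or.2 ⟨h1, h2⟩)
  rw [Ne, three_eq_zero_iff] at hp5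
  rw [three_eq_zero_iff] at hp3
  have hax : IsImaginaryAxis L → ¬ InOsculatingPlane L → ringChar F ≠ 3 := fun h ho h3 => by
    have h3 := three_eq_zero_iff.2 h3
    rw [h.eq_axisOfDevelopable h3] at ho
    exact ho (isRealAxis_axisOfDevelopable h3).inOsculatingPlane
  have ht := hL.trichotomy
  unfold classOf
  split_ifs with h1 h2 h3 h4 h5 h6 h5 h6 h4 h5 h6 h7 h8 h9 h7 h8 h9 h6
  all_goals first | exact ⟨trivial, ‹_›⟩ | skip
  all_goals try have hp := (ht.resolve_left h1).resolve_left h3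
  · exact ⟨h5, h6⟩
  · exact ⟨h5, hu2 ⟨⟨h3, h2⟩, h4⟩ h6⟩
  · exact ⟨h5, ⟨⟨h3, h2⟩, h4⟩⟩
  · exact ⟨h5, ⟨h3, h4⟩⟩
  · exact ⟨h5, h6⟩
  · exact ⟨h5, hu5 ⟨h3, h4⟩ h6⟩
  · exact ⟨h6, h7⟩
  · exact ⟨h6, h8⟩
  · exact ⟨h6, h9⟩
  · exact ⟨h6, hp3 h6 ⟨hp, h5, h7⟩ h8 h9⟩
  · exact ⟨h6, h7⟩
  · exact ⟨h8, ⟨⟨hp, h4⟩, h5, h7⟩⟩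
  · exact ⟨⟨h8, h6⟩, by assumption⟩
  · exact ⟨⟨h8, h6⟩, hp5 h6 ⟨⟨hp, h4⟩, h5, h7⟩ (by assumption)⟩
  · exact ⟨hax (by assumption) h5, by assumption⟩
  · exact ⟨trivial, ⟨⟨hp, h4⟩, h5, by assumption⟩⟩

/-- Conversely, membership in an occurring class determines every branch of the tree. As `classOf`
is a function, disjointness of all pairs of classes follows at once, with no pairwise comparison. -/
theorem classOf_eq {n : F} (hn : Irreducible (X ^ 2 + X + C n : F[X])) {c : LineClass}
    (hc : c.Occurs (ringChar F)) (h : L ∈ c.lines F) : IsLine L ∧ classOf L = c := by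
  have hosc : L ∈ unisecantsInOsc F → IsLine L ∧ IsUnisecant L ∧ ¬ IsTangent L ∧
      InOsculatingPlane L ∧ ¬ IsRealChord L := fun h =>
    ⟨h.1.1.1, h.1.1, h.1.2, h.2, h.1.1.not_isRealChord⟩
  have hnosc : L ∈ unisecantsNotInOsc F → IsLine L ∧ IsUnisecant L ∧ ¬ IsTangent L ∧
      ¬ InOsculatingPlane L ∧ ¬ IsRealChord L := fun h =>
    ⟨h.1.1, h.1, fun ht => h.2 ht.inOsculatingPlane, h.2, h.1.not_isRealChord⟩
  have hpas : IsPassant L → IsLine L ∧ ¬ IsRealChord L ∧ ¬ IsTangent L ∧ ¬ IsUnisecant L := fun h =>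
    ⟨h.1, h.not_isRealChord, h.not_isTangent, h.not_isUnisecant⟩
  have hcosc : InOsculatingPlane L → ¬ IsImaginaryChord L := fun h h' => h'.not_inOsculatingPlane h
  have hp5 : (3 : F) ≠ 0 → L ∈ passantsInOsc F → IsPassant L ∧ ¬ IsImaginaryChord L ∧
    InOsculatingPlane L ∧ ¬ IsRealAxis L := fun h3 h => ⟨h.1.1, h.1.2, h.2⟩
  have hp3 : ringChar F = 3 → L ∈ LineClass.O81minus_char3.lines F ∪
      LineClass.O81plus_char3.lines F ∪ LineClass.O82_char3.lines F →
      IsPassant L ∧ InOsculatingPlane L ∧ L ≠ axisOfDevelopable F := fun h3 h => by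
    have h3 := three_eq_zero_iff.2 h3
    rwa [← passantsMeetingAxis_eq_union h3, mem_passantsMeetingAxis_iff h3] at h
  have h32 : ringChar F = 2 → (3 : F) ≠ 0 := fun h2 h3 =>
    two_ne_zero_of_three h3 (two_eq_zero_iff.2 h2)
  cases c
  · have h : IsRealChord L := h
    exact ⟨h.isLine, by simp [classOf, h]⟩
  · have h : IsRealAxis L := h
    have hc : ringChar F ≠ 3 := hc
    obtain ⟨a1, a2, a3, a4⟩ := hpas h.isPassant
    have a5 := h.inOsculatingPlane
    exact ⟨a1, by simp [classOf, *]⟩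
  · have h : IsTangent L := h
    have := h.isUnisecant
    have a1 := this.not_isRealChord
    exact ⟨this.1, by simp [classOf, *]⟩
  · have h : IsImaginaryChord L := h
    obtain ⟨a1, a2, a3, a4⟩ := hpas h.isPassant
    exact ⟨a1, by simp [classOf, *]⟩
  · have h : IsImaginaryAxis L := h
    have hc : ringChar F ≠ 3 := hc
    obtain ⟨a1, a2, a3, a4⟩ := hpas h.isPassant
    have a5 := h.not_inOsculatingPlane (by rwa [Ne, three_eq_zero_iff]) hn
    have a6 : ¬ IsImaginaryChord L := fun h' => h'.not_isImaginaryAxis h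
    exact ⟨a1, by simp [classOf, *]⟩
  · obtain ⟨a1, a2, a3, a4, a5⟩ := hosc h
    have hc : ringChar F ≠ 2 := hc
    exact ⟨a1, by simp [classOf, *]⟩
  · have hc : ringChar F = 2 := hc
    obtain ⟨a1, a2, a3, a4, a5⟩ :=
      hosc (unisecantsInOsc_eq_union.ge (.inl h))
    exact ⟨a1, by simp [classOf, *]⟩
  · have hc : ringChar F = 2 := hc
    obtain ⟨a1, a2, a3, a4, a5⟩ :=
      hosc (unisecantsInOsc_eq_union.ge (.inr h))
    have := not_mem_O4minus_of_mem_O4plus (two_eq_zero_iff.2 hc) h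
    exact ⟨a1, by simp [classOf, *]⟩
  · have hc : ringChar F ≠ 2 := hc
    obtain ⟨a1, a2, a3, a4, a5⟩ := hnosc (unisecantsNotInOsc_eq_union.ge (.inl h))
    exact ⟨a1, by simp [classOf, *]⟩
  · have hc : ringChar F ≠ 2 := hc
    obtain ⟨a1, a2, a3, a4, a5⟩ := hnosc (unisecantsNotInOsc_eq_union.ge (.inr h))
    have := not_mem_O5minus_of_mem_O5plus h
    exact ⟨a1, by simp [classOf, *]⟩
  · have hc : ringChar F = 2 := hc
    obtain ⟨a1, a2, a3, a4, a5⟩ := hnosc h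
    exact ⟨a1, by simp [classOf, *]⟩
  · obtain ⟨hc2, hc3⟩ : ringChar F ≠ 2 ∧ ringChar F ≠ 3 := hc
    have h3 : (3 : F) ≠ 0 := by rwa [Ne, three_eq_zero_iff]
    obtain ⟨a1, a2, a3, a4⟩ := hp5 h3 ((passantsInOsc_eq_union h3).ge (.inl h))
    obtain ⟨b1, b2, b3, b4⟩ := hpas a1
    exact ⟨b1, by simp [classOf, *]⟩
  · obtain ⟨hc2, hc3⟩ : ringChar F ≠ 2 ∧ ringChar F ≠ 3 := hc
    have h3 : (3 : F) ≠ 0 := by rwa [Ne, three_eq_zero_iff]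
    obtain ⟨a1, a2, a3, a4⟩ := hp5 h3 ((passantsInOsc_eq_union h3).ge (.inr h))
    obtain ⟨b1, b2, b3, b4⟩ := hpas a1
    have := not_mem_O5dminus_of_mem_O5dplus h3 h
    exact ⟨b1, by simp [classOf, *]⟩
  · have hc : ringChar F = 2 := hc
    obtain ⟨a1, a2, a3, a4⟩ := hp5 (h32 hc) h
    obtain ⟨b1, b2, b3, b4⟩ := hpas a1
    exact ⟨b1, by simp [classOf, *]⟩
  · obtain ⟨⟨a1, a2⟩, a3, a4⟩ := h
    obtain ⟨b1, b2, b3, b4⟩ := hpas a1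
    exact ⟨b1, by simp [classOf, *]⟩
  · have hc : ringChar F = 3 := hc
    have h : L = axisOfDevelopable F := h
    have hr := isRealAxis_axisOfDevelopable (three_eq_zero_iff.2 hc)
    rw [← h] at hr
    obtain ⟨b1, b2, b3, b4⟩ := hpas hr.isPassant
    have a5 := hr.inOsculatingPlane
    have a6 := hcosc a5
    refine ⟨b1, ?_⟩
    unfold classOf
    rw [if_neg b2, if_neg b3, if_neg b4, if_neg a6, if_pos a5, if_pos hc, if_pos h]
  · have hc : ringChar F = 3 := hc
    obtain ⟨a1, a2, a3⟩ := hp3 hc (.inl (.inl h))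
    obtain ⟨b1, b2, b3, b4⟩ := hpas a1
    exact ⟨b1, by simp [classOf, *]⟩
  · have hc : ringChar F = 3 := hc
    obtain ⟨a1, a2, a3⟩ := hp3 hc (.inl (.inr h))
    obtain ⟨b1, b2, b3, b4⟩ := hpas a1
    have := not_mem_O81minus_of_mem_O81plus (three_eq_zero_iff.2 hc) h
    exact ⟨b1, by simp [classOf, *]⟩
  · have hc : ringChar F = 3 := hc
    obtain ⟨a1, a2, a3⟩ := hp3 hc (.inr h)
    obtain ⟨b1, b2, b3, b4⟩ := hpas a1
    have := not_mem_O81_of_mem_O82 (three_eq_zero_iff.2 hc) h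
    exact ⟨b1, by simp [classOf, *]⟩

theorem iUnion_lines {n : F} (hn : Irreducible (X ^ 2 + X + C n : F[X])) :
    (⋃ c ∈ {c : LineClass | c.Occurs (ringChar F)}, c.lines F) =
      {L : Submodule F (Fin 4 → F) | IsLine L} := by
  ext L
  simp only [Set.mem_iUnion]
  exact ⟨fun ⟨c, hc, h⟩ => (classOf_eq hn hc h).1,
    fun h => ⟨classOf L, (mem_lines_classOf h).1, (mem_lines_classOf h).2⟩⟩

theorem pairwiseDisjoint_lines {n : F} (hn : Irreducible (X ^ 2 + X + C n : F[X])) :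
    {c : LineClass | c.Occurs (ringChar F)}.PairwiseDisjoint (LineClass.lines F) := by
  intro c hc c' hc' hne
  refine Set.disjoint_left.2 fun L h h' => hne ?_
  rw [← (classOf_eq hn hc h).2, (classOf_eq hn hc' h').2]

/-- The set of lines is counted by the occurring classes. -/
theorem sum_ncard_lines {n : F} (hn : Irreducible (X ^ 2 + X + C n : F[X])) (s : Finset LineClass)
    (hs : ∀ c : LineClass, c ∈ s ↔ c.Occurs (ringChar F)) :
    ∑ c ∈ s, ((c.lines F).ncard : ℚ) =
      ((Nat.card F : ℚ) ^ 2 + 1) * ((Nat.card F : ℚ) ^ 2 + Nat.card F + 1) := by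
  have hs' : (s : Set LineClass) = {c | c.Occurs (ringChar F)} := Set.ext hs
  rw [← ncard_isLine, ← iUnion_lines hn, ← hs', Set.Finite.ncard_biUnion s.finite_toSet
    (fun _ _ => Set.toFinite _) (hs' ▸ pairwiseDisjoint_lines hn), finsum_mem_coe_finset,
    Nat.cast_sum]

/-- All other sizes are known, so this is a difference. The lists of occurring classes differ for `p
= 2`, `p = 3` and the rest, but the polynomial is the same. -/
theorem ncard_O6 {n u v d : F} (hn : Irreducible (X ^ 2 + X + C n : F[X]))
    (hu : ringChar F = 3 → ¬ IsSquare u)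
    (hv : ringChar F ≠ 2 → ringChar F ≠ 3 → ¬ IsSquare (3 * v))
    (hd : ringChar F ≠ 2 → ¬ IsSquare d) :
    ((LineClass.O6.lines F).ncard : ℚ) =
      (Nat.card F : ℚ) ^ 4 - (Nat.card F : ℚ) ^ 3 - (Nat.card F : ℚ) ^ 2 + Nat.card F := by
  classical
  by_cases hc2 : ringChar F = 2
  · have h2 := two_eq_zero_iff.2 hc2
    have h3 : (3 : F) ≠ 0 := fun h3 => two_ne_zero_of_three h3 h2
    have := sum_ncard_lines hn {.O1, .O1d, .O2, .O3, .O3d, .O4minus_char2, .O4plus_char2, .O5_char2,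
      .O5d_char2, .O6} (by intro c; cases c <;> simp [LineClass.Occurs, hc2])
    simp [ncard_O1, ncard_O1d h3, ncard_O2, ncard_O3 hn, ncard_O3d h3 hn, ncard_O4minus h2,
      ncard_O4plus h2, ncard_O5_char2 h2, ncard_O5d_char2 h2] at this
    linear_combination this
  · have h2 := mt two_eq_zero_iff.1 hc2
    have hd := hd hc2
    by_cases hc3 : ringChar F = 3
    · have h3 := three_eq_zero_iff.2 hc3
      have := sum_ncard_lines hn {.O1, .O2, .O3, .O4, .O5minus, .O5plus, .O6, .O7_char3,
        .O81minus_char3, .O81plus_char3, .O82_char3}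
        (by intro c; cases c <;> simp [LineClass.Occurs, hc3])
      simp [ncard_O1, ncard_O2, ncard_O3 hn, ncard_O4 h2, ncard_O5minus h2 hd,
        ncard_O5plus h2, ncard_O7, ncard_O81minus h3 (hu hc3), ncard_O81plus h3,
        ncard_O82 h3] at this
      linear_combination this
    · have h3 := mt three_eq_zero_iff.1 hc3
      have := sum_ncard_lines hn {.O1, .O1d, .O2, .O3, .O3d, .O4, .O5minus, .O5plus, .O5dminus,
        .O5dplus, .O6} (by intro c; cases c <;> simp [LineClass.Occurs, hc2, hc3])
      simp [ncard_O1, ncard_O1d h3, ncard_O2, ncard_O3 hn, ncard_O3d h3 hn, ncard_O4 h2,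
        ncard_O5minus h2 hd, ncard_O5plus h2, ncard_O5dminus h2 h3 (hv hc2 hc3),
        ncard_O5dplus h2 h3] at this
      linear_combination this

end Partition

/-! ### Orders of rational functions -/

section Orders

variable {F : Type*} [Field F]

local notation "𝔯" => algebraMap F[X] (RatFunc F)

theorem algebraMap_ne {a : F[X]} (ha : a ≠ 0) : 𝔯 a ≠ 0 :=
  RatFunc.algebraMap_ne_zero ha

theorem finiteMultiplicity {p a : F[X]} (hp : Irreducible p) (ha : a ≠ 0) :
    FiniteMultiplicity p a :=
  FiniteMultiplicity.of_prime_left hp.prime ha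

theorem multiplicity_mul' {p a b : F[X]} (hp : Irreducible p) (ha : a ≠ 0) (hb : b ≠ 0) :
    multiplicity p (a * b) = multiplicity p a + multiplicity p b :=
  multiplicity_mul hp.prime (finiteMultiplicity hp (mul_ne_zero ha hb))

/-- The order is defined from the reduced fraction. Multiplicities in `num * b = a * denom` make it
computable from any fraction. -/
theorem ord_div_finite {p : F[X]} (hm : p.Monic) (hp : Irreducible p) {a b : F[X]} (ha : a ≠ 0)
    (hb : b ≠ 0) : (Place.finite p hm hp).ord (𝔯 a / 𝔯 b) =
      (multiplicity p a : ℤ) - multiplicity p b := by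
  set r := 𝔯 a / 𝔯 b with hr
  have hr0 : r ≠ 0 := div_ne_zero (algebraMap_ne ha) (algebraMap_ne hb)
  have hn : r.num ≠ 0 := RatFunc.num_ne_zero hr0
  have hd : r.denom ≠ 0 := RatFunc.denom_ne_zero r
  have e : r.num * b = a * r.denom := by
    apply RatFunc.algebraMap_injective F
    have := RatFunc.num_div_denom r
    rw [hr, div_eq_div_iff (algebraMap_ne hd) (algebraMap_ne hb), ← hr] at this
    rwa [map_mul, map_mul]
  have := congrArg (multiplicity p) e
  rw [multiplicity_mul' hp hn hb, multiplicity_mul' hp ha hd] at this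
  change (multiplicity p r.num : ℤ) - multiplicity p r.denom = _
  lia

theorem ord_div_infinity {a b : F[X]} (ha : a ≠ 0) (hb : b ≠ 0) :
    Place.infinity.ord (𝔯 a / 𝔯 b) = (b.natDegree : ℤ) - a.natDegree := by
  change -RatFunc.intDegree (𝔯 a / 𝔯 b) = _
  rw [RatFunc.intDegree_div (algebraMap_ne ha) (algebraMap_ne hb), RatFunc.intDegree_polynomial,
    RatFunc.intDegree_polynomial, neg_sub]

end Orders

/-! ### The derivation of the field of rational functions -/

section Derivation

variable {F : Type*} [Field F]

local notation "𝔯" => algebraMap F[X] (RatFunc F)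

theorem exists_eq_div (r : RatFunc F) : ∃ a b : F[X], b ≠ 0 ∧ r = 𝔯 a / 𝔯 b :=
  ⟨r.num, r.denom, RatFunc.denom_ne_zero r, (RatFunc.num_div_denom r).symm⟩

/-- The quotient rule does not depend on the representing fraction: differentiate `num * b = a *
denom`. -/
theorem deriv_div (a : F[X]) {b : F[X]} (hb : b ≠ 0) :
    deriv (𝔯 a / 𝔯 b) = 𝔯 (derivative a * b - a * derivative b) / 𝔯 (b ^ 2) := by
  set r := 𝔯 a / 𝔯 b with hr
  have hd : r.denom ≠ 0 := RatFunc.denom_ne_zero r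
  have e : r.num * b = a * r.denom := by
    apply RatFunc.algebraMap_injective F
    have := RatFunc.num_div_denom r
    rw [hr, div_eq_div_iff (algebraMap_ne hd) (algebraMap_ne hb), ← hr] at this
    rwa [map_mul, map_mul]
  have e' := congrArg derivative e
  rw [derivative_mul, derivative_mul] at e'
  rw [deriv, div_eq_div_iff (algebraMap_ne (pow_ne_zero 2 hd)) (algebraMap_ne (pow_ne_zero 2 hb)),
    ← map_mul, ← map_mul]
  congr 1
  linear_combination (b * r.denom) * e' - (b * derivative r.denom + r.denom * derivative b) * e

theorem deriv_add (x y : RatFunc F) : deriv (x + y) = deriv x + deriv y := by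
  obtain ⟨a, b, hb, rfl⟩ := exists_eq_div x
  obtain ⟨c, d, hd, rfl⟩ := exists_eq_div y
  have hb' := algebraMap_ne hb
  have hd' := algebraMap_ne hd
  have e : 𝔯 a / 𝔯 b + 𝔯 c / 𝔯 d = 𝔯 (a * d + b * c) / 𝔯 (b * d) := by
    rw [div_add_div _ _ hb' hd']; simp
  rw [e, deriv_div _ (mul_ne_zero hb hd), deriv_div _ hb, deriv_div _ hd]
  simp only [derivative_mul, map_mul, map_add, map_sub, map_pow]
  field_simp
  ring

theorem deriv_mul (x y : RatFunc F) : deriv (x * y) = x * deriv y + y * deriv x := by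
  obtain ⟨a, b, hb, rfl⟩ := exists_eq_div x
  obtain ⟨c, d, hd, rfl⟩ := exists_eq_div y
  have hb' := algebraMap_ne hb
  have hd' := algebraMap_ne hd
  have e : 𝔯 a / 𝔯 b * (𝔯 c / 𝔯 d) = 𝔯 (a * c) / 𝔯 (b * d) := by
    rw [div_mul_div_comm]; simp
  rw [e, deriv_div _ (mul_ne_zero hb hd), deriv_div _ hb, deriv_div _ hd]
  simp only [derivative_mul, map_mul, map_add, map_sub, map_pow]
  field_simp
  ring

theorem deriv_algebraMap (a : F[X]) : deriv (𝔯 a) = 𝔯 (derivative a) := by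
  have := deriv_div a (b := 1) one_ne_zero
  simpa using this

/-- `deriv` as a derivation. -/
noncomputable def derivD : Derivation F (RatFunc F) (RatFunc F) where
  toFun := deriv
  map_add' := deriv_add
  map_smul' c x := by
    have h : ∀ z : RatFunc F, c • z = 𝔯 (C c) * z := fun z => by
      rw [Algebra.smul_def, IsScalarTower.algebraMap_apply F F[X] (RatFunc F)]; rfl
    rw [h, deriv_mul, deriv_algebraMap, RingHom.id_apply, h]
    simp
  map_one_eq_zero' := by
    have := deriv_algebraMap (1 : F[X])
    simpa using this
  leibniz' x y := by
    simpa [smul_eq_mul] using deriv_mul x y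

/-- The chain rule, valid for any derivation. -/
theorem deriv_aeval (q : F[X]) (x : RatFunc F) :
    deriv (aeval x q) = aeval x (derivative q) * deriv x := by
  have := (derivD (F := F)).map_aeval q x
  rwa [smul_eq_mul] at this

end Derivation

/-! ### Homogenization -/

section Homogenize

variable {F : Type*} [Field F]

local notation "𝔯" => algebraMap F[X] (RatFunc F)

/-- The value at `(f, g)` of the binary form with dehomogenization `q`. -/
noncomputable def homog (q f g : F[X]) : F[X] :=
  ∑ i ∈ Finset.range (q.natDegree + 1), C (q.coeff i) * f ^ i * g ^ (q.natDegree - i)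

/-- Clearing denominators, for an arbitrary algebra map to a field: it is used for rational
functions, for residue fields and for evaluation at a point. -/
theorem map_homog {A : Type*} [Field A] [Algebra F A] (ψ : F[X] →ₐ[F] A) (q f g : F[X])
    (hg : ψ g ≠ 0) :
    ψ (homog q f g) = aeval (ψ f / ψ g) q * ψ g ^ q.natDegree := by
  rw [homog, map_sum, aeval_eq_sum_range, Finset.sum_mul]
  refine Finset.sum_congr rfl fun i hi => ?_
  have hi : i ≤ q.natDegree := Nat.lt_succ_iff.1 (Finset.mem_range.1 hi)
  have hC : ψ (C (q.coeff i)) = algebraMap F A (q.coeff i) := ψ.commutes _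
  rw [map_mul, map_mul, map_pow, map_pow, hC, Algebra.smul_def, div_pow]
  have : ψ g ^ q.natDegree = ψ g ^ i * ψ g ^ (q.natDegree - i) := by
    rw [← pow_add, Nat.add_sub_cancel' hi]
  rw [this]
  field_simp

theorem aeval_eq_homog_div (q f : F[X]) {g : F[X]} (hg : g ≠ 0) :
    aeval (𝔯 f / 𝔯 g) q = 𝔯 (homog q f g) / 𝔯 (g ^ q.natDegree) := by
  have hg' := algebraMap_ne hg
  have := map_homog (IsScalarTower.toAlgHom F F[X] (RatFunc F)) q f g hg'
  simp only [IsScalarTower.coe_toAlgHom'] at this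
  rw [this, map_pow, mul_div_cancel_right₀ _ (pow_ne_zero _ hg')]

theorem mk_homog {p : F[X]} [Fact (Irreducible p)] (q f : F[X]) {g : F[X]} (hg : ¬ p ∣ g) :
    AdjoinRoot.mk p (homog q f g) =
      aeval (AdjoinRoot.mk p f / AdjoinRoot.mk p g) q * AdjoinRoot.mk p g ^ q.natDegree :=
  map_homog (AdjoinRoot.mkₐ p) q f g (by simpa [AdjoinRoot.mk_eq_zero] using hg)

theorem dvd_homog_iff {p : F[X]} [Fact (Irreducible p)] (q f : F[X]) {g : F[X]} (hg : ¬ p ∣ g) :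
    p ∣ homog q f g ↔ aeval (AdjoinRoot.mk p f / AdjoinRoot.mk p g) q = 0 := by
  rw [← AdjoinRoot.mk_eq_zero, mk_homog q f hg, mul_eq_zero, or_iff_left]
  exact pow_ne_zero _ (by simpa [AdjoinRoot.mk_eq_zero] using hg)

theorem natDegree_homog_le {q f g : F[X]} {m : ℕ} (hf : f.natDegree ≤ m) (hg : g.natDegree ≤ m) :
    (homog q f g).natDegree ≤ q.natDegree * m := by
  refine natDegree_sum_le_of_forall_le _ _ fun i hi => ?_
  have hi : i ≤ q.natDegree := Nat.lt_succ_iff.1 (Finset.mem_range.1 hi)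
  refine natDegree_mul_le.trans ((add_le_add (natDegree_C_mul_le _ _) le_rfl).trans ?_)
  refine (add_le_add (natDegree_pow_le_of_le i hf) (natDegree_pow_le_of_le _ hg)).trans ?_
  rw [← add_mul, Nat.add_sub_cancel' hi]

theorem homog_X_sub_C (b : F) (f g : F[X]) : homog (X - C b) f g = f - C b * g := by
  rw [homog, natDegree_X_sub_C, Finset.sum_range_succ, Finset.sum_range_one]
  simp [coeff_X, coeff_C]
  ring

end Homogenize

/-! ### Ramification of a quotient of coprime polynomials -/

section Ramification

variable {F : Type*} [Field F]

local notation "𝔯" => algebraMap F[X] (RatFunc F)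

/-- A finite field is perfect, so `p` is separable. Thus `dp / dx` is a unit at the place `p`, and
`p` may serve as local parameter. -/
theorem not_dvd_derivative [Finite F] {p : F[X]} (hp : Irreducible p) : ¬ p ∣ derivative p :=
  fun h => hp.not_isUnit ((PerfectField.separable_of_irreducible hp).isUnit_of_dvd' dvd_rfl h)

/-- Writing `A = p ^ (k + 1) * u`, the Wronskian is `p ^ k` times `(k + 1) p' u B` plus a multiple
of `p`. The leading term survives modulo `p` exactly when `k + 1` is nonzero in `F`: tame versus
wild. -/
theorem multiplicity_wronskian [Finite F] {p A B : F[X]} (hp : Irreducible p) (hA : A ≠ 0)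
    (hpA : p ∣ A) (hpB : ¬ p ∣ B) (hW : wronskian B A ≠ 0) :
    (((multiplicity p A : ℕ) : F) ≠ 0 → multiplicity p (wronskian B A) + 1 = multiplicity p A) ∧
    (((multiplicity p A : ℕ) : F) = 0 → multiplicity p A ≤ multiplicity p (wronskian B A)) := by
  obtain ⟨u, hu, hpu⟩ := (finiteMultiplicity hp hA).exists_eq_pow_mul_and_not_dvd
  obtain ⟨k, hk⟩ := Nat.exists_eq_add_of_lt (multiplicity_pos_of_dvd hpA)
  rw [zero_add] at hk
  rw [hk] at hu ⊢
  have e : wronskian B A = p ^ k * (C ((k + 1 : ℕ) : F) * (derivative p * u * B) +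
      p * (derivative u * B - derivative B * u)) := by
    rw [wronskian, hu, derivative_mul, derivative_pow_succ]
    simp only [map_add, map_natCast, Nat.cast_add, Nat.cast_one, map_one]
    ring
  have hpk : p ^ k ≠ 0 := pow_ne_zero _ hp.ne_zero
  constructor
  · intro h0
    have hT : ¬ p ∣ C ((k + 1 : ℕ) : F) * (derivative p * u * B) +
      p * (derivative u * B - derivative B * u) := by
      rw [dvd_add_left (dvd_mul_right p _), (isUnit_C.2 h0.isUnit).dvd_mul_left,
        hp.prime.dvd_mul, hp.prime.dvd_mul]
      exact not_or.2 ⟨not_or.2 ⟨not_dvd_derivative hp, hpu⟩, hpB⟩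
    rw [e, multiplicity_mul' hp hpk (fun h0 => hT (by rw [h0]; exact dvd_zero p)),
      multiplicity_pow_self_of_prime hp.prime, multiplicity_eq_zero.2 hT]
  · intro h0
    apply (finiteMultiplicity hp hW).le_multiplicity_of_pow_dvd
    rw [e, h0, C_0, zero_mul, zero_add, ← mul_assoc, ← pow_succ]
    exact dvd_mul_right _ _

/-- `f` and `g` are coprime, `g` is monic and `f / g` has nonzero derivative. -/
structure IsReduced (f g : F[X]) : Prop where
  coprime : IsCoprime f g
  monic : g.Monic
  wronskian_ne_zero : wronskian g f ≠ 0

theorem pullParam_finite_X {p : F[X]} (hm : p.Monic) (hp : Irreducible p) :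
    (Place.finite p hm hp).pullParam RatFunc.X = 𝔯 p := by
  change aeval RatFunc.X p = _
  rw [← RatFunc.algebraMap_X, aeval_algebraMap_apply, aeval_X_left_apply]

/-- Both `B²` and `dp / dx` are units at `p`, so only the Wronskian contributes. -/
theorem ord_deriv_finite [Finite F] {p A B : F[X]} (hm : p.Monic) (hp : Irreducible p) (hB : B ≠ 0)
    (hpB : ¬ p ∣ B) (hW : wronskian B A ≠ 0) :
    (Place.finite p hm hp).ord
      (deriv (𝔯 A / 𝔯 B) / deriv ((Place.finite p hm hp).pullParam RatFunc.X)) =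
      multiplicity p (wronskian B A) := by
  have hp' := not_dvd_derivative hp
  have hp0 : derivative p ≠ 0 := fun h0 => hp' (h0 ▸ dvd_zero p)
  have e : derivative A * B - A * derivative B = wronskian B A := by rw [wronskian]; ring
  rw [pullParam_finite_X, deriv_algebraMap, deriv_div A hB, e, div_div, ← map_mul,
    ord_div_finite hm hp hW (mul_ne_zero (pow_ne_zero 2 hB) hp0),
    multiplicity_eq_zero (b := B ^ 2 * derivative p) |>.2, Nat.cast_zero, sub_zero]
  rw [hp.prime.dvd_mul, not_or]
  exact ⟨fun h => hpB (hp.prime.dvd_of_dvd_pow h), hp'⟩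

namespace IsReduced

variable {f g : F[X]} (h : IsReduced f g)

include h

theorem right_ne_zero : g ≠ 0 := h.monic.ne_zero

theorem left_ne_zero : f ≠ 0 := by
  rintro rfl
  exact h.wronskian_ne_zero (by simp [wronskian])

theorem num_mul : (assocMorphism f g).num * g = f * (assocMorphism f g).denom := by
  apply RatFunc.algebraMap_injective F
  have := RatFunc.num_div_denom (assocMorphism f g)
  rw [assocMorphism, div_eq_div_iff (algebraMap_ne (RatFunc.denom_ne_zero _))
    (algebraMap_ne h.right_ne_zero)] at this
  rwa [map_mul, map_mul]

theorem denom_eq : (assocMorphism f g).denom = g := by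
  refine eq_of_monic_of_associated (RatFunc.monic_denom _) h.monic
    (associated_of_dvd_dvd ?_ ?_)
  · exact (RatFunc.isCoprime_num_denom _).symm.dvd_of_dvd_mul_left (Dvd.intro_left _ h.num_mul.symm)
  · exact h.coprime.symm.dvd_of_dvd_mul_left (Dvd.intro_left _ h.num_mul)

theorem num_eq : (assocMorphism f g).num = f := by
  have := h.num_mul
  rw [h.denom_eq] at this
  exact mul_right_cancel₀ h.right_ne_zero this

theorem deriv_eq : deriv (assocMorphism f g) = 𝔯 (wronskian g f) / 𝔯 (g ^ 2) := by
  rw [assocMorphism, deriv_div f h.right_ne_zero, wronskian]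
  congr 2
  ring

/-- The image and the ramification at a finite pole. -/
theorem image_of_dvd {p : F[X]} (hm : p.Monic) (hp : Irreducible p) (hpg : p ∣ g) :
    (Place.finite p hm hp).image (assocMorphism f g) = .infinity := by
  rw [Place.image, h.denom_eq, if_pos hpg]

theorem not_dvd_left {p : F[X]} (hp : Irreducible p) (hpg : p ∣ g) : ¬ p ∣ f := fun hpf =>
  hp.not_isUnit (h.coprime.isUnit_of_dvd' hpf hpg)

omit h in
theorem pullParam_infinity : Place.infinity.pullParam (assocMorphism f g) = 𝔯 g / 𝔯 f := by
  rw [Place.pullParam, assocMorphism, inv_div]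

theorem ramIndex_of_dvd {p : F[X]} (hm : p.Monic) (hp : Irreducible p) (hpg : p ∣ g) :
    ramIndex (assocMorphism f g) (.finite p hm hp) = multiplicity p g := by
  rw [ramIndex, h.image_of_dvd hm hp hpg, pullParam_infinity,
    ord_div_finite hm hp h.right_ne_zero h.left_ne_zero,
    multiplicity_eq_zero.2 (h.not_dvd_left hp hpg), Nat.cast_zero, sub_zero]

/-- The image is the place of the minimal polynomial of the residue; that the polynomial vanishes at
the residue is divisibility of its homogenization at `(f, g)` by `p`. -/
theorem exists_image_eq {p : F[X]} (hm : p.Monic) (hp : Irreducible p) (hpg : ¬ p ∣ g) :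
    ∃ (q : F[X]) (hqm : q.Monic) (hq : Irreducible q),
      (Place.finite p hm hp).image (assocMorphism f g) = .finite q hqm hq ∧ p ∣ homog q f g := by
  have : Fact (Irreducible p) := ⟨hp⟩
  refine ⟨_, minpoly.monic (residue_isIntegral p hp (assocMorphism f g)),
    minpoly.irreducible (residue_isIntegral p hp (assocMorphism f g)), ?_, ?_⟩
  · rw [Place.image, h.denom_eq, if_neg hpg]
  · rw [dvd_homog_iff _ _ hpg]
    have : residue p hp (assocMorphism f g) = AdjoinRoot.mk p f / AdjoinRoot.mk p g := by
      rw [residue, h.num_eq, h.denom_eq]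
    rw [← this, minpoly.aeval]

theorem image_of_dvd_homog {p q : F[X]} (hm : p.Monic) (hp : Irreducible p) (hpg : ¬ p ∣ g)
    (hqm : q.Monic) (hq : Irreducible q) (hd : p ∣ homog q f g) :
    (Place.finite p hm hp).image (assocMorphism f g) = .finite q hqm hq := by
  have : Fact (Irreducible p) := ⟨hp⟩
  have : residue p hp (assocMorphism f g) = AdjoinRoot.mk p f / AdjoinRoot.mk p g := by
    rw [residue, h.num_eq, h.denom_eq]
  rw [dvd_homog_iff _ _ hpg, ← this] at hd
  have e := minpoly.eq_of_irreducible_of_monic hq hd hqm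
  rw [Place.image, h.denom_eq, if_neg hpg]
  congr 1
  exact e.symm

/-- The local parameter pulled back to a finite place that is not a pole. -/
theorem homog_facts [Finite F] {p q : F[X]} (hp : Irreducible p) (hpg : ¬ p ∣ g)
    (hq : Irreducible q) (hd : p ∣ homog q f g) :
    homog q f g ≠ 0 ∧ wronskian (g ^ q.natDegree) (homog q f g) ≠ 0 ∧
      multiplicity p (wronskian (g ^ q.natDegree) (homog q f g)) =
        multiplicity p (wronskian g f) := by
  have : Fact (Irreducible p) := ⟨hp⟩
  have hg := h.right_ne_zero
  -- `q` is separable and vanishes at the residue of `f / g`, so its derivative does not.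
  have hM : ¬ p ∣ homog (derivative q) f g := by
    rw [dvd_homog_iff _ _ hpg] at hd ⊢
    obtain ⟨a, b, hab⟩ := PerfectField.separable_of_irreducible hq
    intro h0
    have := congrArg (aeval (AdjoinRoot.mk p f / AdjoinRoot.mk p g)) hab
    rw [map_add, map_mul, map_mul, hd, h0] at this
    simp at this
  have hM0 : homog (derivative q) f g ≠ 0 := fun h0 => hM (h0 ▸ dvd_zero p)
  -- The chain rule with denominators cleared expresses the Wronskian of the pulled back parameter
  -- through that of `f / g`; the other factors are prime to `p`.
  have e := deriv_aeval q (assocMorphism f g)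
  rw [h.deriv_eq, assocMorphism, aeval_eq_homog_div q f hg, aeval_eq_homog_div _ f hg,
    deriv_div _ (pow_ne_zero _ hg), div_mul_div_comm, ← map_mul, ← map_mul,
    div_eq_div_iff (algebraMap_ne (pow_ne_zero _ (pow_ne_zero _ hg)))
      (algebraMap_ne (mul_ne_zero (pow_ne_zero _ hg) (pow_ne_zero _ hg))), ← map_mul, ← map_mul]
    at e
  replace e := RatFunc.algebraMap_injective F e
  set N := homog q f g
  set B := g ^ q.natDegree
  set M := homog (derivative q) f g
  have hB : B ≠ 0 := pow_ne_zero _ hg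
  have e1 : wronskian B N * (g ^ (derivative q).natDegree * g ^ 2) =
      M * wronskian g f * B ^ 2 := by
    rw [← e, wronskian]; ring
  have hG : g ^ (derivative q).natDegree * g ^ 2 ≠ 0 := by positivity
  have hR : M * wronskian g f * B ^ 2 ≠ 0 :=
    mul_ne_zero (mul_ne_zero hM0 h.wronskian_ne_zero) (pow_ne_zero 2 hB)
  have hWr : wronskian B N ≠ 0 := by
    intro h0
    rw [h0, zero_mul] at e1
    exact hR e1.symm
  refine ⟨?_, hWr, ?_⟩
  · intro h0
    exact hWr (by simp [wronskian, h0])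
  · have e2 := congrArg (multiplicity p) e1
    have hg' : ∀ k, ¬ p ∣ g ^ k := fun k hk => hpg (hp.prime.dvd_of_dvd_pow hk)
    rw [multiplicity_mul' hp hWr hG, multiplicity_mul' hp (mul_ne_zero hM0 h.wronskian_ne_zero)
      (pow_ne_zero 2 hB), multiplicity_mul' hp hM0 h.wronskian_ne_zero,
      multiplicity_mul' hp (pow_ne_zero _ hg) (pow_ne_zero _ hg), multiplicity_eq_zero.2 (hg' _),
      multiplicity_eq_zero.2 (hg' _), multiplicity_eq_zero.2 hM, ← pow_mul,
      multiplicity_eq_zero.2 (hg' _)] at e2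
    simpa using e2

theorem pullParam_finite {q : F[X]} (hqm : q.Monic) (hq : Irreducible q) :
    (Place.finite q hqm hq).pullParam (assocMorphism f g) =
      𝔯 (homog q f g) / 𝔯 (g ^ q.natDegree) :=
  aeval_eq_homog_div q f h.right_ne_zero

theorem ramIndex_of_dvd_homog [Finite F] {p q : F[X]} (hm : p.Monic) (hp : Irreducible p)
    (hpg : ¬ p ∣ g) (hqm : q.Monic) (hq : Irreducible q) (hd : p ∣ homog q f g) :
    ramIndex (assocMorphism f g) (.finite p hm hp) = multiplicity p (homog q f g) := by
  rw [ramIndex, h.image_of_dvd_homog hm hp hpg hqm hq hd, h.pullParam_finite hqm hq,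
    ord_div_finite hm hp (h.homog_facts hp hpg hq hd).1 (pow_ne_zero _ h.right_ne_zero),
    multiplicity_eq_zero.2 (fun hk => hpg (hp.prime.dvd_of_dvd_pow hk)), Nat.cast_zero, sub_zero]

/-- The ramification index and the different exponent at a finite place. -/
theorem exists_ramIndex_eq [Finite F] {p : F[X]} (hm : p.Monic) (hp : Irreducible p) :
    ∃ e : ℕ, 1 ≤ e ∧ ramIndex (assocMorphism f g) (.finite p hm hp) = e ∧
      differentExponent (assocMorphism f g) (.finite p hm hp) =
        multiplicity p (wronskian g f) ∧
      ((e : F) ≠ 0 → multiplicity p (wronskian g f) + 1 = e) ∧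
      ((e : F) = 0 → e ≤ multiplicity p (wronskian g f)) := by
  by_cases hpg : p ∣ g
  · have hpf := h.not_dvd_left hp hpg
    have e : wronskian f g = -wronskian g f := by rw [wronskian_neg_eq]
    have hW : wronskian f g ≠ 0 := e ▸ neg_ne_zero.2 h.wronskian_ne_zero
    refine ⟨multiplicity p g, multiplicity_pos_of_dvd hpg, h.ramIndex_of_dvd hm hp hpg, ?_, ?_⟩
    · rw [differentExponent, h.image_of_dvd hm hp hpg, pullParam_infinity,
        ord_deriv_finite hm hp h.left_ne_zero hpf hW, e, multiplicity_neg]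
    · have := multiplicity_wronskian hp h.right_ne_zero hpg hpf hW
      rwa [e, multiplicity_neg] at this
  · obtain ⟨q, hqm, hq, hi, hd⟩ := h.exists_image_eq hm hp hpg
    obtain ⟨h1, h2, h3⟩ := h.homog_facts hp hpg hq hd
    have hB : ¬ p ∣ g ^ q.natDegree := fun hk => hpg (hp.prime.dvd_of_dvd_pow hk)
    refine ⟨multiplicity p (homog q f g), multiplicity_pos_of_dvd hd,
      h.ramIndex_of_dvd_homog hm hp hpg hqm hq hd, ?_, ?_⟩
    · rw [differentExponent, hi, h.pullParam_finite hqm hq,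
        ord_deriv_finite hm hp (pow_ne_zero _ h.right_ne_zero) hB h2, h3]
    · rw [← h3]
      exact multiplicity_wronskian hp h1 hd hB h2

theorem ramIndex_infinity_of_lt (hd : g.natDegree < f.natDegree) :
    Place.infinity.image (assocMorphism f g) = .infinity ∧
      ramIndex (assocMorphism f g) .infinity = f.natDegree - g.natDegree := by
  have hi : Place.infinity.image (assocMorphism f g) = .infinity := by
    rw [Place.image, h.denom_eq, h.num_eq, if_pos hd]
  exact ⟨hi, by rw [ramIndex, hi, pullParam_infinity,
    ord_div_infinity h.right_ne_zero h.left_ne_zero]⟩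

theorem sub_C_mul_ne_zero (b : F) : f - C b * g ≠ 0 := by
  intro h0
  refine h.wronskian_ne_zero ?_
  rw [sub_eq_zero.1 h0, wronskian]
  simp
  ring

theorem pullParam_placeAt (b : F) : (placeAt b).pullParam (assocMorphism f g) =
    𝔯 (f - C b * g) / 𝔯 g := by
  rw [placeAt, h.pullParam_finite, homog_X_sub_C, natDegree_X_sub_C, pow_one]

theorem ramIndex_infinity_of_le (hd : f.natDegree ≤ g.natDegree) :
    Place.infinity.image (assocMorphism f g) = placeAt (f.coeff g.natDegree) ∧
      ramIndex (assocMorphism f g) .infinity =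
        g.natDegree - (f - C (f.coeff g.natDegree) * g).natDegree := by
  have hi : Place.infinity.image (assocMorphism f g) = placeAt (f.coeff g.natDegree) := by
    rw [Place.image, h.denom_eq, h.num_eq, if_neg (not_lt.2 hd)]
  exact ⟨hi, by rw [ramIndex, hi, h.pullParam_placeAt,
    ord_div_infinity (h.sub_C_mul_ne_zero _) h.right_ne_zero]⟩

/-- The parameter `1 / x` has derivative `-1 / x²`, which contributes the `-2`. With the finite
places this is the Riemann-Hurwitz formula: the total degree is twice the degree of the morphism
minus `2`. -/
theorem differentExponent_infinity : differentExponent (assocMorphism f g) .infinity =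
    2 * max (f.natDegree : ℤ) g.natDegree - 2 - (wronskian g f).natDegree := by
  have hX : deriv (Place.infinity.pullParam (RatFunc.X : RatFunc F)) = 𝔯 (-1) / 𝔯 (X ^ 2) := by
    have := deriv_div (1 : F[X]) (b := X) X_ne_zero
    rw [Place.pullParam]
    simpa using this
  have key : ∀ {A B : F[X]}, B ≠ 0 → wronskian B A ≠ 0 → Place.infinity.ord (deriv (𝔯 A / 𝔯 B) /
      deriv (Place.infinity.pullParam (RatFunc.X : RatFunc F))) =
      2 * B.natDegree - 2 - (wronskian B A).natDegree := by
    intro A B hB hW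
    have e : derivative A * B - A * derivative B = wronskian B A := by rw [wronskian]; ring
    rw [hX, deriv_div A hB, e, div_div_div_eq, ← map_mul, ← map_mul,
      ord_div_infinity (mul_ne_zero hW (pow_ne_zero 2 X_ne_zero))
        (mul_ne_zero (pow_ne_zero 2 hB) (neg_ne_zero.2 one_ne_zero)),
      natDegree_mul hW (pow_ne_zero 2 X_ne_zero),
      natDegree_mul (pow_ne_zero 2 hB) (neg_ne_zero.2 one_ne_zero)]
    simp
    ring
  by_cases hd : g.natDegree < f.natDegree
  · have e : wronskian f g = -wronskian g f := by rw [wronskian_neg_eq]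
    rw [differentExponent, (h.ramIndex_infinity_of_lt hd).1, pullParam_infinity,
      key h.left_ne_zero (e ▸ neg_ne_zero.2 h.wronskian_ne_zero), e, natDegree_neg,
      max_eq_left (by exact_mod_cast hd.le)]
  · have hd := not_lt.1 hd
    have e : ∀ b : F, wronskian g (f - C b * g) = wronskian g f := fun b => by
      simp [wronskian]; ring
    rw [differentExponent, (h.ramIndex_infinity_of_le hd).1, h.pullParam_placeAt,
      key h.right_ne_zero (by rw [e]; exact h.wronskian_ne_zero), e,
      max_eq_right (by exact_mod_cast hd)]

/-- Separability of the morphism. -/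
theorem isSeparableMorphism : IsSeparableMorphism (assocMorphism f g) := by
  set φ := assocMorphism f g with hφ
  have hg := algebraMap_ne h.right_ne_zero
  let γ : F⟮φ⟯ := IntermediateField.AdjoinSimple.gen F φ
  -- `f - φ g` vanishes at `x`, and its derivative there is `W / g`. So a nonzero Wronskian makes
  -- `x` separable over `F(φ)`, and `x` generates.
  let P : F⟮φ⟯[X] := f.map (algebraMap F F⟮φ⟯) - C γ * g.map (algebraMap F F⟮φ⟯)
  have hr : ∀ a : F[X], aeval (RatFunc.X : RatFunc F) (a.map (algebraMap F F⟮φ⟯)) = 𝔯 a := by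
    intro a
    rw [aeval_map_algebraMap, ← RatFunc.algebraMap_X, aeval_algebraMap_apply, aeval_X_left_apply]
  have hγ : algebraMap F⟮φ⟯ (RatFunc F) γ = 𝔯 f / 𝔯 g := rfl
  have h1 : aeval (RatFunc.X : RatFunc F) P = 0 := by
    rw [map_sub, map_mul, hr, hr, aeval_C, hγ, div_mul_cancel₀ _ hg, sub_self]
  have h2 : aeval (RatFunc.X : RatFunc F) (derivative P) ≠ 0 := by
    rw [derivative_sub, derivative_C_mul, derivative_map, derivative_map, map_sub, map_mul, hr, hr,
      aeval_C, hγ]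
    intro h0
    field_simp at h0
    apply h.wronskian_ne_zero
    apply RatFunc.algebraMap_injective F
    rw [wronskian, map_sub, map_mul, map_mul, map_zero]
    linear_combination h0
  have hP : P ≠ 0 := by
    intro h0
    exact h2 (by rw [h0]; simp)
  have hint : IsIntegral F⟮φ⟯ (RatFunc.X : RatFunc F) :=
    (isAlgebraic_iff_isIntegral).1 ⟨P, hP, h1⟩
  have hsep : IsSeparable F⟮φ⟯ (RatFunc.X : RatFunc F) := by
    rw [IsSeparable, separable_iff_derivative_ne_zero (minpoly.irreducible hint)]
    obtain ⟨k, hk⟩ := minpoly.dvd F⟮φ⟯ _ h1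
    intro h0
    apply h2
    rw [hk, derivative_mul, h0, zero_mul, zero_add, map_mul, minpoly.aeval, zero_mul]
  have := (IntermediateField.isSeparable_adjoin_simple_iff_isSeparable F⟮φ⟯ (RatFunc F)).2 hsep
  rw [RatFunc.IntermediateField.adjoin_X] at this
  exact AlgEquiv.Algebra.isSeparable (IntermediateField.topEquiv (F := F⟮φ⟯) (E := RatFunc F))

end IsReduced

end Ramification

/-! ### Divisors of the table -/

section Divisors

variable {F : Type*} [Field F]

@[simp] theorem mult_infinity_finite (m : ℤ) {p : F[X]} (hm : p.Monic) (hp : Irreducible p) :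
    mult m .infinity (.finite p hm hp) = 0 :=
  Finsupp.single_eq_of_ne (by simp)

@[simp] theorem mult_finite_infinity (m : ℤ) {p : F[X]} (hm : p.Monic) (hp : Irreducible p) :
    mult m (.finite p hm hp) .infinity = 0 :=
  Finsupp.single_eq_of_ne (by simp)

@[simp] theorem mult_placeAt_infinity (m : ℤ) (a : F) : mult m (placeAt a) .infinity = 0 :=
  mult_finite_infinity _ _ _

@[simp] theorem mult_placeQ_infinity (m : ℤ) {n : F} (hn : Irreducible (X ^ 2 + X + C n : F[X])) :
    mult m (placeQ n hn) .infinity = 0 :=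
  mult_finite_infinity _ _ _

@[simp] theorem mult_placeSqrt_infinity (m : ℤ) {d : F} (hd : ¬ IsSquare d) :
    mult m (placeSqrt d hd) .infinity = 0 :=
  mult_finite_infinity _ _ _

@[simp] theorem mult_self (m : ℤ) (P : Place F) : mult m P P = m := Finsupp.single_eq_same

theorem mult_of_ne (m : ℤ) {P Q : Place F} (h : Q ≠ P) : mult m P Q = 0 :=
  Finsupp.single_eq_of_ne h

theorem mult_le_one (P Q : Place F) : mult 1 P Q ≤ 1 := by
  by_cases h : Q = P
  · rw [h, mult_self]
  · rw [mult_of_ne _ h]; exact zero_le_one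

theorem mult_add_le_one {P P' : Place F} (h : P ≠ P') (Q : Place F) :
    mult 1 P Q + mult 1 P' Q ≤ 1 := by
  by_cases h' : Q = P
  · rw [h', mult_self, mult_of_ne _ h, add_zero]
  · rw [mult_of_ne _ h', zero_add]; exact mult_le_one _ _

theorem placeAt_ne {a b : F} (h : a ≠ b) : placeAt a ≠ placeAt b := by
  intro h0
  rw [placeAt, placeAt, Place.finite.injEq, sub_right_inj, C_inj] at h0
  exact h h0

theorem placeSqrt_ne_placeAt {d : F} (hd : ¬ IsSquare d) (a : F) : placeSqrt d hd ≠ placeAt a := by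
  intro h0
  rw [placeAt, placeSqrt, Place.finite.injEq] at h0
  have := congrArg natDegree h0
  rw [natDegree_X_pow_sub_C, natDegree_X_sub_C] at this
  norm_num at this

theorem multiplicity_irreducible {p q : F[X]} (hm : p.Monic) (hp : Irreducible p) (hqm : q.Monic)
    (hq : Irreducible q) :
    (multiplicity p q : ℤ) = mult 1 (.finite q hqm hq) (.finite p hm hp) := by
  by_cases h : p = q
  · subst h
    rw [mult_self, multiplicity_self, Nat.cast_one]
  · rw [mult_of_ne _ (by simpa using h), multiplicity_eq_zero.2, Nat.cast_zero]
    exact fun hd => h (eq_of_monic_of_associated hm hqm (hp.associated_of_dvd hq hd))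

theorem multiplicity_irreducible_pow {p q : F[X]} (hm : p.Monic) (hp : Irreducible p)
    (hqm : q.Monic) (hq : Irreducible q) (k : ℕ) :
    (multiplicity p (q ^ k) : ℤ) = mult k (.finite q hqm hq) (.finite p hm hp) := by
  rw [(finiteMultiplicity hp hq.ne_zero).multiplicity_pow hp.prime, Nat.cast_mul,
    multiplicity_irreducible hm hp hqm hq]
  by_cases h : Place.finite p hm hp = .finite q hqm hq
  · rw [h, mult_self, mult_self, mul_one]
  · rw [mult_of_ne _ h, mult_of_ne _ h, mul_zero]

theorem multiplicity_X_sub_C_pow {p : F[X]} (hm : p.Monic) (hp : Irreducible p) (a : F) (k : ℕ) :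
    (multiplicity p ((X - C a) ^ k) : ℤ) = mult k (placeAt a) (.finite p hm hp) :=
  multiplicity_irreducible_pow hm hp _ _ k

theorem multiplicity_X_pow {p : F[X]} (hm : p.Monic) (hp : Irreducible p) (k : ℕ) :
    (multiplicity p (X ^ k : F[X]) : ℤ) = mult k (placeAt 0) (.finite p hm hp) := by
  rw [← multiplicity_X_sub_C_pow, C_0, sub_zero]

theorem multiplicity_C_mul {p : F[X]} {c : F} (hc : c ≠ 0) (a : F[X]) :
    multiplicity p (C c * a) = multiplicity p a :=
  multiplicity_eq_of_associated_right
    (associated_unit_mul_left a (C c) (isUnit_C.2 hc.isUnit))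

theorem multiplicity_C {p : F[X]} (hp : Irreducible p) {c : F} (hc : c ≠ 0) :
    multiplicity p (C c) = 0 :=
  multiplicity_of_isUnit_right hp.not_isUnit (isUnit_C.2 hc.isUnit)

/-- A Bézout relation for the coprime cofactors shows that the greatest common divisor is associated
to `h`. -/
theorem baseDivisor_mul {h f g : F[X]} (hfg : IsCoprime f g) {p : F[X]} (hm : p.Monic)
    (hp : Irreducible p) :
    baseDivisor (h * f) (h * g) (.finite p hm hp) = multiplicity p h := by
  classical
  rw [baseDivisor, Nat.cast_inj]
  refine multiplicity_eq_of_associated_right (associated_of_dvd_dvd ?_ ?_)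
  · obtain ⟨a, b, hab⟩ := hfg
    have e : h = a * (h * f) + b * (h * g) := by linear_combination -h * hab
    rw [e]
    refine dvd_add (Dvd.dvd.mul_left ?_ _) (Dvd.dvd.mul_left ?_ _)
    · rw [← e]; exact EuclideanDomain.gcd_dvd_left _ _
    · rw [← e]; exact EuclideanDomain.gcd_dvd_right _ _
  · exact EuclideanDomain.dvd_gcd (dvd_mul_right _ _) (dvd_mul_right _ _)

theorem baseDivisor_eq {h f g : F[X]} {B : Divisor F} (hfg : IsCoprime f g)
    (hB : ∀ p hm hp, (multiplicity p h : ℤ) = B (.finite p hm hp))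
    (hi : 3 - (max (h * f).natDegree (h * g).natDegree : ℤ) = B .infinity) :
    baseDivisor (h * f) (h * g) = ⇑B := by
  funext P
  cases P with
  | finite p hm hp => rw [baseDivisor_mul hfg, hB]
  | infinity => exact hi

variable [Finite F] {f g : F[X]}

/-- At a finite place of different exponent at most one the ramification is tame: wild ramification
would give `2 ≤ e ≤ d`. Only larger exponents require a separate computation of the index. -/
theorem IsReduced.hasDivisors (h : IsReduced f g) {R D : Divisor F}
    (hD : ∀ p hm hp, (multiplicity p (wronskian g f) : ℤ) = D (.finite p hm hp))
    (hR : ∀ p hm hp, R (.finite p hm hp) = D (.finite p hm hp) ∧ D (.finite p hm hp) ≤ 1 ∨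
      ramIndex (assocMorphism f g) (.finite p hm hp) = R (.finite p hm hp) + 1)
    (hDi : 2 * max (f.natDegree : ℤ) g.natDegree - 2 - (wronskian g f).natDegree = D .infinity)
    (hRi : ramIndex (assocMorphism f g) .infinity = R .infinity + 1) :
    HasDivisors R D (assocMorphism f g) := by
  refine ⟨h.isSeparableMorphism, funext fun P => ?_, funext fun P => ?_⟩
  · rw [ramificationDivisor, sub_eq_iff_eq_add]
    cases P with
    | infinity => exact hRi
    | finite p hm hp =>
      rcases hR p hm hp with ⟨h1, h2⟩ | h1
      · obtain ⟨e, he, hre, -, h3, h4⟩ := h.exists_ramIndex_eq hm hp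
        rw [← hD] at h1 h2
        rw [h1, hre]
        have h2 : multiplicity p (wronskian g f) ≤ 1 := by exact_mod_cast h2
        by_cases h0 : (e : F) = 0
        · have := h4 h0
          have h5 : e = 1 := by lia
          rw [h5, Nat.cast_one] at h0
          exact absurd h0 one_ne_zero
        · rw [← h3 h0]
          push_cast
          ring
      · exact h1
  · rw [differentDivisor]
    cases P with
    | infinity => rw [h.differentExponent_infinity, hDi]
    | finite p hm hp =>
      obtain ⟨e, -, -, h1, -⟩ := h.exists_ramIndex_eq hm hp
      rw [h1, hD]

theorem IsReduced.ramIndex_placeAt (h : IsReduced f g) {a b : F} (hg : g.eval a ≠ 0)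
    (hb : f.eval a = b * g.eval a) :
    ramIndex (assocMorphism f g) (placeAt a) = multiplicity (X - C a) (f - C b * g) := by
  rw [placeAt, h.ramIndex_of_dvd_homog _ _ (by rwa [dvd_iff_isRoot]) (monic_X_sub_C b)
    (irreducible_X_sub_C b) (by rw [homog_X_sub_C, dvd_iff_isRoot]; simp [hb]), homog_X_sub_C]

end Divisors

/-! ### The rows of the table -/

section Rows

variable {F : Type*} [Field F]

theorem corresponds_of {L : Submodule F (Fin 4 → F)} {f g : F[X]}
    (a b c d a' b' c' d' : F) (hL : L = plane ![a, b, c, d] ⊓ plane ![a', b', c', d'])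
    (hf : f = C a * X ^ 3 + C b * X ^ 2 + C c * X + C d)
    (hg : g = C a' * X ^ 3 + C b' * X ^ 2 + C c' * X + C d') : Corresponds L f g := by
  have key : ∀ (x y z w : F),
      (fun j : Fin 4 => (C x * X ^ 3 + C y * X ^ 2 + C z * X + C w).coeff (3 - (j : ℕ))) =
        ![x, y, z, w] := fun x y z w => by
    ext j
    fin_cases j <;> simp [coeff_X, coeff_C]
  subst hf hg
  exact ⟨natDegree_cubic_le, natDegree_cubic_le, by rw [hL, key, key]⟩

/-- `h` is the base part; it cancels in the morphism, and only the coprime quotient matters for the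
ramification. -/
theorem IsTableRow.of_reduced {𝒪 : Set (Submodule F (Fin 4 → F))} {size : ℚ} {v w : Fin 4 → F}
    {f g h f₁ g₁ : F[X]} {B : Divisor F} {ram : RatFunc F → Prop} {k : ℕ}
    (horb : 𝒪 = MulAction.orbit PGL(2, F) (join v w)) (hcard : (𝒪.ncard : ℚ) = size)
    (hcor : Corresponds (join v w) f g) (hf : f = h * f₁) (hg : g = h * g₁) (hh : h ≠ 0)
    (hco : IsCoprime f₁ g₁) (hk : max f.natDegree g.natDegree = k)
    (hB : ∀ p hm hp, (multiplicity p h : ℤ) = B (.finite p hm hp)) (hi : 3 - (k : ℤ) = B .infinity)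
    (hram : ram (assocMorphism f₁ g₁)) : IsTableRow 𝒪 size v w f g B ram := by
  subst hf hg
  refine ⟨horb, hcard, hcor, baseDivisor_eq hco hB ?_, ?_⟩
  · rw [← hi, ← hk, Nat.cast_max]
  · rw [assocMorphism, map_mul, map_mul, mul_div_mul_left _ _ (algebraMap_ne hh)]
    exact hram

/-- The case of a base point free row. -/
theorem IsTableRow.of_coprime {𝒪 : Set (Submodule F (Fin 4 → F))} {size : ℚ} {v w : Fin 4 → F}
    {f g : F[X]} {ram : RatFunc F → Prop}
    (horb : 𝒪 = MulAction.orbit PGL(2, F) (join v w)) (hcard : (𝒪.ncard : ℚ) = size)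
    (hcor : Corresponds (join v w) f g) (hco : IsCoprime f g)
    (hk : max f.natDegree g.natDegree = 3) (hram : ram (assocMorphism f g)) :
    IsTableRow 𝒪 size v w f g 0 ram :=
  .of_reduced horb hcard hcor (one_mul f).symm (one_mul g).symm one_ne_zero hco hk
    (fun p _ hp => by rw [multiplicity_of_one_right hp.not_isUnit]; rfl) (by simp) hram

/-- The generator `x` has its `p`-th power in `F(φ)`. -/
theorem isPurelyInseparableMorphism_X_pow (p : ℕ) [Fact p.Prime] [CharP F p] :
    IsPurelyInseparableMorphism (assocMorphism (X ^ p : F[X]) 1) := by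
  set φ : RatFunc F := assocMorphism (X ^ p : F[X]) 1 with hφ
  have hexp : ExpChar F p := ExpChar.prime Fact.out
  have : ExpChar F⟮φ⟯ p := expChar_of_injective_algebraMap (algebraMap F F⟮φ⟯).injective p
  have h1 : IsPurelyInseparable F⟮φ⟯ F⟮φ⟯⟮(RatFunc.X : RatFunc F)⟯ := by
    rw [IntermediateField.isPurelyInseparable_adjoin_simple_iff_pow_mem _ _ p]
    refine ⟨1, IntermediateField.AdjoinSimple.gen F φ, ?_⟩
    change φ = _
    rw [hφ, assocMorphism]
    simp
  rw [RatFunc.IntermediateField.adjoin_X] at h1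
  exact AlgEquiv.isPurelyInseparable (IntermediateField.topEquiv (F := F⟮φ⟯) (E := RatFunc F))

variable [Finite F]

/-- Every separable quotient in the table has numerator of larger degree than the denominator, so
`∞` goes to `∞` with index `a - b`. -/
theorem hasDivisors_of {f g W : F[X]} {R D : Divisor F} {a b k : ℕ} (hco : IsCoprime f g)
    (hg : g.Monic) (hW : wronskian g f = W) (hW0 : W ≠ 0) (ha : f.natDegree = a)
    (hb : g.natDegree = b) (hk : W.natDegree = k) (hlt : b < a)
    (hD : ∀ p hm hp, (multiplicity p W : ℤ) = D (.finite p hm hp))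
    (hR : IsReduced f g → ∀ p hm hp,
      R (.finite p hm hp) = D (.finite p hm hp) ∧ D (.finite p hm hp) ≤ 1 ∨
      ramIndex (assocMorphism f g) (.finite p hm hp) = R (.finite p hm hp) + 1)
    (hDi : 2 * (a : ℤ) - 2 - k = D .infinity) (hRi : (a : ℤ) - b = R .infinity + 1) :
    HasDivisors R D (assocMorphism f g) := by
  subst hW ha hb hk
  have h : IsReduced f g := ⟨hco, hg, hW0⟩
  refine h.hasDivisors hD (hR h) ?_ ?_
  · rw [max_eq_left (by exact_mod_cast hlt.le), hDi]
  · rw [(h.ramIndex_infinity_of_lt hlt).2, hRi]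

theorem hasDivisors_linear (a : F) : HasDivisors 0 0 (assocMorphism (X - C a) (1 : F[X])) := by
  refine hasDivisors_of (W := 1) (a := 1) (b := 0) (k := 0) isCoprime_one_right monic_one
    (by simp [wronskian]) one_ne_zero (natDegree_X_sub_C a) natDegree_one natDegree_one one_pos
    (fun p _ hp => ?_) (fun _ p hm hp => .inl ⟨rfl, zero_le_one⟩) (by simp) (by simp)
  rw [multiplicity_of_one_right hp.not_isUnit]; rfl

theorem row_O1 : IsTableRow (LineClass.O1.lines F) ((Nat.card F : ℚ) ^ 2 / 2 + Nat.card F / 2)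
    ![1, 0, 0, 0] ![0, 0, 0, 1] (X ^ 2) X (mult 1 (placeAt 0) + mult 1 .infinity)
    (HasDivisors 0 0) := by
  refine .of_reduced (h := X) (f₁ := X - C 0) (g₁ := 1) (k := 2) lines_O1 ncard_O1
    (corresponds_of 0 1 0 0 0 0 1 0 join_chord (by simp) (by simp)) (by simp [sq]) (by simp)
    X_ne_zero
    isCoprime_one_right (by simp) (fun p hm hp => ?_) (by simp) (hasDivisors_linear 0)
  have := multiplicity_X_pow hm hp 1
  simpa using this

theorem row_O1d (h3 : (3 : F) ≠ 0) : IsTableRow (LineClass.O1d.lines F)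
    ((Nat.card F : ℚ) ^ 2 / 2 + Nat.card F / 2) ![0, 1, 0, 0] ![0, 0, 1, 0] (X ^ 3) 1 0
    (HasDivisors (mult 2 (placeAt 0) + mult 2 .infinity)
      (mult 2 (placeAt 0) + mult 2 .infinity)) := by
  refine .of_coprime lines_O1d (ncard_O1d h3)
    (corresponds_of 1 0 0 0 0 0 0 1 join_axis (by simp) (by simp)) isCoprime_one_right (by simp) ?_
  refine hasDivisors_of (W := C 3 * X ^ 2) (a := 3) (b := 0) (k := 2) isCoprime_one_right monic_one
    (by simp [wronskian, map_ofNat C]; ring) (by simp [h3]) (by simp) (by simp)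
    (natDegree_C_mul_X_pow 2 3 h3)
    (by norm_num) (fun p hm hp => ?_) (fun h p hm hp => ?_) (by simp) (by simp)
  · rw [multiplicity_C_mul h3, multiplicity_X_pow hm hp]
    simp
  · by_cases hP : Place.finite p hm hp = placeAt 0
    · rw [hP, h.ramIndex_placeAt (b := 0) (by simp) (by simp)]
      have := multiplicity_X_pow (F := F) (monic_X_sub_C 0) (irreducible_X_sub_C 0) 3
      right
      simp [placeAt] at this ⊢
      simp [this]
    · left
      simp [mult_of_ne _ hP]

theorem row_O2 : IsTableRow (LineClass.O2.lines F) ((Nat.card F : ℚ) + 1)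
    ![0, 0, 1, 0] ![0, 0, 0, 1] (X ^ 3) (X ^ 2) (mult 2 (placeAt 0)) (HasDivisors 0 0) := by
  refine .of_reduced (h := X ^ 2) (f₁ := X - C 0) (g₁ := 1) (k := 3) lines_O2 ncard_O2
    (corresponds_of 1 0 0 0 0 1 0 0 join_tangent (by simp) (by simp)) (by simp [pow_succ]) (by simp)
    (by simp) isCoprime_one_right (by simp) (fun p hm hp => ?_) (by simp) (hasDivisors_linear 0)
  exact multiplicity_X_pow hm hp 2

theorem row_O3 {n : F} (hn : Irreducible (X ^ 2 + X + C n : F[X])) :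
    IsTableRow (LineClass.O3.lines F) ((Nat.card F : ℚ) ^ 2 / 2 - Nat.card F / 2)
      ![n, -n, 0, 1] ![1 - n, -1, 1, 0] (X ^ 3 + C (n - 1) * X - C n) (X ^ 2 + X + C n)
      (mult 1 (placeQ n hn)) (HasDivisors 0 0) := by
  refine .of_reduced (h := X ^ 2 + X + C n) (f₁ := X - C 1) (g₁ := 1) (k := 3) (lines_O3 hn)
    (ncard_O3 hn) (corresponds_of 1 0 (n - 1) (-n) 0 1 1 n (join_imaginaryChord n)
      (by simp [sub_eq_add_neg]) (by simp)) (by simp; ring) (by simp)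
    hn.ne_zero isCoprime_one_right ?_ (fun p hm hp => ?_) ?_ (hasDivisors_linear 1)
  · rw [max_eq_left]
    · compute_degree!
    · refine (natDegree_quadratic_le (a := 1) (b := 1) (c := n)).trans' (by simp) |>.trans ?_
      rw [show (X ^ 3 + C (n - 1) * X - C n : F[X]).natDegree = 3 by compute_degree!]
      norm_num
  · exact multiplicity_irreducible hm hp _ hn
  · simp

omit [Finite F] in
theorem join_osc : (join ![0, 1, 0, 0] ![0, 0, 0, 1] : Submodule F (Fin 4 → F)) =
    plane ![1, 0, 0, 0] ⊓ plane ![0, 0, 1, 0] :=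
  join_eq_plane_inf (linearIndependent_of_minor 1 3 (by simp))
    (linearIndependent_of_minor 0 2 (by simp)) (by simp)

theorem row_O4 (h2 : (2 : F) ≠ 0) : IsTableRow (LineClass.O4.lines F)
    ((Nat.card F : ℚ) ^ 2 + Nat.card F) ![0, 1, 0, 0] ![0, 0, 0, 1] (X ^ 3) X (mult 1 (placeAt 0))
    (HasDivisors (mult 1 (placeAt 0) + mult 1 .infinity)
      (mult 1 (placeAt 0) + mult 1 .infinity)) := by
  refine .of_reduced (h := X) (f₁ := X ^ 2) (g₁ := 1) (k := 3) (lines_O4 h2) (ncard_O4 h2)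
    (corresponds_of 1 0 0 0 0 0 1 0 join_osc (by simp) (by simp)) (by ring)
    (by simp) X_ne_zero isCoprime_one_right (by simp) (fun p hm hp => ?_) (by simp) ?_
  · simpa using multiplicity_X_pow hm hp 1
  refine hasDivisors_of (W := C 2 * X) (a := 2) (b := 0) (k := 1) isCoprime_one_right monic_one
    (by simp [wronskian, map_ofNat C]; ring) (by simp [h2]) (by simp) (by simp)
    (natDegree_C_mul_X 2 h2)
    (by norm_num) (fun p hm hp => ?_) (fun h p hm hp => ?_) (by simp) (by simp)
  · rw [multiplicity_C_mul h2]
    simpa using multiplicity_X_pow hm hp 1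
  · left
    simpa using mult_le_one _ _

theorem row_O4minus (h2 : (2 : F) = 0) : IsTableRow (LineClass.O4minus_char2.lines F)
    ((Nat.card F : ℚ) + 1) ![0, 1, 0, 0] ![0, 0, 0, 1] (X ^ 3) X (mult 1 (placeAt 0))
    IsPurelyInseparableMorphism := by
  have : CharP F 2 := ringChar.of_eq (two_eq_zero_iff.1 h2)
  have : Fact (Nat.Prime 2) := ⟨Nat.prime_two⟩
  refine .of_reduced (h := X) (f₁ := X ^ 2) (g₁ := 1) (k := 3) lines_O4minus (ncard_O4minus h2)
    (corresponds_of 1 0 0 0 0 0 1 0 join_osc (by simp) (by simp)) (by ring)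
    (by simp) X_ne_zero isCoprime_one_right (by simp) (fun p hm hp => ?_) (by simp)
    (isPurelyInseparableMorphism_X_pow 2)
  simpa using multiplicity_X_pow hm hp 1

theorem row_O4plus (h2 : (2 : F) = 0) : IsTableRow (LineClass.O4plus_char2.lines F)
    ((Nat.card F : ℚ) ^ 2 - 1) ![0, 1, 1, 0] ![0, 0, 0, 1] (X ^ 3) (X ^ 2 + X) (mult 1 (placeAt 0))
    (HasDivisors (mult 1 (placeAt 0)) (mult 2 (placeAt 0))) := by
  have hC : (2 : F[X]) = 0 := by rw [← map_ofNat C, h2, C_0]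
  have hco : IsCoprime (X ^ 2 : F[X]) (X + 1) := ⟨1, -(X - 1), by ring⟩
  refine .of_reduced (h := X) (f₁ := X ^ 2) (g₁ := X + 1) (k := 3) lines_O4plus (ncard_O4plus h2)
    (corresponds_of 1 0 0 0 0 1 1 0 ?_ (by simp) (by simp)) (by ring)
    (by ring) X_ne_zero hco ?_ (fun p hm hp => ?_) (by simp) ?_
  · refine join_eq_plane_inf (linearIndependent_of_minor 1 3 (by simp))
      (linearIndependent_of_minor 0 2 (by simp)) ?_
    simp
    linear_combination h2
  · rw [max_eq_left] <;> rw [natDegree_X_pow]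
    compute_degree!
  · simpa using multiplicity_X_pow hm hp 1
  refine hasDivisors_of (W := X ^ 2) (a := 2) (b := 1) (k := 2) hco (by monicity!)
    ?_ (by simp) (by simp) (by compute_degree!) (by simp)
    (by norm_num) (fun p hm hp => ?_) (fun h p hm hp => ?_) (by simp) (by simp)
  · simp [wronskian]
    linear_combination X * hC
  · exact multiplicity_X_pow hm hp 2
  · by_cases hP : Place.finite p hm hp = placeAt 0
    · rw [hP, h.ramIndex_placeAt (b := 0) (by simp) (by simp)]
      have := multiplicity_X_pow (F := F) (monic_X_sub_C 0) (irreducible_X_sub_C 0) 2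
      right
      simp [placeAt] at this ⊢
      simp [this]
    · left
      simp [mult_of_ne _ hP]

omit [Finite F] in
theorem isCoprime_sq_add_C {d : F} (hd : d ≠ 0) : IsCoprime (X ^ 2 + C d : F[X]) X :=
  ⟨C d⁻¹, -(C d⁻¹ * X), by
    have : (C d⁻¹ * C d : F[X]) = 1 := by rw [← C_mul, inv_mul_cancel₀ hd, C_1]
    linear_combination this⟩

omit [Finite F] in
theorem wronskian_sq_add_C (d : F) : wronskian X (X ^ 2 + C d) = X ^ 2 - C d := by
  simp [wronskian]
  ring

/-- The divisors of `(x² + d) / x`. -/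
theorem hasDivisors_unisecant {d : F} (hd : d ≠ 0) {R D : Divisor F}
    (hD : ∀ p hm hp, (multiplicity p (X ^ 2 - C d) : ℤ) = D (.finite p hm hp))
    (hR : IsReduced (X ^ 2 + C d) X → ∀ p hm hp,
      R (.finite p hm hp) = D (.finite p hm hp) ∧ D (.finite p hm hp) ≤ 1 ∨
      ramIndex (assocMorphism (X ^ 2 + C d) X) (.finite p hm hp) = R (.finite p hm hp) + 1)
    (hDi : D .infinity = 0) (hRi : R .infinity = 0) :
    HasDivisors R D (assocMorphism (X ^ 2 + C d) X) :=
  hasDivisors_of (W := X ^ 2 - C d) (a := 2) (b := 1) (k := 2) (isCoprime_sq_add_C hd) monic_X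
    (wronskian_sq_add_C d) (X_pow_sub_C_ne_zero two_pos d) (natDegree_X_pow_add_C) natDegree_X
    (natDegree_X_pow_sub_C) (by norm_num) hD hR (by simp [hDi]) (by simp [hRi])

omit [Finite F] in
theorem IsTableRow.of_unisecant {𝒪 : Set (Submodule F (Fin 4 → F))} {size : ℚ} {d : F} (hd : d ≠ 0)
    {R D : Divisor F}
    (horb : 𝒪 = MulAction.orbit PGL(2, F) (join ![-d, 0, 1, 0] ![0, 0, 0, 1]))
    (hcard : (𝒪.ncard : ℚ) = size)
    (hram : HasDivisors R D (assocMorphism (X ^ 2 + C d) X)) :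
    IsTableRow 𝒪 size ![-d, 0, 1, 0] ![0, 0, 0, 1] (X ^ 3 + C d * X) (X ^ 2) (mult 1 (placeAt 0))
      (HasDivisors R D) := by
  refine .of_reduced (h := X) (k := 3) horb hcard
    (corresponds_of 1 0 d 0 0 1 0 0 (join_unisecant d) (by simp) (by simp)) (by ring) (by ring)
    X_ne_zero (isCoprime_sq_add_C hd) ?_ (fun p hm hp => ?_) (by simp) hram
  · have : (X ^ 3 + C d * X : F[X]).natDegree = 3 := by compute_degree!
    rw [this, natDegree_X_pow]
    norm_num
  · simpa using multiplicity_X_pow hm hp 1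

omit [Finite F] in
theorem multiplicity_sq_sub_C {p : F[X]} (hm : p.Monic) (hp : Irreducible p) {d : F}
    (hd : ¬ IsSquare d) :
    (multiplicity p (X ^ 2 - C d) : ℤ) = mult 1 (placeSqrt d hd) (.finite p hm hp) :=
  multiplicity_irreducible hm hp _ _

theorem row_O5minus (h2 : (2 : F) ≠ 0) {d : F} (hd : ¬ IsSquare d) :
    IsTableRow (LineClass.O5minus.lines F) ((Nat.card F : ℚ) ^ 3 / 2 - Nat.card F / 2)
      ![-d, 0, 1, 0] ![0, 0, 0, 1] (X ^ 3 + C d * X) (X ^ 2) (mult 1 (placeAt 0))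
      (HasDivisors (mult 1 (placeSqrt d hd)) (mult 1 (placeSqrt d hd))) := by
  have hd0 : d ≠ 0 := by rintro rfl; simp at hd
  refine .of_unisecant hd0 (lines_O5minus hd) (ncard_O5minus h2 hd)
    (hasDivisors_unisecant hd0 (fun p hm hp => ?_) (fun _ p hm hp => .inl ⟨rfl, ?_⟩)
      (by simp) (by simp))
  · exact multiplicity_sq_sub_C hm hp hd
  · exact mult_le_one _ _

omit [Finite F] in
theorem one_ne_neg_one (h2 : (2 : F) ≠ 0) : (1 : F) ≠ -1 :=
  fun h => h2 (by linear_combination h)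

omit [Finite F] in
theorem multiplicity_sq_sub_one {p : F[X]} (hm : p.Monic) (hp : Irreducible p) :
    (multiplicity p (X ^ 2 - C 1 : F[X]) : ℤ) =
      mult 1 (placeAt 1) (.finite p hm hp) + mult 1 (placeAt (-1)) (.finite p hm hp) := by
  have e : (X ^ 2 - C 1 : F[X]) = (X - C 1) * (X - C (-1)) := by simp; ring
  rw [e, multiplicity_mul' hp (X_sub_C_ne_zero _) (X_sub_C_ne_zero _), Nat.cast_add,
    multiplicity_irreducible hm hp (monic_X_sub_C _) (irreducible_X_sub_C _),
    multiplicity_irreducible hm hp (monic_X_sub_C _) (irreducible_X_sub_C _)]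
  rfl

theorem row_O5plus (h2 : (2 : F) ≠ 0) :
    IsTableRow (LineClass.O5plus.lines F) ((Nat.card F : ℚ) ^ 3 / 2 - Nat.card F / 2)
      ![-1, 0, 1, 0] ![0, 0, 0, 1] (X ^ 3 + X) (X ^ 2) (mult 1 (placeAt 0))
      (HasDivisors (mult 1 (placeAt 1) + mult 1 (placeAt (-1)))
        (mult 1 (placeAt 1) + mult 1 (placeAt (-1)))) := by
  have := IsTableRow.of_unisecant one_ne_zero lines_O5plus (ncard_O5plus h2)
    (hasDivisors_unisecant one_ne_zero (R := mult 1 (placeAt 1) + mult 1 (placeAt (-1)))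
      (D := mult 1 (placeAt 1) + mult 1 (placeAt (-1)))
      (fun p hm hp => multiplicity_sq_sub_one hm hp)
      (fun _ p hm hp => .inl ⟨rfl, mult_add_le_one (placeAt_ne (one_ne_neg_one h2)) _⟩)
      (by simp) (by simp))
  simpa using this

omit [Finite F] in
theorem sq_sub_one_of_two (h2 : (2 : F) = 0) : (X ^ 2 - C 1 : F[X]) = (X - C 1) ^ 2 := by
  have hC : (2 : F[X]) = 0 := by rw [← map_ofNat C, h2, C_0]
  simp
  linear_combination (X - 1) * hC

theorem row_O5_char2 (h2 : (2 : F) = 0) :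
    IsTableRow (LineClass.O5_char2.lines F) ((Nat.card F : ℚ) ^ 3 - Nat.card F)
      ![1, 0, 1, 0] ![0, 0, 0, 1] (X ^ 3 + X) (X ^ 2) (mult 1 (placeAt 0))
      (HasDivisors (mult 1 (placeAt 1)) (mult 2 (placeAt 1))) := by
  have h1 : (-1 : F) = 1 := by linear_combination -h2
  have e : (X ^ 2 + C 1 : F[X]) = (X - C 1) ^ 2 := by
    rw [← sq_sub_one_of_two h2, sub_eq_add_neg, ← C_neg, h1]
  have := IsTableRow.of_unisecant one_ne_zero (by rw [lines_O5_char2 h2, h1]) (ncard_O5_char2 h2)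
    (hasDivisors_unisecant one_ne_zero (R := mult 1 (placeAt 1)) (D := mult 2 (placeAt 1))
      (fun p hm hp => by rw [sq_sub_one_of_two h2]; exact multiplicity_X_sub_C_pow hm hp 1 2)
      (fun h p hm hp => by
        by_cases hP : Place.finite p hm hp = placeAt 1
        · right
          -- In characteristic `2` the numerator is the square of `X - 1`, so the index comes from
          -- the fibre over `0`.
          rw [hP, h.ramIndex_placeAt (b := 0) (by simp) (by simp; linear_combination h2), C_0,
            zero_mul, sub_zero, e]
          rw [multiplicity_X_sub_C_pow (monic_X_sub_C 1) (irreducible_X_sub_C 1)]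
          change mult 2 (placeAt 1) (placeAt 1) = _
          rw [mult_self, mult_self]
          norm_num
        · left
          simp [mult_of_ne _ hP])
      (by simp) (by simp))
  simpa [h1] using this

omit [Finite F] in
theorem isCoprime_cube_sq_sub_C {v : F} (hv : v ≠ 0) : IsCoprime (X ^ 3 : F[X]) (X ^ 2 - C v) := by
  refine IsCoprime.pow_left ⟨C v⁻¹ * X, -C v⁻¹, ?_⟩
  have : (C v⁻¹ * C v : F[X]) = 1 := by rw [← C_mul, inv_mul_cancel₀ hv, C_1]
  linear_combination this

/-- The rows of the passants in an osculating plane. -/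
theorem IsTableRow.of_passant {𝒪 : Set (Submodule F (Fin 4 → F))} {size : ℚ} {v : F} (hv : v ≠ 0)
    {R D : Divisor F}
    (horb : 𝒪 = MulAction.orbit PGL(2, F) (join ![0, 0, 1, 0] ![0, v, 0, 1]))
    (hcard : (𝒪.ncard : ℚ) = size)
    (hD : ∀ p hm hp,
      (multiplicity p (X ^ 2 - C (3 * v)) : ℤ) + mult 2 (placeAt 0) (.finite p hm hp) =
      D (.finite p hm hp))
    (hR : IsReduced (X ^ 3) (X ^ 2 - C v) → ∀ p hm hp, Place.finite p hm hp ≠ placeAt 0 →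
      R (.finite p hm hp) = D (.finite p hm hp) ∧ D (.finite p hm hp) ≤ 1 ∨
      ramIndex (assocMorphism (X ^ 3) (X ^ 2 - C v)) (.finite p hm hp) = R (.finite p hm hp) + 1)
    (hR0 : R (placeAt 0) = 2) (hDi : D .infinity = 0) (hRi : R .infinity = 0) :
    IsTableRow 𝒪 size ![0, 0, 1, 0] ![0, v, 0, 1] (X ^ 3) (X ^ 2 - C v) 0 (HasDivisors R D) := by
  have hco := isCoprime_cube_sq_sub_C hv
  have hW : (X ^ 2 - C (3 * v) : F[X]) ≠ 0 := X_pow_sub_C_ne_zero two_pos _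
  refine .of_coprime horb hcard
    (corresponds_of 1 0 0 0 0 1 0 (-v) (join_passant v) (by simp) (by simp [sub_eq_add_neg])) hco
    (by rw [natDegree_X_pow, natDegree_X_pow_sub_C]; norm_num) ?_
  refine hasDivisors_of (W := (X ^ 2 - C (3 * v)) * X ^ 2) (a := 3) (b := 2) (k := 4) hco
    (monic_X_pow_sub_C v two_ne_zero) ?_ (mul_ne_zero hW (by simp)) (by simp) natDegree_X_pow_sub_C
    (by rw [natDegree_mul hW (by simp), natDegree_X_pow_sub_C, natDegree_X_pow]) (by norm_num)
    (fun p hm hp => ?_) (fun h p hm hp => ?_) (by simp [hDi]) (by simp [hRi])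
  · simp [wronskian, map_ofNat C]
    ring
  · rw [multiplicity_mul' hp hW (by simp), Nat.cast_add, multiplicity_X_pow hm hp]
    exact hD p hm hp
  · by_cases hP : Place.finite p hm hp = placeAt 0
    · rw [hP, h.ramIndex_placeAt (b := 0) (by simpa using hv) (by simp), hR0]
      have := multiplicity_X_pow (F := F) (monic_X_sub_C 0) (irreducible_X_sub_C 0) 3
      right
      simp [placeAt] at this ⊢
      simp [this]
    · exact hR h p hm hp hP

theorem row_O5dminus (h2 : (2 : F) ≠ 0) (h3 : (3 : F) ≠ 0) {v : F} (hv : ¬ IsSquare (3 * v)) :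
    IsTableRow (LineClass.O5dminus.lines F) ((Nat.card F : ℚ) ^ 3 / 2 - Nat.card F / 2)
      ![0, 0, 1, 0] ![0, v, 0, 1] (X ^ 3) (X ^ 2 - C v) 0
      (HasDivisors (mult 1 (placeSqrt (3 * v) hv) + mult 2 (placeAt 0))
        (mult 1 (placeSqrt (3 * v) hv) + mult 2 (placeAt 0))) := by
  refine .of_passant (by rintro rfl; simp at hv) (lines_O5dminus h3 hv) (ncard_O5dminus h2 h3 hv)
    (fun p hm hp => ?_) (fun _ p hm hp hP => .inl ⟨rfl, ?_⟩) ?_ (by simp) (by simp)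
  · rw [multiplicity_sq_sub_C hm hp hv]
    rfl
  · rw [Finsupp.add_apply, mult_of_ne _ hP, add_zero]
    exact mult_le_one _ _
  · rw [Finsupp.add_apply, mult_of_ne _ (placeSqrt_ne_placeAt hv 0).symm, mult_self, zero_add]

theorem row_O5dplus (h2 : (2 : F) ≠ 0) (h3 : (3 : F) ≠ 0) :
    IsTableRow (LineClass.O5dplus.lines F) ((Nat.card F : ℚ) ^ 3 / 2 - Nat.card F / 2)
      ![0, 0, 1, 0] ![0, 1 / 3, 0, 1] (X ^ 3) (X ^ 2 - C (1 / 3)) 0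
      (HasDivisors (mult 1 (placeAt 1) + mult 1 (placeAt (-1)) + mult 2 (placeAt 0))
        (mult 1 (placeAt 1) + mult 1 (placeAt (-1)) + mult 2 (placeAt 0))) := by
  refine .of_passant (div_ne_zero one_ne_zero h3) (lines_O5dplus h3) (ncard_O5dplus h2 h3)
    (fun p hm hp => ?_) (fun _ p hm hp hP => .inl ⟨rfl, ?_⟩) ?_ (by simp) (by simp)
  · rw [mul_div_cancel₀ _ h3, multiplicity_sq_sub_one hm hp]
    rfl
  · rw [Finsupp.add_apply, mult_of_ne _ hP, add_zero]
    exact mult_add_le_one (placeAt_ne (one_ne_neg_one h2)) _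
  · rw [Finsupp.add_apply, Finsupp.add_apply, mult_of_ne _ (placeAt_ne zero_ne_one),
      mult_of_ne _ (placeAt_ne (neg_ne_zero.2 one_ne_zero).symm), mult_self, zero_add, zero_add]

theorem row_O5d_char2 (h2 : (2 : F) = 0) :
    IsTableRow (LineClass.O5d_char2.lines F) ((Nat.card F : ℚ) ^ 3 - Nat.card F)
      ![0, 0, 1, 0] ![0, 1, 0, 1] (X ^ 3) (X ^ 2 + 1) 0
      (HasDivisors (mult 1 (placeAt 1) + mult 2 (placeAt 0))
        (mult 2 (placeAt 1) + mult 2 (placeAt 0))) := by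
  have h1 : (-1 : F) = 1 := by linear_combination -h2
  have e : (X ^ 2 + 1 : F[X]) = X ^ 2 - C 1 := by
    rw [sub_eq_add_neg, ← C_neg, h1, C_1]
  have e3 : (3 * 1 : F) = 1 := by linear_combination h2
  rw [e]
  refine .of_passant one_ne_zero (lines_O5d_char2 h2) (ncard_O5d_char2 h2)
    (fun p hm hp => ?_) (fun h p hm hp hP => ?_) ?_ (by simp) (by simp)
  · rw [e3, sq_sub_one_of_two h2, multiplicity_X_sub_C_pow hm hp]
    rfl
  · rw [Finsupp.add_apply, Finsupp.add_apply, mult_of_ne _ hP, add_zero, add_zero]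
    by_cases hP1 : Place.finite p hm hp = placeAt 1
    · right
      obtain rfl : p = X - C 1 := by
        rw [placeAt, Place.finite.injEq] at hP1
        exact hP1
      -- Here `P_1` is a pole: the denominator is `(X - 1) ^ 2` in characteristic `2`.
      rw [h.ramIndex_of_dvd hm hp (sq_sub_one_of_two h2 ▸ dvd_pow_self _ two_ne_zero),
        sq_sub_one_of_two h2, multiplicity_X_sub_C_pow hm hp, hP1, mult_self, mult_self]
      norm_num
    · left
      simp [mult_of_ne _ hP1]
  · rw [Finsupp.add_apply, mult_of_ne _ (placeAt_ne zero_ne_one), mult_self, zero_add]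

omit [Finite F] in
theorem row_O7 (h3 : (3 : F) = 0) : IsTableRow (LineClass.O7_char3.lines F) 1
    ![0, 1, 0, 0] ![0, 0, 1, 0] (X ^ 3) 1 0 IsPurelyInseparableMorphism := by
  have : CharP F 3 := ringChar.of_eq (three_eq_zero_iff.1 h3)
  have : Fact (Nat.Prime 3) := ⟨Nat.prime_three⟩
  exact .of_coprime (lines_O7 h3) ncard_O7
    (corresponds_of 1 0 0 0 0 0 0 1 join_axis (by simp) (by simp)) isCoprime_one_right (by simp)
    (isPurelyInseparableMorphism_X_pow 3)

/-- The rows of the passants meeting the axis of the osculating developable at the intersection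
of two tangents. -/
theorem IsTableRow.of_passant_left {𝒪 : Set (Submodule F (Fin 4 → F))} {size : ℚ}
    (h3 : (3 : F) = 0) {u : F} (hu : u ≠ 0)
    (horb : 𝒪 = MulAction.orbit PGL(2, F) (join ![0, 1, 0, 0] ![u, 0, 1, 0]))
    (hcard : (𝒪.ncard : ℚ) = size) :
    IsTableRow 𝒪 size ![0, 1, 0, 0] ![u, 0, 1, 0] (X ^ 3 - C u * X) 1 0
      (HasDivisors (mult 2 .infinity) (mult 4 .infinity)) := by
  have hdeg : (X ^ 3 - C u * X : F[X]).natDegree = 3 := by compute_degree!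
  have hC : (3 : F[X]) = 0 := by rw [← map_ofNat C, h3, C_0]
  refine .of_coprime horb hcard
    (corresponds_of 1 0 (-u) 0 0 0 0 1 (join_passant_left u) (by simp [sub_eq_add_neg]) (by simp))
    isCoprime_one_right (by rw [hdeg, natDegree_one]; norm_num) ?_
  -- The Wronskian is constant, so nothing ramifies at finite places and the whole degree `4` of the
  -- different sits at `∞`.
  refine hasDivisors_of (W := C (-u)) (a := 3) (b := 0) (k := 0) isCoprime_one_right monic_one
    ?_ (by simpa using hu) hdeg natDegree_one (natDegree_C _) (by norm_num)
    (fun p hm hp => ?_) (fun h p hm hp => .inl ?_) (by simp) (by simp)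
  · simp [wronskian, map_ofNat C]
    linear_combination hC
  · rw [multiplicity_C hp (neg_ne_zero.2 hu)]
    simp
  · simp

theorem row_O81minus (h3 : (3 : F) = 0) {u : F} (hu : ¬ IsSquare u) :
    IsTableRow (LineClass.O81minus_char3.lines F) ((Nat.card F : ℚ) ^ 2 / 2 - 1 / 2)
      ![0, 1, 0, 0] ![u, 0, 1, 0] (X ^ 3 - C u * X) 1 0
      (HasDivisors (mult 2 .infinity) (mult 4 .infinity)) :=
  .of_passant_left h3 (by rintro rfl; simp at hu) (lines_O81minus h3 hu) (ncard_O81minus h3 hu)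

theorem row_O81plus (h3 : (3 : F) = 0) :
    IsTableRow (LineClass.O81plus_char3.lines F) ((Nat.card F : ℚ) ^ 2 / 2 - 1 / 2)
      ![0, 1, 0, 0] ![1, 0, 1, 0] (X ^ 3 - X) 1 0
      (HasDivisors (mult 2 .infinity) (mult 4 .infinity)) := by
  have := IsTableRow.of_passant_left h3 one_ne_zero (lines_O81plus h3) (ncard_O81plus h3)
  simpa using this

theorem row_O82 (h3 : (3 : F) = 0) :
    IsTableRow (LineClass.O82_char3.lines F) ((Nat.card F : ℚ) ^ 3 - Nat.card F)
      ![1, 1, 0, 0] ![0, 0, 1, 0] (X ^ 3 - X ^ 2) 1 0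
      (HasDivisors (mult 1 (placeAt 0) + mult 2 .infinity)
        (mult 1 (placeAt 0) + mult 3 .infinity)) := by
  have h2 := two_ne_zero_of_three h3
  have hdeg : (X ^ 3 - X ^ 2 : F[X]).natDegree = 3 := by compute_degree!
  have hC : (3 : F[X]) = 0 := by rw [← map_ofNat C, h3, C_0]
  refine .of_coprime (lines_O82 h3) (ncard_O82 h3)
    (corresponds_of 1 (-1) 0 0 0 0 0 1 (join_passant_right 1) (by simp [sub_eq_add_neg]) (by simp))
    isCoprime_one_right (by rw [hdeg, natDegree_one]; norm_num) ?_
  refine hasDivisors_of (W := C (-2) * X) (a := 3) (b := 0) (k := 1) isCoprime_one_right monic_one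
    ?_ (by simpa using h2) hdeg natDegree_one (natDegree_C_mul_X _ (neg_ne_zero.2 h2)) (by norm_num)
    (fun p hm hp => ?_) (fun h p hm hp => .inl ?_) (by simp) (by simp)
  · simp [wronskian, map_ofNat C]
    linear_combination X ^ 2 * hC
  · rw [multiplicity_C_mul (neg_ne_zero.2 h2)]
    simpa using multiplicity_X_pow hm hp 1
  · simpa using mult_le_one _ _

/-- The row of the imaginary axes. -/
theorem row_O3d (h3 : (3 : F) ≠ 0) {n : F} (hn : Irreducible (X ^ 2 + X + C n : F[X])) :
    IsTableRow (LineClass.O3d.lines F) ((Nat.card F : ℚ) ^ 2 / 2 - Nat.card F / 2)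
      ![3 * n, n - 1, 0, 3] ![3 * n, -1, 1, 0] (X ^ 3 - C (3 * n) * X - C n)
      (X ^ 2 + X + C ((1 - n) / 3)) 0
      (HasDivisors (mult 2 (placeQ n hn)) (mult 2 (placeQ n hn))) := by
  set m := (1 - n) / 3 with hm
  have hm3 : (3 : F[X]) * C m = 1 - C n := by
    rw [← map_ofNat C, ← C_mul, hm, mul_div_cancel₀ _ h3, C_sub, C_1]
  -- A vanishing discriminant would give the quadratic the rational root `-2n`.
  have hδ : 1 - 4 * n ≠ 0 := by
    intro h0
    refine quadratic_ne_zero hn (s := -2 * n) (t := 1) (by simp) ?_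
    linear_combination -n * h0
  have hκ : (C (3 / (1 - 4 * n)) : F[X]) * (1 - 4 * C n) = 3 := by
    rw [← map_ofNat C 4, ← C_1, ← C_mul, ← C_sub, ← C_mul, div_mul_cancel₀ _ hδ, map_ofNat]
  set f : F[X] := X ^ 3 - C (3 * n) * X - C n with hf
  set g : F[X] := X ^ 2 + X + C m with hg
  set Q : F[X] := X ^ 2 + X + C n with hQ
  have hfd : f.natDegree = 3 := by rw [hf]; compute_degree!
  have hgd : g.natDegree = 2 := by rw [hg]; compute_degree!
  have hQd : Q.natDegree = 2 := by rw [hQ]; compute_degree!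
  have hgm : g.Monic := by rw [hg]; monicity!
  have hQm : Q.Monic := by rw [hQ]; monicity!
  have hf' : f = X ^ 3 - 3 * C n * X - C n := by rw [hf, C_mul, map_ofNat]
  have hco : IsCoprime f g := by
    set κ : F[X] := C (3 / (1 - 4 * n))
    have h3' : (3 : F[X]) ≠ 0 := by rw [← map_ofNat C]; exact C_ne_zero.2 h3
    -- Two Euclidean divisions: `f - (X - 1) g = (2X + 1) / κ` and `4g - (2X + 1)² = 1 / κ`, with `κ
    -- = 3 / (1 - 4n)`.
    refine ⟨-κ ^ 2 * (2 * X + 1), κ * (4 + κ * (2 * X + 1) * (X - 1)), mul_left_cancel₀ h3' ?_⟩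
    rw [hf', hg]
    linear_combination (1 - κ * (2 * X + 1) ^ 2) * hκ +
      (4 * κ - κ ^ 2 * (2 * X + 1) * (1 - X)) * hm3
  have hW : wronskian g f = Q ^ 2 := by
    rw [hf', hg, hQ, wronskian]
    simp [map_ofNat C]
    linear_combination (X ^ 2 - C n) * hm3
  have hcor : Corresponds (join ![3 * n, n - 1, 0, 3] ![3 * n, -1, 1, 0]) f g := by
    refine corresponds_of 1 0 (-(3 * n)) (-n) 0 1 1 m ?_ ?_ (by simp [hg])
    · refine join_eq_plane_inf (linearIndependent_of_minor 2 3 (by simpa using h3))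
        (linearIndependent_of_minor 0 1 (by simp)) ?_
      have : m * 3 = 1 - n := by rw [hm, div_mul_cancel₀ _ h3]
      simp [this]
      ring
    · rw [hf]
      simp
      ring
  refine .of_coprime (lines_O3d h3 hn) (ncard_O3d h3 hn) hcor hco (by rw [hfd, hgd]; norm_num) ?_
  refine hasDivisors_of hco hgm hW (pow_ne_zero 2 hQm.ne_zero) hfd hgd
    (by rw [natDegree_pow, hQd]) (by norm_num)
    (fun p hm hp => multiplicity_irreducible_pow hm hp hQm hn 2)
    (fun h p hpm hp => ?_) (by simp) (by simp)
  by_cases hP : Place.finite p hpm hp = placeQ n hn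
  · right
    obtain rfl : p = Q := by
      rw [placeQ, Place.finite.injEq] at hP
      exact hP
    -- The image place of `Q`: the roots of `s` are three times the roots of `Q`.
    set s : F[X] := X ^ 2 + C 3 * X + C (9 * n) with hs
    have hsd : s.natDegree = 2 := by rw [hs]; compute_degree!
    have hsm : s.Monic := by rw [hs]; monicity!
    have hsi : Irreducible s := by
      refine irreducible_of_degree_le_three_of_not_isRoot (by rw [hsd]; simp) fun y hy => ?_
      rw [IsRoot, hs] at hy
      simp at hy
      exact quadratic_ne_zero hn (s := y) (t := 3) (.inr h3) (by linear_combination hy)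
    -- The fibre over the place of `s` is `Q ^ 3`, so `Q` is totally ramified. Its index `3` cannot
    -- be read off the Wronskian alone when the exponent is `2`.
    have hh' : f ^ 2 + 3 * f * g + 9 * C n * g ^ 2 = Q ^ 3 := by
      rw [hf', hg, hQ]
      linear_combination (X ^ 3 - 3 * C n * X - C n +
        C n * (3 * (X ^ 2 + X + C m) + 3 * X ^ 2 + 3 * X + 1 - C n)) * hm3
    have hh : homog s f g = Q ^ 3 := by
      rw [← hh', homog, hsd, Finset.sum_range_succ, Finset.sum_range_succ, Finset.sum_range_one, hs]
      simp [coeff_X, coeff_C, map_ofNat C]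
      ring
    have hpg : ¬ Q ∣ g := fun hd => by
      have h2 : Q ∣ f ^ 2 := by
        have e : f ^ 2 = Q ^ 3 - g * (3 * f + 9 * C n * g) := by
          rw [← hh', sub_eq_add_neg]; ring
        rw [e]
        exact dvd_sub (dvd_pow_self Q three_ne_zero) (hd.mul_right _)
      exact hn.not_isUnit (hco.isUnit_of_dvd' (hn.prime.dvd_of_dvd_pow h2) hd)
    rw [h.ramIndex_of_dvd_homog hpm hp hpg hsm hsi (hh ▸ dvd_pow_self Q three_ne_zero), hh,
      multiplicity_irreducible_pow hpm hp hQm hn, hP, placeQ, mult_self, mult_self]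
    norm_num
  · left
    simp [mult_of_ne _ hP]

end Rows

/-! ### Coefficient vectors of cubic forms -/

section CoeffVec

variable {k : Type*} [Field k]

/-- The coefficients of the cubic form with dehomogenization `f`. -/
noncomputable def coeffVec (f : k[X]) : Fin 4 → k := fun j => f.coeff (3 - (j : ℕ))

theorem coeffVec_dot (f : k[X]) (v : Fin 4 → k) : coeffVec f ⬝ᵥ v =
    f.coeff 3 * v 0 + f.coeff 2 * v 1 + f.coeff 1 * v 2 + f.coeff 0 * v 3 := by
  rw [dot_four]
  rfl

/-- A plane cuts the cubic in the zeros of its form; common roots of `f` and `g` are the points of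
the cubic on the line. -/
theorem coeffVec_dot_pt {f : k[X]} (hf : f.natDegree ≤ 3) (x : k) :
    coeffVec f ⬝ᵥ pt x 1 = f.eval x := by
  rw [coeffVec_dot, eval_eq_sum_range' (Nat.lt_succ_of_le hf)]
  simp [Finset.sum_range_succ, pt]
  ring

theorem coeffVec_cubic (x y z w : k) :
    coeffVec (C x * X ^ 3 + C y * X ^ 2 + C z * X + C w) = ![x, y, z, w] := by
  ext j
  fin_cases j <;> simp [coeffVec, coeff_X, coeff_C]

/-- Cubes of linear forms are the equations of osculating planes. Thus a cube in the pencil of `f`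
and `g` is an osculating plane through the line. -/
theorem coeffVec_dot_cube (c x : k) (v : Fin 4 → k) :
    coeffVec (C c * (X - C x) ^ 3) ⬝ᵥ v = c * (osc x 1 ⬝ᵥ v) := by
  have e : C c * (X - C x) ^ 3 =
      C c * X ^ 3 + C (-3 * c * x) * X ^ 2 + C (3 * c * x ^ 2) * X + C (-(c * x ^ 3)) := by
    simp [map_ofNat C]
    ring
  rw [e, coeffVec_cubic, dot_four, osc_dot]
  simp
  ring

/-- The same at infinity: a constant is the dehomogenization of a cube of the second variable. -/
theorem coeffVec_dot_C (c : k) (v : Fin 4 → k) :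
    coeffVec (C c) ⬝ᵥ v = -c * (osc 1 0 ⬝ᵥ v) := by
  rw [coeffVec_dot, osc_dot]
  simp [coeff_C]

theorem coeffVec_dot_comb (a b : k) (f g : k[X]) (v : Fin 4 → k) :
    coeffVec (C a * f + C b * g) ⬝ᵥ v = a * (coeffVec f ⬝ᵥ v) + b * (coeffVec g ⬝ᵥ v) := by
  simp only [coeffVec_dot, coeff_add, coeff_C_mul]
  ring

/-- The kernel of one linear form has dimension at least three. -/
theorem not_isLine_of_plane_le {L : Submodule k (Fin 4 → k)} {c : Fin 4 → k} (h : plane c ≤ L) :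
    ¬ IsLine L := by
  intro hL
  let ψ : (Fin 4 → k) →ₗ[k] k := Fintype.linearCombination k c
  have hψ : LinearMap.ker ψ = plane c := by
    ext v
    rw [LinearMap.mem_ker, mem_plane, Fintype.linearCombination_apply, dotProduct]
    simp [mul_comm]
  have h1 := LinearMap.finrank_range_add_finrank_ker ψ
  have h2 : Module.finrank k (LinearMap.range ψ) ≤ 1 :=
    (Submodule.finrank_le _).trans (Module.finrank_self k).le
  have h3 := Submodule.finrank_mono h
  rw [hψ, Module.finrank_fintype_fun_eq_card, Fintype.card_fin] at h1
  rw [show Module.finrank k L = 2 from hL] at h3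
  lia

theorem eq_C_mul_cube {h : k[X]} (hd : h.natDegree ≤ 3) (h0 : h ≠ 0) {x : k}
    (hx : (X - C x) ^ 3 ∣ h) : ∃ c, c ≠ 0 ∧ h = C c * (X - C x) ^ 3 := by
  obtain ⟨r, rfl⟩ := hx
  have hr : r ≠ 0 := right_ne_zero_of_mul h0
  rw [natDegree_mul (pow_ne_zero 3 (X_sub_C_ne_zero x)) hr, natDegree_pow, natDegree_X_sub_C] at hd
  obtain ⟨c, rfl⟩ := natDegree_eq_zero.1 (by lia : r.natDegree = 0)
  exact ⟨c, fun h => hr (by rw [h, C_0]), mul_comm _ _⟩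

end CoeffVec

/-! ### Roots in the algebraic closure -/

section Roots

variable {F : Type*} [Field F] [Finite F]

local notation "K" => AlgebraicClosure F
local notation "ι" => algebraMap F (AlgebraicClosure F)

omit [Finite F] in
theorem exists_root {p : F[X]} (hp : Irreducible p) : ∃ ξ : K, aeval ξ p = 0 :=
  IsAlgClosed.exists_aeval_eq_zero K p (degree_pos_of_irreducible hp).ne'

omit [Finite F] in
theorem dvd_of_aeval_eq_zero {p a : F[X]} (hm : p.Monic) (hp : Irreducible p) {ξ : K}
    (hξ : aeval ξ p = 0) (ha : aeval ξ a = 0) : p ∣ a := by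
  rw [minpoly.eq_of_irreducible_of_monic hp hξ hm]
  exact minpoly.dvd F ξ ha

theorem aeval_frob {p : F[X]} {ξ : K} (hξ : aeval ξ p = 0) : aeval (frob F ξ) p = 0 := by
  rw [aeval_algHom_apply, hξ, map_zero]

/-- Frobenius interchanges the two roots: their sum is rational, so conjugating twice returns to the
start. -/
theorem isQuadraticNonrational_of_aeval {p : F[X]} (hm : p.Monic) (hp : Irreducible p)
    (hd : p.natDegree = 2) {ξ : K} (hξ : aeval ξ p = 0) : IsQuadraticNonrational ξ := by
  have key : ∀ x : K, aeval x p = 0 → x ^ 2 + ι (p.coeff 1) * x + ι (p.coeff 0) = 0 := by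
    intro x hx
    rw [aeval_eq_sum_range, hd] at hx
    have h2 : p.coeff 2 = 1 := by rw [← hd]; exact hm
    simp [Finset.sum_range_succ, h2, Algebra.smul_def] at hx
    linear_combination hx
  have h1 := key _ hξ
  have h2 := key _ (aeval_frob hξ)
  have hne : frob F ξ ≠ ξ := by
    intro h0
    obtain ⟨a, rfl⟩ := exists_of_frob_eq h0
    have := natDegree_le_of_dvd (dvd_of_aeval_eq_zero (a := X - C a) hm hp hξ (by simp))
      (X_sub_C_ne_zero a)
    rw [hd, natDegree_X_sub_C] at this
    lia
  have h3 : frob F ξ = -ι (p.coeff 1) - ξ := by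
    refine mul_left_cancel₀ (sub_ne_zero.2 hne) ?_
    linear_combination h2 - h1
  refine isQuadraticNonrational_iff.2 ⟨?_, hne⟩
  rw [h3, map_sub, map_neg, AlgHom.commutes, h3]
  ring

omit [Finite F] in
theorem X_sub_C_pow_dvd_map {p a : F[X]} {ξ : K} (hξ : aeval ξ p = 0) {m : ℕ} (h : p ^ m ∣ a) :
    (X - C ξ) ^ m ∣ a.map ι := by
  refine (pow_dvd_pow_of_dvd ?_ m).trans (Polynomial.map_pow ι m ▸ Polynomial.map_dvd ι h)
  rwa [dvd_iff_isRoot, IsRoot, eval_map_algebraMap]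

end Roots

/-! ### The fibres of a quotient of coprime polynomials -/

section Fibres

variable {F : Type*} [Field F]

local notation "𝔯" => algebraMap F[X] (RatFunc F)

theorem homog_mul {a b f g : F[X]} (ha : a ≠ 0) (hb : b ≠ 0) (hg : g ≠ 0) :
    homog (a * b) f g = homog a f g * homog b f g := by
  have key : ∀ q : F[X], 𝔯 (homog q f g) = aeval (𝔯 f / 𝔯 g) q * 𝔯 g ^ q.natDegree := fun q =>
    map_homog (IsScalarTower.toAlgHom F F[X] (RatFunc F)) q f g (algebraMap_ne hg)
  apply RatFunc.algebraMap_injective F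
  rw [map_mul, key, key, key, natDegree_mul ha hb, map_mul, pow_add]
  ring

theorem eval_homog (q f : F[X]) {g : F[X]} {x : F} (hg : g.eval x ≠ 0) :
    (homog q f g).eval x = q.eval (f.eval x / g.eval x) * g.eval x ^ q.natDegree := by
  have := map_homog (aeval x) q f g (by simpa using hg)
  simpa using this

theorem map_homog_map {k : Type*} [Field k] (σ : F →+* k) (q f g : F[X]) :
    (homog q f g).map σ = homog (q.map σ) (f.map σ) (g.map σ) := by
  simp [homog, Polynomial.map_sum]

/-- The numerator of the local parameter at a place pulled back along `f / g`. -/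
noncomputable def fiberForm (f g : F[X]) : Place F → F[X]
  | .finite q _ _ => homog q f g
  | .infinity => g

/-- The degree of a place. -/
noncomputable def Place.deg : Place F → ℕ
  | .finite q _ _ => q.natDegree
  | .infinity => 1

theorem Place.one_le_deg (Q : Place F) : 1 ≤ Q.deg := by
  cases Q with
  | finite q hm hq => exact hq.natDegree_pos
  | infinity => exact le_rfl

theorem natDegree_fiberForm_le {f g : F[X]} {m : ℕ} (hf : f.natDegree ≤ m) (hg : g.natDegree ≤ m)
    (Q : Place F) : (fiberForm f g Q).natDegree ≤ Q.deg * m := by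
  cases Q with
  | finite q hm hq => exact natDegree_homog_le hf hg
  | infinity => exact hg.trans (one_mul m).ge

namespace IsReduced

variable {f g : F[X]} (h : IsReduced f g)

include h

/-- The residue field of the image embeds in that of the place. -/
theorem deg_image_le {p : F[X]} (hm : p.Monic) (hp : Irreducible p) :
    ((Place.finite p hm hp).image (assocMorphism f g)).deg ≤ p.natDegree := by
  by_cases hpg : p ∣ g
  · rw [h.image_of_dvd hm hp hpg]
    exact hp.natDegree_pos
  · have : Fact (Irreducible p) := ⟨hp⟩
    have hfin : Module.Finite F (AdjoinRoot p) := (AdjoinRoot.powerBasis hp.ne_zero).finite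
    rw [Place.image, h.denom_eq, if_neg hpg]
    refine (minpoly.natDegree_le _).trans ?_
    rw [(AdjoinRoot.powerBasis hp.ne_zero).finrank, AdjoinRoot.powerBasis_dim]

theorem fiberForm_facts [Finite F] {p : F[X]} (hm : p.Monic) (hp : Irreducible p) {Q : Place F}
    (hQ : (Place.finite p hm hp).image (assocMorphism f g) = Q) :
    fiberForm f g Q ≠ 0 ∧
      ramIndex (assocMorphism f g) (.finite p hm hp) = multiplicity p (fiberForm f g Q) := by
  by_cases hpg : p ∣ g
  · rw [h.image_of_dvd hm hp hpg] at hQ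
    subst hQ
    exact ⟨h.right_ne_zero, h.ramIndex_of_dvd hm hp hpg⟩
  · obtain ⟨q, hqm, hq, hi, hd⟩ := h.exists_image_eq hm hp hpg
    rw [hi] at hQ
    subst hQ
    exact ⟨(h.homog_facts hp hpg hq hd).1, h.ramIndex_of_dvd_homog hm hp hpg hqm hq hd⟩

/-- A binary form of degree `m` vanishes at infinity to the order by which its dehomogenization
falls short of `m`. -/
theorem ramIndex_infinity {m : ℕ} (hmax : max f.natDegree g.natDegree = m) {Q : Place F}
    (hQ : Place.infinity.image (assocMorphism f g) = Q) :
    Q.deg = 1 ∧ fiberForm f g Q ≠ 0 ∧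
      ramIndex (assocMorphism f g) .infinity = m - (fiberForm f g Q).natDegree := by
  by_cases hd : g.natDegree < f.natDegree
  · obtain ⟨h1, h2⟩ := h.ramIndex_infinity_of_lt hd
    rw [h1] at hQ
    subst hQ
    rw [max_eq_left hd.le] at hmax
    exact ⟨rfl, h.right_ne_zero, by rw [h2, hmax]; rfl⟩
  · have hd := not_lt.1 hd
    obtain ⟨h1, h2⟩ := h.ramIndex_infinity_of_le hd
    rw [h1] at hQ
    subst hQ
    rw [max_eq_right hd] at hmax
    have e : fiberForm f g (placeAt (f.coeff g.natDegree)) = f - C (f.coeff g.natDegree) * g :=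
      homog_X_sub_C _ _ _
    exact ⟨natDegree_X_sub_C _, e ▸ h.sub_C_mul_ne_zero _, by rw [h2, e, hmax]⟩

/-- Distinct ramified places of a cubic morphism have distinct images. -/
theorem image_ne [Finite F] (hmax : max f.natDegree g.natDegree = 3) {P P' : Place F} (hne : P ≠ P')
    (hP : 1 < ramIndex (assocMorphism f g) P) (hP' : 1 < ramIndex (assocMorphism f g) P') :
    P.image (assocMorphism f g) ≠ P'.image (assocMorphism f g) := by
  have hf : f.natDegree ≤ 3 := hmax ▸ le_max_left _ _
  have hg : g.natDegree ≤ 3 := hmax ▸ le_max_right _ _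
  -- Ramification at `∞` lowers the degree of the fibre form to at most `1`, leaving no room for a
  -- factor `p ^ 2`.
  have key : ∀ {p : F[X]} (hm : p.Monic) (hp : Irreducible p),
      1 < ramIndex (assocMorphism f g) (.finite p hm hp) →
      (Place.finite p hm hp).image (assocMorphism f g) ≠
        Place.infinity.image (assocMorphism f g) ∨
      ¬ 1 < ramIndex (assocMorphism f g) .infinity := by
    intro p hm hp hr
    by_contra! hc
    obtain ⟨h1, h2⟩ := h.fiberForm_facts hm hp hc.1
    obtain ⟨-, -, h4⟩ := h.ramIndex_infinity hmax rfl
    rw [h2] at hr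
    rw [h4] at hc
    have h5 := natDegree_le_of_dvd ((finiteMultiplicity hp h1).pow_dvd_iff_le_multiplicity.2
      (by exact_mod_cast hr : 2 ≤ _)) h1
    have h6 := hp.natDegree_pos
    rw [natDegree_pow] at h5
    have := hc.2
    lia
  cases P with
  | infinity =>
    cases P' with
    | infinity => exact absurd rfl hne
    | finite p' hm' hp' => exact ((key hm' hp' hP').resolve_right (not_not.2 hP)).symm
  | finite p hm hp =>
    cases P' with
    | infinity => exact (key hm hp hP).resolve_right (not_not.2 hP')
    | finite p' hm' hp' =>
      intro hi
      obtain ⟨h1, h2⟩ := h.fiberForm_facts hm hp rfl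
      obtain ⟨-, h4⟩ := h.fiberForm_facts hm' hp' hi.symm
      have hd1 := h.deg_image_le hm hp
      have hd2 := h.deg_image_le hm' hp'
      have hd3 := natDegree_fiberForm_le hf hg ((Place.finite p hm hp).image (assocMorphism f g))
      have hd4 := Place.one_le_deg ((Place.finite p hm hp).image (assocMorphism f g))
      rw [← hi] at hd2
      rw [h2] at hP
      rw [h4] at hP'
      have hpp : p ≠ p' := by simpa using hne
      -- The fibre form has degree at most `3 deg Q` and would be divisible by `p ^ 2 * p' ^ 2`, of
      -- degree at least `4 deg Q`, since `p` and `p'` have at least the degree of their image `Q`.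
      have hco : IsCoprime (p ^ 2) (p' ^ 2) := by
        refine IsCoprime.pow ((hp.coprime_iff_not_dvd).2 fun hd => hpp ?_)
        exact eq_of_monic_of_associated hm hm' (hp.associated_of_dvd hp' hd)
      have hdvd := hco.mul_dvd
        ((finiteMultiplicity hp h1).pow_dvd_iff_le_multiplicity.2 (by exact_mod_cast hP : 2 ≤ _))
        ((finiteMultiplicity hp' h1).pow_dvd_iff_le_multiplicity.2 (by exact_mod_cast hP' : 2 ≤ _))
      have h5 := natDegree_le_of_dvd hdvd h1
      rw [natDegree_mul (pow_ne_zero 2 hp.ne_zero) (pow_ne_zero 2 hp'.ne_zero), natDegree_pow,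
        natDegree_pow] at h5
      lia

local notation "K" => AlgebraicClosure F
local notation "ι" => algebraMap F (AlgebraicClosure F)

/-- Total ramification over the algebraic closure. -/
theorem exists_cube [Finite F] (hf : f.natDegree ≤ 3) (hg : g.natDegree ≤ 3) {p : F[X]}
    (hm : p.Monic) (hp : Irreducible p)
    (hr : 3 ≤ ramIndex (assocMorphism f g) (.finite p hm hp)) {ξ : K} (hξ : aeval ξ p = 0) :
    ∃ a b c : K, c ≠ 0 ∧ C a * f.map ι + C b * g.map ι = C c * (X - C ξ) ^ 3 := by
  have hfι : (f.map ι).natDegree ≤ 3 := natDegree_map_le.trans hf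
  have hgι : (g.map ι).natDegree ≤ 3 := natDegree_map_le.trans hg
  have hgι0 : g.map ι ≠ 0 :=
    (Polynomial.map_ne_zero_iff (algebraMap F K).injective).2 h.right_ne_zero
  have hdvd : ∀ {a : F[X]}, a ≠ 0 → 3 ≤ multiplicity p a → (X - C ξ) ^ 3 ∣ a.map ι :=
    fun ha hle => X_sub_C_pow_dvd_map hξ
      ((finiteMultiplicity hp ha).pow_dvd_iff_le_multiplicity.2 hle)
  by_cases hpg : p ∣ g
  · rw [h.ramIndex_of_dvd hm hp hpg] at hr
    obtain ⟨c, hc, e⟩ := eq_C_mul_cube hgι hgι0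
      (hdvd h.right_ne_zero (by exact_mod_cast hr))
    exact ⟨0, 1, c, hc, by rw [← e]; simp⟩
  · obtain ⟨q, hqm, hq, -, hd⟩ := h.exists_image_eq hm hp hpg
    rw [h.ramIndex_of_dvd_homog hm hp hpg hqm hq hd] at hr
    have hN := (h.homog_facts hp hpg hq hd).1
    have hN' : (homog q f g).map ι ≠ 0 :=
      (Polynomial.map_ne_zero_iff (algebraMap F K).injective).2 hN
    have h3 := hdvd hN (by exact_mod_cast hr)
    rw [map_homog_map] at h3 hN'
    have hgξ : (g.map ι).eval ξ ≠ 0 := by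
      rw [eval_map_algebraMap]
      exact fun h0 => hpg (dvd_of_aeval_eq_zero hm hp hξ h0)
    -- Over the closure the fibre form splits according to the roots of `q`. Those are simple, so
    -- only the factor `f - β g`, with `β` the value at `ξ`, vanishes at `ξ`; it absorbs the whole
    -- cube and, having degree at most `3`, is a constant times it.
    set β : K := (f.map ι).eval ξ / (g.map ι).eval ξ with hβ
    have hqβ : (q.map ι).eval β = 0 := by
      have h0 : (homog (q.map ι) (f.map ι) (g.map ι)).eval ξ = 0 :=
        dvd_iff_isRoot.1 ((dvd_pow_self _ three_ne_zero).trans h3)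
      rw [eval_homog _ _ hgξ] at h0
      exact (mul_eq_zero.1 h0).resolve_right (pow_ne_zero _ hgξ)
    obtain ⟨r, hqr⟩ := dvd_iff_isRoot.2 hqβ
    have hqι : q.map ι ≠ 0 := (Polynomial.map_ne_zero_iff (algebraMap F K).injective).2 hq.ne_zero
    have hr0 : r ≠ 0 := fun h0 => hqι (by rw [hqr, h0, mul_zero])
    have hrβ : r.eval β ≠ 0 := by
      have hsep : (q.map ι).Separable := (PerfectField.separable_of_irreducible hq).map
      intro h0
      obtain ⟨s, t, hst⟩ := hsep
      have e := congrArg (eval β) hst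
      rw [hqr] at e
      simp [h0] at e
    rw [hqr, homog_mul (X_sub_C_ne_zero β) hr0 hgι0, homog_X_sub_C] at h3 hN'
    have hndvd : ¬ (X - C ξ) ∣ homog r (f.map ι) (g.map ι) := by
      rw [dvd_iff_isRoot, IsRoot, eval_homog _ _ hgξ]
      exact mul_ne_zero hrβ (pow_ne_zero _ hgξ)
    have h4 := (prime_X_sub_C ξ).pow_dvd_of_dvd_mul_right 3 hndvd h3
    obtain ⟨c, hc, e⟩ := eq_C_mul_cube
      ((natDegree_sub_le _ _).trans (max_le hfι ((natDegree_C_mul_le _ _).trans hgι)))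
      (left_ne_zero_of_mul hN') h4
    exact ⟨1, -β, c, hc, by rw [← e]; simp [sub_eq_add_neg]⟩

end IsReduced

end Fibres

/-! ### The generic lines -/

section Generic

variable {F : Type*} [Field F] {L : Submodule F (Fin 4 → F)} {f g : F[X]}

local notation "K" => AlgebraicClosure F
local notation "ι" => algebraMap F (AlgebraicClosure F)

theorem coeffVec_map (a : F[X]) : coeffVec (a.map ι) = emb (coeffVec a) := by
  ext i
  simp [coeffVec, emb]

theorem eq_zero_of_coeffVec_eq_zero {h : F[X]} (hd : h.natDegree ≤ 3) (h0 : coeffVec h = 0) :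
    h = 0 := by
  ext n
  by_cases hn : n ≤ 3
  · have := congrFun h0 ⟨3 - n, by lia⟩
    rw [coeffVec, Fin.val_mk, Nat.sub_sub_self hn] at this
    simpa using this
  · rw [coeff_eq_zero_of_natDegree_lt (by lia), coeff_zero]

namespace Corresponds

variable (hc : Corresponds L f g)

include hc

theorem mem_iff {v : Fin 4 → F} : v ∈ L ↔ coeffVec f ⬝ᵥ v = 0 ∧ coeffVec g ⬝ᵥ v = 0 := by
  conv_lhs => rw [hc.2.2]
  rfl

theorem smul {a : F} (ha : a ≠ 0) : Corresponds L (C a * f) (C a * g) := by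
  refine ⟨(natDegree_C_mul_le _ _).trans hc.1, (natDegree_C_mul_le _ _).trans hc.2.1, ?_⟩
  ext v
  rw [hc.mem_iff]
  change _ ↔ coeffVec (C a * f) ⬝ᵥ v = 0 ∧ coeffVec (C a * g) ⬝ᵥ v = 0
  have e : ∀ r : F[X], coeffVec (C a * r) ⬝ᵥ v = a * (coeffVec r ⬝ᵥ v) := fun r => by
    simpa using coeffVec_dot_comb a 0 r 0 v
  simp [e, ha]

/-- The two forms are not proportional. -/
theorem comb_ne_zero (hL : IsLine L) {a b : F} (hab : a ≠ 0 ∨ b ≠ 0) : C a * f + C b * g ≠ 0 := by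
  intro h0
  have key : ∀ v, a * (coeffVec f ⬝ᵥ v) + b * (coeffVec g ⬝ᵥ v) = 0 := fun v => by
    rw [← coeffVec_dot_comb, h0]
    simp [coeffVec_dot]
  by_cases ha : a = 0
  · have hb : b ≠ 0 := by simpa [ha] using hab
    refine not_isLine_of_plane_le (c := coeffVec f) (fun v hv => hc.mem_iff.2 ⟨hv, ?_⟩) hL
    simpa [ha, hb] using key v
  · refine not_isLine_of_plane_le (c := coeffVec g) (fun v hv => hc.mem_iff.2 ⟨?_, hv⟩) hL
    have := key v
    rw [mem_plane.1 hv, mul_zero, add_zero] at this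
    exact (mul_eq_zero.1 this).resolve_left ha

theorem pt_mem_iff (x : F) : pt x 1 ∈ L ↔ f.eval x = 0 ∧ g.eval x = 0 := by
  rw [hc.mem_iff, coeffVec_dot_pt hc.1, coeffVec_dot_pt hc.2.1]

/-- If both cubic coefficients vanished, the point `P(∞)` would lie on the line. -/
theorem max_natDegree (hL : IsPassant L) : max f.natDegree g.natDegree = 3 := by
  refine le_antisymm (max_le hc.1 hc.2.1) ?_
  by_contra! hlt
  refine (isPassant_iff.1 hL).2 1 0 (by simp) (hc.mem_iff.2 ?_)
  rw [coeffVec_dot, coeffVec_dot, coeff_eq_zero_of_natDegree_lt ((le_max_left _ _).trans_lt hlt),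
    coeff_eq_zero_of_natDegree_lt ((le_max_right _ _).trans_lt hlt)]
  simp [pt]

theorem le_plane_osc_infinity {a b c : F} (h0 : c ≠ 0) (h : C a * f + C b * g = C c) :
    L ≤ plane (osc 1 0) := by
  intro v hv
  obtain ⟨h1, h2⟩ := hc.mem_iff.1 hv
  have e := coeffVec_dot_comb a b f g v
  rw [h, h1, h2, coeffVec_dot_C] at e
  simpa [h0, mem_plane] using e

theorem extend_le_plane_osc {a b c ξ : K} (h0 : c ≠ 0)
    (h : C a * f.map ι + C b * g.map ι = C c * (X - C ξ) ^ 3) : extend L ≤ plane (osc ξ 1) := by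
  rw [extend_le_iff]
  intro v hv
  obtain ⟨h1, h2⟩ := hc.mem_iff.1 hv
  have e := coeffVec_dot_comb a b (f.map ι) (g.map ι) (emb v)
  rw [h, coeffVec_dot_cube, coeffVec_map, coeffVec_map, emb_dot, emb_dot, h1, h2] at e
  simpa [h0, mem_plane] using e

theorem linearIndependent (hL : IsLine L) : LinearIndependent F ![coeffVec f, coeffVec g] := by
  rw [LinearIndependent.pair_iff]
  intro s t hst
  by_contra hne
  refine hc.comb_ne_zero hL (a := s) (b := t) (by tauto) (eq_zero_of_coeffVec_eq_zero ?_ ?_)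
  · exact (natDegree_add_le _ _).trans (max_le ((natDegree_C_mul_le _ _).trans hc.1)
      ((natDegree_C_mul_le _ _).trans hc.2.1))
  · rw [← hst]
    ext i
    simp [coeffVec]

theorem extend_eq (hL : IsLine L) :
    extend L = plane (emb (coeffVec f)) ⊓ plane (emb (coeffVec g)) := by
  conv_lhs => rw [hc.2.2]
  exact extend_plane_inf (hc.linearIndependent hL)

variable [Finite F]

/-- A common irreducible factor of degree `1` puts a rational point of the cubic on the line, one of
degree `2` makes it an imaginary chord, and one of degree `3` makes the two equations proportional.
-/
theorem isCoprime (hL : IsTruePassant L) : IsCoprime f g := by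
  refine isCoprime_of_irreducible_dvd ?_ ?_
  · rintro ⟨rfl, rfl⟩
    exact hc.comb_ne_zero hL.1.1 (a := 1) (b := 1) (by simp) (by simp)
  intro p hp hpf hpg
  obtain ⟨p', hp', hm, hpf, hpg⟩ : ∃ p' : F[X], Irreducible p' ∧ p'.Monic ∧ p' ∣ f ∧ p' ∣ g := by
    have hu : IsUnit (C p.leadingCoeff⁻¹) :=
      isUnit_C.2 (inv_ne_zero (leadingCoeff_ne_zero.2 hp.ne_zero)).isUnit
    have ha : Associated (p * C p.leadingCoeff⁻¹) p := associated_mul_unit_left _ _ hu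
    exact ⟨_, ha.symm.irreducible hp, monic_mul_leadingCoeff_inv hp.ne_zero,
      ha.dvd_iff_dvd_left.2 hpf, ha.dvd_iff_dvd_left.2 hpg⟩
  have hf0 : f ≠ 0 := by simpa using hc.comb_ne_zero hL.1.1 (a := 1) (b := 0) (by simp)
  have hg0 : g ≠ 0 := by simpa using hc.comb_ne_zero hL.1.1 (a := 0) (b := 1) (by simp)
  have hd1 := (natDegree_le_of_dvd hpf hf0).trans hc.1
  have hd0 := hp'.natDegree_pos
  have hroot : ∀ x : K, aeval x p' = 0 → aeval x f = 0 ∧ aeval x g = 0 := fun x hx =>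
    ⟨aeval_eq_zero_of_dvd_aeval_eq_zero hpf hx, aeval_eq_zero_of_dvd_aeval_eq_zero hpg hx⟩
  obtain hd | hd | hd : p'.natDegree = 1 ∨ p'.natDegree = 2 ∨ p'.natDegree = 3 := by lia
  · rw [hm.eq_X_add_C hd, ← sub_neg_eq_add, ← C_neg] at hpf hpg
    exact (isPassant_iff.1 hL.1).2 _ 1 (by simp)
      ((hc.pt_mem_iff _).2 ⟨dvd_iff_isRoot.1 hpf, dvd_iff_isRoot.1 hpg⟩)
  · obtain ⟨ξ, hξ⟩ := exists_root hp'
    have hmem : ∀ x : K, aeval x p' = 0 → pt x 1 ∈ extend L := fun x hx => by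
      rw [hc.extend_eq hL.1.1, Submodule.mem_inf, mem_plane, mem_plane, ← coeffVec_map,
        ← coeffVec_map, coeffVec_dot_pt (natDegree_map_le.trans hc.1),
        coeffVec_dot_pt (natDegree_map_le.trans hc.2.1), eval_map_algebraMap, eval_map_algebraMap]
      exact hroot x hx
    exact hL.2 (isImaginaryChord_of_mem hL.1.1 (isQuadraticNonrational_of_aeval hm hp' hd hξ)
      (hmem ξ hξ) (hmem _ (aeval_frob hξ)))
  · have key : ∀ r : F[X], r ≠ 0 → r.natDegree ≤ 3 → p' ∣ r → ∃ c, c ≠ 0 ∧ r = C c * p' := by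
      rintro r hr hrd ⟨t, rfl⟩
      have ht := right_ne_zero_of_mul hr
      rw [natDegree_mul hp'.ne_zero ht] at hrd
      obtain ⟨c, rfl⟩ := natDegree_eq_zero.1 (by lia : t.natDegree = 0)
      exact ⟨c, fun h => ht (by rw [h, C_0]), mul_comm _ _⟩
    obtain ⟨a, ha, e1⟩ := key f hf0 hc.1 hpf
    obtain ⟨b, hb, e2⟩ := key g hg0 hc.2.1 hpg
    refine hc.comb_ne_zero hL.1.1 (a := b) (b := -a) (.inl hb) ?_
    rw [e1, e2, C_neg]
    ring

/-- For coprime forms a zero Wronskian means that both derivatives vanish. If `3 ≠ 0`, the cubic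
coefficients are then zero and `P(∞)` is on the line. If `3 = 0`, only `X³` and `1` remain, and the
line is the axis, which lies in an osculating plane. -/
theorem wronskian_ne_zero (hL : IsTruePassant L) (ho : ¬ InOsculatingPlane L) :
    wronskian g f ≠ 0 := by
  intro h0
  obtain ⟨h1, h2⟩ := (hc.isCoprime hL).symm.wronskian_eq_zero_iff.1 h0
  have key : ∀ r : F[X], derivative r = 0 → r.coeff 1 = 0 ∧ 2 * r.coeff 2 = 0 ∧
      3 * r.coeff 3 = 0 := fun r hr => by
    have e0 := congrArg (coeff · 0) hr
    have e1 := congrArg (coeff · 1) hr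
    have e2 := congrArg (coeff · 2) hr
    simp only [coeff_derivative, coeff_zero] at e0 e1 e2
    norm_num at e0 e1 e2
    exact ⟨e0, by rw [mul_comm]; simpa using e1, by rw [mul_comm]; simpa using e2⟩
  obtain ⟨g1, g2, g3⟩ := key g h1
  obtain ⟨f1, f2, f3⟩ := key f h2
  by_cases h3 : (3 : F) = 0
  · have hne := two_ne_zero_of_three h3
    have hle : join ![0, 1, 0, 0] ![0, 0, 1, 0] ≤ L := by
      refine join_le_iff.2 ⟨hc.mem_iff.2 ?_, hc.mem_iff.2 ?_⟩ <;>
        rw [coeffVec_dot, coeffVec_dot] <;> simp_all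
    have hline : IsLine (join ![0, 1, 0, 0] ![0, 0, 1, 0] : Submodule F (Fin 4 → F)) :=
      isLine_join (linearIndependent_of_minor 1 2 (by simp))
    have e := hline.eq_of_le hL.1.1 hle
    rw [← axisOfDevelopable_eq h3] at e
    exact ho (e ▸ (isRealAxis_axisOfDevelopable h3).inOsculatingPlane)
  · have hf3 := (mul_eq_zero.1 f3).resolve_left h3
    have hg3 := (mul_eq_zero.1 g3).resolve_left h3
    refine (isPassant_iff.1 hL.1).2 1 0 (by simp) (hc.mem_iff.2 ?_)
    rw [coeffVec_dot, coeffVec_dot, hf3, hg3]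
    simp [pt]

/-- No ramification index of the morphism of a generic line exceeds `2`. -/
theorem ramIndex_le_two (hL : L ∈ passantsNotInOsc F) (h : IsReduced f g) (P : Place F) :
    ramIndex (assocMorphism f g) P ≤ 2 := by
  obtain ⟨hp, ho, ha⟩ := hL
  by_contra! hr
  replace hr : 3 ≤ ramIndex (assocMorphism f g) P := hr
  cases P with
  | infinity =>
    have hmax := hc.max_natDegree hp.1
    have hd0 : ∀ r : F[X], r ≠ 0 → (3 : ℤ) ≤ (3 : ℕ) - r.natDegree → ∃ c, c ≠ 0 ∧ r = C c := by
      intro r hr0 hr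
      obtain ⟨c, rfl⟩ := natDegree_eq_zero.1 (by lia : r.natDegree = 0)
      exact ⟨c, fun h => hr0 (by rw [h, C_0]), rfl⟩
    obtain ⟨-, h1, h2⟩ := h.ramIndex_infinity hmax rfl
    rw [h2] at hr
    obtain ⟨c, hc0, e⟩ := hd0 _ h1 hr
    -- Index `3` at infinity makes the fibre form constant, and this form is `g` or `f - b g`: the
    -- pencil contains the equation of the osculating plane at infinity.
    obtain ⟨a, b, hab⟩ : ∃ a b : F, C a * f + C b * g = C c := by
      by_cases hd : g.natDegree < f.natDegree
      · rw [(h.ramIndex_infinity_of_lt hd).1] at e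
        exact ⟨0, 1, by rw [← e]; simp [fiberForm]⟩
      · rw [(h.ramIndex_infinity_of_le (not_lt.1 hd)).1] at e
        refine ⟨1, -f.coeff g.natDegree, ?_⟩
        rw [← e, placeAt, fiberForm, homog_X_sub_C]
        simp [sub_eq_add_neg]
    exact ho (inOsculatingPlane_iff.2 ⟨1, 0, by simp, hc.le_plane_osc_infinity hc0 hab⟩)
  | finite p hm hpi =>
    have hle : ∀ ξ : K, aeval ξ p = 0 → extend L ≤ plane (osc ξ 1) := fun ξ hξ => by
      obtain ⟨a, b, c, h0, e⟩ := h.exists_cube hc.1 hc.2.1 hm hpi hr hξ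
      exact hc.extend_le_plane_osc h0 e
    have hd0 := hpi.natDegree_pos
    -- Index at least `3`, tame or wild, forces `p ^ 2` to divide the Wronskian, whose degree is at
    -- most `5`.
    have hd3 : p.natDegree < 3 := by
      obtain ⟨e, -, he, -, h1, h2⟩ := h.exists_ramIndex_eq hm hpi
      rw [he] at hr
      have hr : 3 ≤ e := by exact_mod_cast hr
      have h3 : 2 ≤ multiplicity p (wronskian g f) := by
        by_cases h0 : (e : F) = 0
        · have := h2 h0
          lia
        · have := h1 h0
          lia
      have h4 := natDegree_le_of_dvd ((finiteMultiplicity hpi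
        h.wronskian_ne_zero).pow_dvd_iff_le_multiplicity.2 h3) h.wronskian_ne_zero
      have h5 := natDegree_wronskian_lt_add h.wronskian_ne_zero
      have h6 := hc.1
      have h7 := hc.2.1
      rw [natDegree_pow] at h4
      lia
    obtain hd | hd : p.natDegree = 1 ∨ p.natDegree = 2 := by lia
    · have h1 := hle (ι (-p.coeff 0)) (by conv_lhs => rw [hm.eq_X_add_C hd]; simp)
      have h2 : osc (ι (-p.coeff 0)) 1 = emb (osc (-p.coeff 0) 1) := by rw [emb_osc, map_one]
      rw [h2, extend_le_plane_iff] at h1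
      exact ho (inOsculatingPlane_iff.2 ⟨_, 1, by simp, h1⟩)
    · obtain ⟨ξ, hξ⟩ := exists_root hpi
      exact ha (isImaginaryAxis_of_le hp.1.1 (isQuadraticNonrational_of_aeval hm hpi hd hξ)
        (hle ξ hξ) (hle _ (aeval_frob hξ)))

/-- The rational functions of generic lines. -/
theorem generic (hL : L ∈ passantsNotInOsc F) :
    baseDivisor f g = 0 ∧ IsSeparableMorphism (assocMorphism f g) ∧
      IsSimpleMorphism (assocMorphism f g) := by
  have hp := hL.1
  have hco := hc.isCoprime hp
  have hmax := hc.max_natDegree hp.1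
  refine ⟨?_, ?_⟩
  · have := baseDivisor_eq (h := 1) (B := 0) hco
      (fun p _ hp => by rw [multiplicity_of_one_right hp.not_isUnit]; rfl)
      (by rw [one_mul, one_mul, ← Nat.cast_max, hmax]; rfl)
    simpa using this
  have hg0 : g ≠ 0 := by simpa using hc.comb_ne_zero hp.1.1 (a := 0) (b := 1) (by simp)
  -- Rescaling both forms makes the denominator monic and changes neither the line nor the morphism.
  have hl : g.leadingCoeff⁻¹ ≠ 0 := inv_ne_zero (leadingCoeff_ne_zero.2 hg0)
  have hc' := hc.smul hl
  have e : assocMorphism f g =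
      assocMorphism (C g.leadingCoeff⁻¹ * f) (C g.leadingCoeff⁻¹ * g) := by
    rw [assocMorphism, assocMorphism, map_mul, map_mul,
      mul_div_mul_left _ _ (algebraMap_ne (C_ne_zero.2 hl))]
  have h : IsReduced (C g.leadingCoeff⁻¹ * f) (C g.leadingCoeff⁻¹ * g) :=
    ⟨hc'.isCoprime hp, by rw [mul_comm]; exact monic_mul_leadingCoeff_inv hg0,
      hc'.wronskian_ne_zero hp hL.2.1⟩
  rw [e]
  refine ⟨h.isSeparableMorphism, fun P hP => ?_, fun P P' hne h1 h2 => ?_⟩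
  · have := hc'.ramIndex_le_two hL h P
    lia
  · exact h.image_ne (hc'.max_natDegree hp.1) hne h1 h2

end Corresponds

end Generic

end TwistedCubic

/-! ### The classification theorem. -/

open TwistedCubic in
theorem mainTheorem3 {F : Type*} [Field F] [Finite F] (q : ℚ) (hq : q = Nat.card F)
    (n u v d : F) (hn : Irreducible (X ^ 2 + X + C n : F[X]))
    (hu : ringChar F = 3 → ¬ IsSquare u)
    (hv : ringChar F ≠ 2 → ringChar F ≠ 3 → ¬ IsSquare (3 * v))
    (hd : ringChar F ≠ 2 → ¬ IsSquare d) :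
    -- the occurring classes partition the set of lines
    ((⋃ c ∈ {c : LineClass | c.Occurs (ringChar F)}, c.lines F) =
        {L : Submodule F (Fin 4 → F) | IsLine L} ∧
      {c : LineClass | c.Occurs (ringChar F)}.PairwiseDisjoint (LineClass.lines F)) ∧
    -- the kinds of lines that consist of several classes
    ((ringChar F = 2 → unisecantsInOsc F =
        LineClass.O4minus_char2.lines F ∪ LineClass.O4plus_char2.lines F) ∧
      (ringChar F ≠ 2 → unisecantsNotInOsc F =
        LineClass.O5minus.lines F ∪ LineClass.O5plus.lines F) ∧
      (ringChar F ≠ 2 → ringChar F ≠ 3 → passantsInOsc F =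
        LineClass.O5dminus.lines F ∪ LineClass.O5dplus.lines F) ∧
      (ringChar F = 3 → passantsMeetingAxis F =
        LineClass.O81minus_char3.lines F ∪ LineClass.O81plus_char3.lines F ∪
          LineClass.O82_char3.lines F)) ∧
    -- real chords
    IsTableRow (LineClass.O1.lines F) (q ^ 2 / 2 + q / 2) ![1, 0, 0, 0] ![0, 0, 0, 1]
      (X ^ 2) X (mult 1 (placeAt 0) + mult 1 .infinity) (HasDivisors 0 0) ∧
    -- real axes
    (ringChar F ≠ 3 →
      IsTableRow (LineClass.O1d.lines F) (q ^ 2 / 2 + q / 2) ![0, 1, 0, 0] ![0, 0, 1, 0]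
        (X ^ 3) 1 0
        (HasDivisors (mult 2 (placeAt 0) + mult 2 .infinity)
          (mult 2 (placeAt 0) + mult 2 .infinity))) ∧
    -- tangents
    IsTableRow (LineClass.O2.lines F) (q + 1) ![0, 0, 1, 0] ![0, 0, 0, 1]
      (X ^ 3) (X ^ 2) (mult 2 (placeAt 0)) (HasDivisors 0 0) ∧
    -- imaginary chords
    IsTableRow (LineClass.O3.lines F) (q ^ 2 / 2 - q / 2) ![n, -n, 0, 1] ![1 - n, -1, 1, 0]
      (X ^ 3 + C (n - 1) * X - C n) (X ^ 2 + X + C n) (mult 1 (placeQ n hn)) (HasDivisors 0 0) ∧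
    -- imaginary axes
    (ringChar F ≠ 3 →
      IsTableRow (LineClass.O3d.lines F) (q ^ 2 / 2 - q / 2)
        ![3 * n, n - 1, 0, 3] ![3 * n, -1, 1, 0]
        (X ^ 3 - C (3 * n) * X - C n) (X ^ 2 + X + C ((1 - n) / 3)) 0
        (HasDivisors (mult 2 (placeQ n hn)) (mult 2 (placeQ n hn)))) ∧
    -- true unisecants in an osculating plane
    (ringChar F ≠ 2 →
      IsTableRow (LineClass.O4.lines F) (q ^ 2 + q) ![0, 1, 0, 0] ![0, 0, 0, 1]
        (X ^ 3) X (mult 1 (placeAt 0))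
        (HasDivisors (mult 1 (placeAt 0) + mult 1 .infinity)
          (mult 1 (placeAt 0) + mult 1 .infinity))) ∧
    (ringChar F = 2 →
      IsTableRow (LineClass.O4minus_char2.lines F) (q + 1) ![0, 1, 0, 0] ![0, 0, 0, 1]
        (X ^ 3) X (mult 1 (placeAt 0)) IsPurelyInseparableMorphism) ∧
    (ringChar F = 2 →
      IsTableRow (LineClass.O4plus_char2.lines F) (q ^ 2 - 1) ![0, 1, 1, 0] ![0, 0, 0, 1]
        (X ^ 3) (X ^ 2 + X) (mult 1 (placeAt 0))
        (HasDivisors (mult 1 (placeAt 0)) (mult 2 (placeAt 0)))) ∧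
    -- unisecants not in an osculating plane
    (∀ h2 : ringChar F ≠ 2,
      IsTableRow (LineClass.O5minus.lines F) (q ^ 3 / 2 - q / 2) ![-d, 0, 1, 0] ![0, 0, 0, 1]
        (X ^ 3 + C d * X) (X ^ 2) (mult 1 (placeAt 0))
        (HasDivisors (mult 1 (placeSqrt d (hd h2))) (mult 1 (placeSqrt d (hd h2))))) ∧
    (ringChar F ≠ 2 →
      IsTableRow (LineClass.O5plus.lines F) (q ^ 3 / 2 - q / 2) ![-1, 0, 1, 0] ![0, 0, 0, 1]
        (X ^ 3 + X) (X ^ 2) (mult 1 (placeAt 0))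
        (HasDivisors (mult 1 (placeAt 1) + mult 1 (placeAt (-1)))
          (mult 1 (placeAt 1) + mult 1 (placeAt (-1))))) ∧
    (ringChar F = 2 →
      IsTableRow (LineClass.O5_char2.lines F) (q ^ 3 - q) ![1, 0, 1, 0] ![0, 0, 0, 1]
        (X ^ 3 + X) (X ^ 2) (mult 1 (placeAt 0))
        (HasDivisors (mult 1 (placeAt 1)) (mult 2 (placeAt 1)))) ∧
    -- passants in an osculating plane
    (∀ (h2 : ringChar F ≠ 2) (h3 : ringChar F ≠ 3),
      IsTableRow (LineClass.O5dminus.lines F) (q ^ 3 / 2 - q / 2) ![0, 0, 1, 0] ![0, v, 0, 1]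
        (X ^ 3) (X ^ 2 - C v) 0
        (HasDivisors (mult 1 (placeSqrt (3 * v) (hv h2 h3)) + mult 2 (placeAt 0))
          (mult 1 (placeSqrt (3 * v) (hv h2 h3)) + mult 2 (placeAt 0)))) ∧
    (ringChar F ≠ 2 → ringChar F ≠ 3 →
      IsTableRow (LineClass.O5dplus.lines F) (q ^ 3 / 2 - q / 2) ![0, 0, 1, 0] ![0, 1 / 3, 0, 1]
        (X ^ 3) (X ^ 2 - C (1 / 3)) 0
        (HasDivisors (mult 1 (placeAt 1) + mult 1 (placeAt (-1)) + mult 2 (placeAt 0))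
          (mult 1 (placeAt 1) + mult 1 (placeAt (-1)) + mult 2 (placeAt 0)))) ∧
    (ringChar F = 2 →
      IsTableRow (LineClass.O5d_char2.lines F) (q ^ 3 - q) ![0, 0, 1, 0] ![0, 1, 0, 1]
        (X ^ 3) (X ^ 2 + 1) 0
        (HasDivisors (mult 1 (placeAt 1) + mult 2 (placeAt 0))
          (mult 2 (placeAt 1) + mult 2 (placeAt 0)))) ∧
    -- true passants not in an osculating plane
    (((LineClass.O6.lines F).ncard : ℚ) = q ^ 4 - q ^ 3 - q ^ 2 + q ∧
      ∀ L ∈ LineClass.O6.lines F, ∀ f g : F[X], Corresponds L f g →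
        baseDivisor f g = 0 ∧ IsSeparableMorphism (assocMorphism f g) ∧
          IsSimpleMorphism (assocMorphism f g)) ∧
    -- the axis of the osculating developable
    (ringChar F = 3 →
      IsTableRow (LineClass.O7_char3.lines F) 1 ![0, 1, 0, 0] ![0, 0, 1, 0]
        (X ^ 3) 1 0 IsPurelyInseparableMorphism) ∧
    -- passants meeting the axis
    (ringChar F = 3 →
      IsTableRow (LineClass.O81minus_char3.lines F) (q ^ 2 / 2 - 1 / 2)
        ![0, 1, 0, 0] ![u, 0, 1, 0] (X ^ 3 - C u * X) 1 0
        (HasDivisors (mult 2 .infinity) (mult 4 .infinity))) ∧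
    (ringChar F = 3 →
      IsTableRow (LineClass.O81plus_char3.lines F) (q ^ 2 / 2 - 1 / 2)
        ![0, 1, 0, 0] ![1, 0, 1, 0] (X ^ 3 - X) 1 0
        (HasDivisors (mult 2 .infinity) (mult 4 .infinity))) ∧
    (ringChar F = 3 →
      IsTableRow (LineClass.O82_char3.lines F) (q ^ 3 - q)
        ![1, 1, 0, 0] ![0, 0, 1, 0] (X ^ 3 - X ^ 2) 1 0
        (HasDivisors (mult 1 (placeAt 0) + mult 2 .infinity)
          (mult 1 (placeAt 0) + mult 3 .infinity))) := by
  subst hq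
  have two_ne (h : ringChar F ≠ 2) : (2 : F) ≠ 0 := mt two_eq_zero_iff.1 h
  have three_ne (h : ringChar F ≠ 3) : (3 : F) ≠ 0 := mt three_eq_zero_iff.1 h
  have two_eq (h : ringChar F = 2) : (2 : F) = 0 := two_eq_zero_iff.2 h
  have three_eq (h : ringChar F = 3) : (3 : F) = 0 := three_eq_zero_iff.2 h
  exact ⟨⟨iUnion_lines hn, pairwiseDisjoint_lines hn⟩,
    ⟨fun _ => unisecantsInOsc_eq_union, fun _ => unisecantsNotInOsc_eq_union,
      fun _ h3 => passantsInOsc_eq_union (three_ne h3),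
      fun h3 => passantsMeetingAxis_eq_union (three_eq h3)⟩,
    row_O1, fun h3 => row_O1d (three_ne h3), row_O2, row_O3 hn,
    fun h3 => row_O3d (three_ne h3) hn, fun h2 => row_O4 (two_ne h2),
    fun h2 => row_O4minus (two_eq h2), fun h2 => row_O4plus (two_eq h2),
    fun h2 => row_O5minus (two_ne h2) (hd h2), fun h2 => row_O5plus (two_ne h2),
    fun h2 => row_O5_char2 (two_eq h2),
    fun h2 h3 => row_O5dminus (two_ne h2) (three_ne h3) (hv h2 h3),
    fun h2 h3 => row_O5dplus (two_ne h2) (three_ne h3), fun h2 => row_O5d_char2 (two_eq h2),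
    ⟨ncard_O6 hn hu hv hd, fun _ hL _ _ hc => hc.generic hL⟩,
    fun h3 => row_O7 (three_eq h3), fun h3 => row_O81minus (three_eq h3) (hu h3),
    fun h3 => row_O81plus (three_eq h3), fun h3 => row_O82 (three_eq h3)⟩
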